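/- **Setting.** Let $n,d,m,s\ge 1$ be integers, let $x_1,\dots,x_n\in\mathbb R^d$, let $\ell_1,\dots,\ell_n:\mathbb R\to\mathbb R$ be convex and twice differentiable, let $\lambda\ge 0$, and assume that $$f(w)=\frac1n\sum_{j=1}^n \ell_j(w^\top x_j)+\frac\lambda2\|w\|^2$$ is strongly convex, with minimizer $w^*$. Its gradient and Hessian at $w$ are $g(w)=\frac1n\sum_j\ell_j'(w^\top x_j)x_j+\lambda w$ and $H(w)=\frac1n\sum_j\ell_j''(w^\top x_j)x_jx_j^\top+\lambda I$. Assume that the Hessian is $L$-Lipschitz: $\|H(w)-H(w')\|_2\le L\|w-w'\|$ for all $w,w'$. There are $m$ machines. A fixed set $B$ of $\alpha m$ of them is Byzantine, and $0\le\alpha<\beta<1/2$. In round $t$, with current iterate $w_t$, machine $i$ holds indices $S_{i,t}=(j_1,\dots,j_s)$. The $ms$ indices held by the machines in round $t$ are drawn independently and uniformly from $\{1,\dots,n\}$ (with replacement), independently of $w_t$. A machine $i\notin B$ sends $\hat p_{i,t}=H_{i,t}^{-1}g_{i,t}$, where $g_{i,t}=\frac1s\sum_{r}\ell'_{j_r}(w_t^\top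 x_{j_r})x_{j_r}+\lambda w_t$ and $H_{i,t}=\frac1s\sum_{r}\ell''_{j_r}(w_t^\top x_{j_r})x_{j_r}x_{j_r}^\top+\lambda I$. A machine $i\in B$ sends an arbitrary vector $\hat p_{i,t}$, which may depend on everything. The center sorts the machines by $\|\hat p_{i,t}\|$ (ties broken in any way), keeps the set $\mathcal U_t$ of the $(1-\beta)m$ machines with the smallest norms, and sets $$w_{t+1}=w_t-\gamma\,\frac1{|\mathcal U_t|}\sum_{i\in\mathcal U_t}\hat p_{i,t},\qquad \gamma=1 .$$ **Notation.** Let $H_t=H(w_t)$ and $\Delta_t=w_t-w^*$. Let $\sigma_{\max}$, $\sigma_{\min}$ be the largest and smallest singular values and $\kappa_t=\sigma_{\max}(H_t)/\sigma_{\min}(H_t)$. Let $A_t\in\mathbb R^{n\times d}$ have $j$-th row $\sqrt{\ell_j''(w_t^\top x_j)}\,x_j^\top$, and let $\mu=\frac nd\max_j\|u_j\|^2$ be its row coherence, where $u_j$ is the $j$-th row of a matrix whose columns form an orthonormal basis of the column space of $A_t$. For $\eta,\delta\in(0,1)$ put $$\nu=\frac{\sigma_{\max}(A_t^\top A_t)}{\sigma_{\max}(A_t^\top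 A_t)+n\lambda},\qquad \epsilon=\frac1{1-\eta}\,\frac1{\sqrt{\sigma_{\min}(H_t)}}\Bigl(1+\sqrt{2\ln\tfrac m\delta}\Bigr)\sqrt{\tfrac1s}\,\max_j\|\ell_j'(w_t^\top x_j)x_j\|,$$ $$\epsilon_{byz}^2=\Bigl[3\Bigl(\frac{1-\alpha}{1-\beta}\Bigr)^2+4\kappa_t\Bigl(\frac{\alpha}{1-\beta}\Bigr)^2\Bigr]\epsilon^2,$$ $$\zeta_{byz}^2=2\Bigl(\frac{1-\alpha}{1-\beta}\Bigr)^2\Bigl(\frac{\nu}{1-\eta}\Bigr)^2+\nu^2\Bigl(\frac{1-\alpha}{1-\beta}\Bigr)^2\Bigl(\frac{\eta}{\sqrt{(1-\alpha)m}}+\frac{\eta^2}{1-\eta}\Bigr)^2+4\kappa_t\Bigl(\frac{\alpha}{1-\beta}\Bigr)^2\Bigl[2+\Bigl(\frac{\nu}{1-\eta}\Bigr)^2\Bigr].$$ **Theorem.** Let $\eta,\delta\in(0,1)$ and let $t\ge0$. Suppose that almost surely $s\ge\frac{3\mu d}{\eta^2}\log\frac{md}{\delta}$ and $\zeta_{byz}<1$.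 Then, with probability exceeding $1-\delta$, $$\|\Delta_{t+1}\|\le\max\Bigl\{\sqrt{\kappa_t\,\frac{\zeta_{byz}^2}{1-\zeta_{byz}^2}}\;\|\Delta_t\|,\ \frac{L}{\sigma_{\min}(H_t)}\|\Delta_t\|^2\Bigr\}+\frac{2\,\epsilon_{byz}}{\sqrt{\sigma_{\min}(H_t)}} .$$ -/

import Mathlib

open MeasureTheory ProbabilityTheory

noncomputable section

namespace Comrade

/-- Data of a regularized empirical risk: feature vectors `x_j ∈ ℝ^d`, scalar losses `ℓ_j`, and
the regularization parameter `λ`. -/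
structure Erm (n d : ℕ) where
  x : Fin n → EuclideanSpace ℝ (Fin d)
  ell : Fin n → ℝ → ℝ
  lam : ℝ

namespace Erm

variable {n d : ℕ} (D : Erm n d)

/-- `f(w) = (1/n) ∑_j ℓ_j(wᵀ x_j) + (λ/2) ‖w‖²`. -/
def loss (w : EuclideanSpace ℝ (Fin d)) : ℝ :=
  (1 / (n : ℝ)) * ∑ j, D.ell j (inner ℝ (D.x j) w) + D.lam / 2 * ‖w‖ ^ 2

/-- Gradient at `w` of the empirical risk over the listed samples `σ 0, …, σ (k-1)`
(a sample that is listed several times counts several times):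
`(1/k) ∑_r ℓ'_{σ r}(wᵀ x_{σ r}) x_{σ r} + λ w`. -/
def gradOn {k : ℕ} (σ : Fin k → Fin n) (w : EuclideanSpace ℝ (Fin d)) :
    EuclideanSpace ℝ (Fin d) :=
  (1 / (k : ℝ)) • ∑ r, deriv (D.ell (σ r)) (inner ℝ (D.x (σ r)) w) • D.x (σ r) + D.lam • w

/-- Hessian at `w` of the empirical risk over the listed samples:
`(1/k) ∑_r ℓ''_{σ r}(wᵀ x_{σ r}) x_{σ r} x_{σ r}ᵀ + λ I`. -/
def hessOn {k : ℕ} (σ : Fin k → Fin n) (w : EuclideanSpace ℝ (Fin d)) :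
    Matrix (Fin d) (Fin d) ℝ :=
  (1 / (k : ℝ)) • ∑ r, deriv (deriv (D.ell (σ r))) (inner ℝ (D.x (σ r)) w) •
      Matrix.vecMulVec (D.x (σ r)).ofLp (D.x (σ r)).ofLp
    + D.lam • (1 : Matrix (Fin d) (Fin d) ℝ)

/-- The exact gradient, over all `n` samples. -/
def grad (w : EuclideanSpace ℝ (Fin d)) : EuclideanSpace ℝ (Fin d) := D.gradOn id w

/-- The exact Hessian, over all `n` samples. -/
def hess (w : EuclideanSpace ℝ (Fin d)) : Matrix (Fin d) (Fin d) ℝ := D.hessOn id w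

/-- The second order update `H⁻¹ g` of a worker that holds the listed samples. -/
def localUpdate {k : ℕ} (σ : Fin k → Fin n) (w : EuclideanSpace ℝ (Fin d)) :
    EuclideanSpace ℝ (Fin d) :=
  Matrix.toEuclideanCLM (𝕜 := ℝ) (n := Fin d) (D.hessOn σ w)⁻¹ (D.gradOn σ w)

/-- The `n × d` matrix `A` whose `j`-th row is `√(ℓ''_j(wᵀ x_j)) x_jᵀ`. -/
def rowMat (w : EuclideanSpace ℝ (Fin d)) : Matrix (Fin n) (Fin d) ℝ :=
  Matrix.of fun j a => √(deriv (deriv (D.ell j)) (inner ℝ (D.x j) w)) * D.x j a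

/-- `max_j ‖b_j‖`, where `b_j = ℓ'_j(wᵀ x_j) x_j`. -/
def maxGradNorm (w : EuclideanSpace ℝ (Fin d)) : ℝ :=
  ⨆ j, ‖deriv (D.ell j) (inner ℝ (D.x j) w) • D.x j‖

end Erm

/-- Largest singular value of a square matrix. -/
def sigmaMax {d : ℕ} (M : Matrix (Fin d) (Fin d) ℝ) : ℝ :=
  (Matrix.toEuclideanLin M).singularValues 0

/-- Smallest singular value of a `d × d` matrix, `d ≥ 1`. -/
def sigmaMin {d : ℕ} (M : Matrix (Fin d) (Fin d) ℝ) : ℝ :=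
  (Matrix.toEuclideanLin M).singularValues (d - 1)

/-- Spectral norm of a square matrix. -/
def specNorm {d : ℕ} (M : Matrix (Fin d) (Fin d) ℝ) : ℝ :=
  ‖Matrix.toEuclideanCLM (𝕜 := ℝ) (n := Fin d) M‖

/-- The column space of a matrix. -/
def colSpace {n d : ℕ} (A : Matrix (Fin n) (Fin d) ℝ) : Submodule ℝ (EuclideanSpace ℝ (Fin n)) :=
  LinearMap.range (Matrix.toEuclideanLin A)

/-- Row coherence `(n/d) max_i ‖u_i‖²`, where `u_i` is the `i`-th row of a matrix `U` whose columns
form an orthonormal basis of the column space of `A` (the left singular vectors). -/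
def coherence {n d : ℕ} (A : Matrix (Fin n) (Fin d) ℝ) : ℝ :=
  (n : ℝ) / d * ⨆ i : Fin n,
    ∑ k, ((stdOrthonormalBasis ℝ (colSpace A) k : EuclideanSpace ℝ (Fin n)) i) ^ 2

namespace Erm

variable {n d : ℕ} (D : Erm n d)

/-- Condition number of the exact Hessian. -/
def kappa (w : EuclideanSpace ℝ (Fin d)) : ℝ := sigmaMax (D.hess w) / sigmaMin (D.hess w)

/-- `ν = σ_max(AᵀA) / (σ_max(AᵀA) + n λ)`. -/
def nu (w : EuclideanSpace ℝ (Fin d)) : ℝ :=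
  sigmaMax ((D.rowMat w).transpose * D.rowMat w) /
    (sigmaMax ((D.rowMat w).transpose * D.rowMat w) + n * D.lam)

/-- `ε`, for `m` workers with `s` samples each. -/
def eps (m s : ℕ) (η δ : ℝ) (w : EuclideanSpace ℝ (Fin d)) : ℝ :=
  1 / (1 - η) * (1 / √(sigmaMin (D.hess w))) * (1 + √(2 * Real.log (m / δ))) * √(1 / (s : ℝ)) *
    D.maxGradNorm w

/-- `ε_byz`. -/
def epsByz (m s : ℕ) (α β η δ : ℝ) (w : EuclideanSpace ℝ (Fin d)) : ℝ :=
  √((3 * ((1 - α) / (1 - β)) ^ 2 + 4 * D.kappa w * (α / (1 - β)) ^ 2) * D.eps m s η δ w ^ 2)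

/-- `ζ_byz`. -/
def zetaByz (m : ℕ) (α β η : ℝ) (w : EuclideanSpace ℝ (Fin d)) : ℝ :=
  √(2 * ((1 - α) / (1 - β)) ^ 2 * (D.nu w / (1 - η)) ^ 2
    + D.nu w ^ 2 * ((1 - α) / (1 - β)) ^ 2 * (η / √((1 - α) * m) + η ^ 2 / (1 - η)) ^ 2
    + 4 * D.kappa w * (α / (1 - β)) ^ 2 * (2 + (D.nu w / (1 - η)) ^ 2))

end Erm

/-- `U` is an admissible set of untrimmed machines for the received vectors `p` and the trimming
fraction `β`: the `(1-β)m` machines that come first when the machines are sorted by the norm of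
their vectors, ties being broken in any way. -/
structure IsTrimmed {m d : ℕ} (β : ℝ) (p : Fin m → EuclideanSpace ℝ (Fin d))
    (U : Finset (Fin m)) : Prop where
  card_eq : (U.card : ℝ) = (1 - β) * m
  norm_le : ∀ i ∈ U, ∀ j ∉ U, ‖p i‖ ≤ ‖p j‖

/-- `w` is a trajectory, with step size `γ`, of the trimmed approximate Newton method in which the
machines of `B` are Byzantine: in round `t`, machine `i` holds the samples `S t i` and sends the
vector `p t i`, on which nothing is required if `i ∈ B`; the center keeps the machines of `U t`. -/
structure IsRun {n d m s : ℕ} (D : Erm n d) (B : Finset (Fin m)) (β γ : ℝ)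
    (S : ℕ → Fin m → Fin s → Fin n) (p : ℕ → Fin m → EuclideanSpace ℝ (Fin d))
    (U : ℕ → Finset (Fin m)) (w : ℕ → EuclideanSpace ℝ (Fin d)) : Prop where
  honest : ∀ t, ∀ i ∉ B, p t i = D.localUpdate (S t i) (w t)
  trimmed : ∀ t, IsTrimmed β (p t) (U t)
  step : ∀ t, w (t + 1) = w t - γ • ((1 / ((U t).card : ℝ)) • ∑ i ∈ U t, p t i)

namespace Erm

/-- `grad` is the gradient of the loss. -/
theorem hasGradientAt_loss {n d : ℕ} (D : Erm n d) (h1 : ∀ j, Differentiable ℝ (D.ell j))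
    (w : EuclideanSpace ℝ (Fin d)) : HasGradientAt D.loss (D.grad w) w := by
  rw [hasGradientAt_iff_hasFDerivAt]
  have hj : ∀ j ∈ Finset.univ, HasFDerivAt (fun v => D.ell j (inner ℝ (D.x j) v))
      (deriv (D.ell j) (inner ℝ (D.x j) w) • innerSL ℝ (D.x j)) w := fun j _ =>
    ((h1 j _).hasDerivAt).comp_hasFDerivAt w (innerSL ℝ (D.x j)).hasFDerivAt
  have h := ((HasFDerivAt.fun_sum hj).const_mul (1 / (n : ℝ))).add
    (((hasStrictFDerivAt_norm_sq w).hasFDerivAt).const_mul (D.lam / 2))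
  refine h.congr_fderiv ?_
  ext v
  simp [grad, gradOn, two_smul]
  ring

/-- `hess` is the derivative of the gradient of the loss. -/
theorem hasFDerivAt_grad {n d : ℕ} (D : Erm n d) (h2 : ∀ j, Differentiable ℝ (deriv (D.ell j)))
    (w : EuclideanSpace ℝ (Fin d)) :
    HasFDerivAt D.grad (Matrix.toEuclideanCLM (𝕜 := ℝ) (n := Fin d) (D.hess w)) w := by
  have hj : ∀ j ∈ Finset.univ, HasFDerivAt
      (fun v => deriv (D.ell j) (inner ℝ (D.x j) v) • D.x j)
      ((deriv (deriv (D.ell j)) (inner ℝ (D.x j) w) • innerSL ℝ (D.x j)).smulRight (D.x j)) w :=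
    fun j _ => (((h2 j _).hasDerivAt).comp_hasFDerivAt w
      (innerSL ℝ (D.x j)).hasFDerivAt).smul_const (D.x j)
  have h := ((HasFDerivAt.fun_sum hj).const_smul (1 / (n : ℝ))).add
    ((hasFDerivAt_id w).const_smul D.lam)
  refine h.congr_fderiv ?_
  ext v i
  simp [hess, hessOn,
    Matrix.vecMulVec_mulVec, PiLp.inner_apply, dotProduct, mul_comm, mul_left_comm]

end Erm

end Comrade

end

/-! Call the sample of a machine typical if its unregularized Hessian agrees with the exact one, as
a quadratic form, up to the relative error `h = a η (1 + η/3)`, and if its gradient is off by at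
most `2√3 (1 + √(2 ln (m/δ))) √(1/s)` times the largest `‖ℓ'_j x_j‖`. The factor `a` is `slack m`.

Randomness enters only through one claim: some honest sample is atypical with probability at most
`0.95 δ`. The Hessian part is a matrix Chernoff bound (Golden-Thompson, one draw at a time) for the
matrices `n u_j u_jᵀ`, which average to the identity and are bounded by `μ d`. The gradient part is
Hoeffding's inequality in a Hilbert space, through the potential `cosh ‖·‖`. Samples are uniform on
a finite set, so both bounds count bad samples; independence of `w_t` and Fubini turn the counts
into probabilities.

When all honest samples are typical, the step is deterministic. Let `q = H⁻¹ g` be the exact Newton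
direction, `G` the Hessian averaged over the segment from `w*` to `w_t`, so that `G Δ = g`, `r` the
Byzantine fraction of the kept machines, `b = L ‖Δ‖ / (2 σ_min)` and `τ = ν h`. Then `(1 - ν) H ≤ λ
I ≤ G`, and the Lipschitz condition gives `|H - G| ≤ b σ_min`. An honest message differs from `q` by
at most `√κ (1 + b) ‖Δ‖ τ / (1 - τ)` plus gradient noise. A kept Byzantine message is no longer than
that of some honest machine that was trimmed, which exists because `|U| + |B| < m`. Comparing the
average with `(1 - r) q` in the energy norm `√⟨u, H u⟩` (`norm_sub_trimmed_average_le`) yields the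
factor `√κ max (r + (1 - r) ν) ((1 - r) b - r) + (r + √κ τ / (1 - τ)) (1 + b)`. The scalar
inequality `trimmed_newton_factor_le` bounds it by `max (√κ ζ / √(1 - ζ²)) (2 b)`. It needs only `2
Y² + 8 κ r² ≤ ζ²`, with `Y = a ν / (1 - η)`, and `κ (1 - ν) ≤ 1`.

The assumption `ζ_byz < 1` also forces `ν < 1`, hence `λ > 0`, which makes every sampled Hessian
invertible. -/

/-! ### The Lie product formula -/

section Trotter

open Filter Topology NormedSpace

variable {𝔸 : Type*} [NormedRing 𝔸] [NormedAlgebra ℝ 𝔸] [CompleteSpace 𝔸] [NormOneClass 𝔸]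

theorem norm_exp_le_exp_norm (x : 𝔸) : ‖exp x‖ ≤ Real.exp ‖x‖ := by
  have h := NormedSpace.exp_series_hasSum_exp' (𝕂 := ℝ) x
  have h2 := NormedSpace.exp_series_hasSum_exp' (𝕂 := ℝ) ‖x‖
  rw [← Real.exp_eq_exp_ℝ] at h2
  rw [← h.tsum_eq]
  refine tsum_of_norm_bounded h2 fun n => ?_
  rw [norm_smul, Real.norm_eq_abs, abs_of_nonneg (by positivity), smul_eq_mul]
  gcongr
  exact norm_pow_le x n

/-- Telescoping: `x^(k+1) - y^(k+1) = x^k (x - y) + (x^k - y^k) y`. -/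
theorem norm_pow_sub_pow_le {𝔸 : Type*} [NormedRing 𝔸] [NormOneClass 𝔸] {x y : 𝔸} {M : ℝ}
    (hx : ‖x‖ ≤ M) (hy : ‖y‖ ≤ M) (n : ℕ) :
    ‖x ^ n - y ^ n‖ ≤ n * M ^ (n - 1) * ‖x - y‖ := by
  have hM : 0 ≤ M := (norm_nonneg x).trans hx
  induction n with
  | zero => simp
  | succ k ih =>
    have e : x ^ (k + 1) - y ^ (k + 1) = x ^ k * (x - y) + (x ^ k - y ^ k) * y := by
      rw [pow_succ, pow_succ]; noncomm_ring
    rw [e]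
    refine (norm_add_le _ _).trans ?_
    have h1 : ‖x ^ k * (x - y)‖ ≤ M ^ k * ‖x - y‖ := by
      refine (norm_mul_le _ _).trans ?_
      gcongr
      exact (norm_pow_le x k).trans (by gcongr)
    have h2 : ‖(x ^ k - y ^ k) * y‖ ≤ k * M ^ (k - 1) * ‖x - y‖ * M := by
      refine (norm_mul_le _ _).trans ?_
      gcongr
    have h3 : (k : ℝ) * M ^ (k - 1) * ‖x - y‖ * M = k * M ^ k * ‖x - y‖ := by
      rcases k with _ | k
      · simp
      · simp only [Nat.add_sub_cancel, pow_succ]; ring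
    rw [h3] at h2
    push_cast
    linarith

/-- The Lie product formula. -/
theorem tendsto_exp_mul_exp_pow (A B : 𝔸) :
    Tendsto (fun N : ℕ => (exp ((N : ℝ)⁻¹ • A) * exp ((N : ℝ)⁻¹ • B)) ^ N) atTop
      (𝓝 (exp (A + B))) := by
  -- Both curves pass through `1` at time `0` with velocity `A + B`, so their difference at time
  -- `1/N` is `o(1/N)`; telescoping the `N`-th powers costs only a factor of order `N`.
  have hd : HasDerivAt (fun t : ℝ => exp (t • A) * exp (t • B) - exp (t • (A + B))) 0 0 := by
    have h := ((hasDerivAt_exp_smul_const (𝕂 := ℝ) A (0 : ℝ)).mul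
      (hasDerivAt_exp_smul_const (𝕂 := ℝ) B (0 : ℝ))).sub
      (hasDerivAt_exp_smul_const (𝕂 := ℝ) (A + B) (0 : ℝ))
    refine (h.congr_deriv (by simp)).congr_of_eventuallyEq (Eventually.of_forall fun t => by simp)
  have hs : Tendsto (fun N : ℕ => (N : ℝ) • (exp ((N : ℝ)⁻¹ • A) * exp ((N : ℝ)⁻¹ • B)
      - exp ((N : ℝ)⁻¹ • (A + B)))) atTop (𝓝 0) := by
    have h := hd.tendsto_slope_zero
    have hN : Tendsto (fun N : ℕ => ((N : ℝ))⁻¹) atTop (𝓝[≠] 0) := by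
      rw [tendsto_nhdsWithin_iff]
      refine ⟨tendsto_inv_atTop_nhds_zero_nat, ?_⟩
      filter_upwards [eventually_gt_atTop 0] with N hN
      simp [hN.ne']
    have h2 := h.comp hN
    refine h2.congr fun N => ?_
    simp
  rw [tendsto_iff_norm_sub_tendsto_zero]
  set C := Real.exp (‖A‖ + ‖B‖) with hC
  have hb : Tendsto (fun N : ℕ => C * ‖(N : ℝ) • (exp ((N : ℝ)⁻¹ • A) * exp ((N : ℝ)⁻¹ • B)
      - exp ((N : ℝ)⁻¹ • (A + B)))‖) atTop (𝓝 0) := by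
    simpa using (hs.norm.const_mul C)
  refine squeeze_zero' (Eventually.of_forall fun _ => norm_nonneg _) ?_ hb
  filter_upwards [eventually_gt_atTop 0] with N hN
  have hN0 : (N : ℝ) ≠ 0 := by exact_mod_cast hN.ne'
  set M := Real.exp ((N : ℝ)⁻¹ * (‖A‖ + ‖B‖)) with hM
  have hnorm : ∀ X : 𝔸, ‖(N : ℝ)⁻¹ • X‖ = (N : ℝ)⁻¹ * ‖X‖ := fun X => by
    rw [norm_smul, Real.norm_eq_abs, abs_of_nonneg (by positivity)]
  have h1 : ‖exp ((N : ℝ)⁻¹ • A) * exp ((N : ℝ)⁻¹ • B)‖ ≤ M := by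
    refine (norm_mul_le _ _).trans ?_
    rw [hM, mul_add, Real.exp_add, ← hnorm, ← hnorm]
    gcongr <;> exact norm_exp_le_exp_norm _
  have h2 : ‖exp ((N : ℝ)⁻¹ • (A + B))‖ ≤ M := by
    refine (norm_exp_le_exp_norm _).trans ?_
    rw [hnorm, hM]
    gcongr
    exact norm_add_le _ _
  have e : exp (A + B) = exp ((N : ℝ)⁻¹ • (A + B)) ^ N := by
    let _ : NormedAlgebra ℚ 𝔸 := NormedAlgebra.restrictScalars ℚ ℝ 𝔸
    rw [← NormedSpace.exp_nsmul, ← Nat.cast_smul_eq_nsmul ℝ, smul_smul, mul_inv_cancel₀ hN0,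
      one_smul]
  rw [e]
  refine (norm_pow_sub_pow_le h1 h2 N).trans ?_
  rw [norm_smul, Real.norm_eq_abs, abs_of_nonneg (Nat.cast_nonneg N)]
  have h3 : M ^ (N - 1) ≤ C := by
    calc M ^ (N - 1) ≤ M ^ N := pow_le_pow_right₀ (Real.one_le_exp (by positivity)) (by omega)
      _ = C := by rw [hM, hC, ← Real.exp_nat_mul]; congr 1; field_simp
  calc (N : ℝ) * M ^ (N - 1) * _ ≤ (N : ℝ) * C * _ := by gcongr
    _ = _ := by ring

end Trotter

/-! ### The Golden-Thompson inequality -/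

section GoldenThompson

open Matrix

variable {ι : Type*} [Fintype ι] [DecidableEq ι]

theorem Matrix.trace_mul_pow_comm (A B : Matrix ι ι ℝ) (k : ℕ) :
    trace ((A * B) ^ k) = trace ((B * A) ^ k) := by
  rcases k with _ | k
  · simp
  · have h : ∀ k : ℕ, (A * B) ^ k * A = A * (B * A) ^ k := fun k => by
      induction k with
      | zero => simp
      | succ k ih => rw [pow_succ', Matrix.mul_assoc (A * B), ih, pow_succ']; simp only [Matrix.mul_assoc]
    rw [pow_succ, ← Matrix.mul_assoc, h, Matrix.mul_assoc, trace_mul_comm, pow_succ, Matrix.mul_assoc]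

theorem Matrix.trace_mul_transpose_self_nonneg {ι : Type*} [Fintype ι] (A : Matrix ι ι ℝ) :
    0 ≤ trace (A * Aᵀ) := by
  simp only [trace, diag_apply, mul_apply, transpose_apply]
  exact Finset.sum_nonneg fun i _ => Finset.sum_nonneg fun j _ => mul_self_nonneg _

theorem Matrix.two_mul_trace_mul_le {ι : Type*} [Fintype ι] (A B : Matrix ι ι ℝ) :
    2 * trace (A * B) ≤ trace (A * Aᵀ) + trace (B * Bᵀ) := by
  have h := trace_mul_transpose_self_nonneg (A - Bᵀ)
  have e : trace (Bᵀ * B) = trace (B * Bᵀ) := trace_mul_comm _ _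
  have e2 : trace (Bᵀ * Aᵀ) = trace (A * B) := by rw [← transpose_mul, trace_transpose]
  simp only [transpose_sub, transpose_transpose, Matrix.sub_mul, Matrix.mul_sub, trace_sub] at h
  linarith

/-- The two statements feed each other. The first at `k + 1` applies the first at `k` to `Z²`,
regroups cyclically into `(ZᵀZ)(ZZᵀ)`, splits by the second, and closes with the Frobenius
inequality `2 tr(AB) ≤ tr(AAᵀ) + tr(BBᵀ)`. The second at `k + 1` applies the first at `k` to `XY`,
whose `ZZᵀ` is cyclically `X²Y²`. Positivity of `X` and `Y` plays no role. -/
theorem Matrix.trace_pow_two_pow_le (k : ℕ) :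
    (∀ Z : Matrix ι ι ℝ, trace (Z ^ 2 ^ (k + 1)) ≤ trace ((Z * Zᵀ) ^ 2 ^ k)) ∧
    ∀ X Y : Matrix ι ι ℝ, Xᵀ = X → Yᵀ = Y →
      trace ((X * Y) ^ 2 ^ k) ≤ trace (X ^ 2 ^ k * Y ^ 2 ^ k) := by
  induction k with
  | zero =>
    refine ⟨fun Z => ?_, fun X Y _ _ => by simp⟩
    have := two_mul_trace_mul_le Z Z
    simp only [pow_zero, zero_add, pow_one, sq]
    linarith
  | succ k ih =>
    obtain ⟨hC, hD⟩ := ih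
    have hsq : ∀ (W : Matrix ι ι ℝ) (j : ℕ), W ^ 2 ^ (j + 1) = (W * W) ^ 2 ^ j := fun W j => by
      rw [pow_succ', pow_mul, sq]
    refine ⟨fun Z => ?_, fun X Y hX hY => ?_⟩
    · rw [hsq Z]
      refine (hC (Z * Z)).trans ?_
      have e1 : trace ((Z * Z * (Z * Z)ᵀ) ^ 2 ^ k) = trace (((Zᵀ * Z) * (Z * Zᵀ)) ^ 2 ^ k) := by
        rw [transpose_mul, show Z * Z * (Zᵀ * Zᵀ) = (Z * Z * Zᵀ) * Zᵀ by
          simp only [Matrix.mul_assoc], trace_mul_pow_comm]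
        simp only [Matrix.mul_assoc]
      rw [e1]
      have hP : (Zᵀ * Z)ᵀ = Zᵀ * Z := by simp [transpose_mul]
      have hQ : (Z * Zᵀ)ᵀ = Z * Zᵀ := by simp [transpose_mul]
      refine (hD _ _ hP hQ).trans ?_
      have h := two_mul_trace_mul_le ((Zᵀ * Z) ^ 2 ^ k) ((Z * Zᵀ) ^ 2 ^ k)
      rw [transpose_pow, transpose_pow, hP, hQ, ← pow_add, ← pow_add, ← two_mul, ← pow_succ',
        trace_mul_pow_comm Zᵀ Z] at h
      linarith
    · rw [hsq X, hsq Y]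
      refine (hC _).trans ?_
      rw [transpose_mul, hX, hY, show X * Y * (Y * X) = (X * (Y * Y)) * X by
        simp only [Matrix.mul_assoc], trace_mul_pow_comm, ← Matrix.mul_assoc]
      exact hD _ _ (by rw [transpose_mul, hX]) (by rw [transpose_mul, hY])

attribute [local instance] Matrix.linftyOpNormedRing Matrix.linftyOpNormedAlgebra in
/-- The Golden-Thompson inequality. -/
theorem Matrix.trace_exp_add_le (A B : Matrix ι ι ℝ) (hA : Aᵀ = A) (hB : Bᵀ = B) :
    trace (NormedSpace.exp (A + B)) ≤ trace (NormedSpace.exp A * NormedSpace.exp B) := by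
  rcases isEmpty_or_nonempty ι with hι | hι
  · simp [trace]
  let _ : NormOneClass (Matrix ι ι ℝ) := Matrix.linfty_opNormOneClass
  have ht := tendsto_exp_mul_exp_pow A B
  -- The trace inequality is available for exponents `2^k` only, so the product formula is used
  -- along this subsequence.
  have h2 : Filter.Tendsto (fun k : ℕ => 2 ^ k) Filter.atTop (Filter.atTop : Filter ℕ) :=
    tendsto_pow_atTop_atTop_of_one_lt (by norm_num)
  have hc : Continuous (fun M : Matrix ι ι ℝ => trace M) := continuous_id.matrix_trace
  refine le_of_tendsto ((hc.tendsto _).comp (ht.comp h2)) (Filter.Eventually.of_forall fun k => ?_)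
  have hs : ∀ M : Matrix ι ι ℝ, Mᵀ = M →
      (NormedSpace.exp (((2 ^ k : ℕ) : ℝ)⁻¹ • M))ᵀ = NormedSpace.exp (((2 ^ k : ℕ) : ℝ)⁻¹ • M) :=
    fun M hM => by rw [← Matrix.exp_transpose, transpose_smul, hM]
  have hp : ∀ M : Matrix ι ι ℝ,
      (NormedSpace.exp (((2 ^ k : ℕ) : ℝ)⁻¹ • M)) ^ 2 ^ k = NormedSpace.exp M := fun M => by
    rw [← Matrix.exp_nsmul, ← Nat.cast_smul_eq_nsmul ℝ, smul_smul, mul_inv_cancel₀ (by positivity),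
      one_smul]
  have h := (trace_pow_two_pow_le k).2 _ _ (hs A hA) (hs B hB)
  rwa [hp, hp] at h

end GoldenThompson

/-! ### Matrix Chernoff bounds for sampling with replacement -/

section MatrixChernoff

open Matrix

variable {ι : Type*} [Fintype ι] [DecidableEq ι]

theorem Matrix.exists_orthogonal_diagonalization (M : Matrix ι ι ℝ) (hM : Mᵀ = M) :
    ∃ (V : Matrix ι ι ℝ) (l : ι → ℝ), V * Vᵀ = 1 ∧ Vᵀ * V = 1 ∧ M = V * diagonal l * Vᵀ := by
  have hH : M.IsHermitian := by
    rw [IsHermitian, conjTranspose_eq_transpose_of_trivial, hM]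
  refine ⟨hH.eigenvectorUnitary, hH.eigenvalues, ?_, ?_, ?_⟩
  · have := Unitary.coe_mul_star_self hH.eigenvectorUnitary
    rwa [Unitary.coe_star, star_eq_conjTranspose, conjTranspose_eq_transpose_of_trivial] at this
  · have := Unitary.coe_star_mul_self hH.eigenvectorUnitary
    rwa [star_eq_conjTranspose, conjTranspose_eq_transpose_of_trivial] at this
  · have h := hH.spectral_theorem
    rw [Unitary.conjStarAlgAut_apply, star_eq_conjTranspose,
      conjTranspose_eq_transpose_of_trivial] at h
    exact h

theorem Matrix.exp_orthogonal_conj_diagonal {V : Matrix ι ι ℝ} (h1 : V * Vᵀ = 1)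
    (l : ι → ℝ) : NormedSpace.exp (V * diagonal l * Vᵀ) =
      V * diagonal (fun i => Real.exp (l i)) * Vᵀ := by
  have hinv : V⁻¹ = Vᵀ := inv_eq_right_inv h1
  have hu : IsUnit V := (isUnit_iff_isUnit_det V).2 (isUnit_det_of_right_inverse h1)
  rw [← hinv, exp_conj V _ hu, exp_diagonal]
  congr 3
  ext i
  rw [Pi.coe_exp, Real.exp_eq_exp_ℝ]

theorem Matrix.dotProduct_orthogonal_conj_diagonal (V : Matrix ι ι ℝ) (l v : ι → ℝ) :
    v ⬝ᵥ (V * diagonal l * Vᵀ) *ᵥ v = ∑ i, l i * (Vᵀ *ᵥ v) i ^ 2 := by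
  rw [← mulVec_mulVec, ← mulVec_mulVec, dotProduct_mulVec, ← mulVec_transpose]
  simp only [dotProduct, mulVec_diagonal]
  exact Finset.sum_congr rfl fun i _ => by ring

theorem Matrix.dotProduct_self_orthogonal {V : Matrix ι ι ℝ} (h1 : V * Vᵀ = 1) (v : ι → ℝ) :
    v ⬝ᵥ v = ∑ i, (Vᵀ *ᵥ v) i ^ 2 := by
  have h := dotProduct_orthogonal_conj_diagonal V (fun _ => 1) v
  simpa [h1] using h

/-- A Rayleigh quotient that is at least `τ` forces some eigenvalue to be at least `τ`, and the
trace of the exponential dominates each of its positive eigenvalues. -/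
theorem Matrix.exp_le_trace_exp {M : Matrix ι ι ℝ} (hM : Mᵀ = M) {v : ι → ℝ} (hv : v ≠ 0) {τ : ℝ}
    (h : τ * (v ⬝ᵥ v) ≤ v ⬝ᵥ M *ᵥ v) : Real.exp τ ≤ trace (NormedSpace.exp M) := by
  obtain ⟨V, l, h1, h2, rfl⟩ := exists_orthogonal_diagonalization M hM
  rw [exp_orthogonal_conj_diagonal h1, trace_mul_comm, ← Matrix.mul_assoc, h2, Matrix.one_mul,
    trace_diagonal]
  rw [dotProduct_self_orthogonal h1, dotProduct_orthogonal_conj_diagonal, Finset.mul_sum] at h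
  have hne : Vᵀ *ᵥ v ≠ 0 := fun h0 => hv (by
    rw [← one_mulVec v, ← h1, ← mulVec_mulVec, h0, mulVec_zero])
  have : ∃ i, τ ≤ l i := by
    by_contra! hlt
    obtain ⟨i, hi⟩ := Function.ne_iff.1 hne
    refine absurd h (not_le.2 (Finset.sum_lt_sum (fun j _ => ?_) ⟨i, Finset.mem_univ _, ?_⟩))
    · exact mul_le_mul_of_nonneg_right (hlt j).le (sq_nonneg _)
    · exact mul_lt_mul_of_pos_right (hlt i) (by have := sq_pos_of_ne_zero hi; simpa using this)
  obtain ⟨i, hi⟩ := this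
  exact (Real.exp_le_exp.2 hi).trans
    (Finset.single_le_sum (fun j _ => (Real.exp_pos (l j)).le) (Finset.mem_univ i))

theorem Matrix.dotProduct_exp_mulVec_nonneg {A : Matrix ι ι ℝ} (hA : Aᵀ = A) (v : ι → ℝ) :
    0 ≤ v ⬝ᵥ NormedSpace.exp A *ᵥ v := by
  obtain ⟨V, l, h1, h2, rfl⟩ := exists_orthogonal_diagonalization A hA
  rw [exp_orthogonal_conj_diagonal h1, dotProduct_orthogonal_conj_diagonal]
  exact Finset.sum_nonneg fun i _ => mul_nonneg (Real.exp_pos _).le (sq_nonneg _)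

theorem Matrix.trace_exp_nonneg {A : Matrix ι ι ℝ} (hA : Aᵀ = A) :
    0 ≤ trace (NormedSpace.exp A) := by
  refine Finset.sum_nonneg fun i _ => ?_
  simpa using dotProduct_exp_mulVec_nonneg hA (Pi.single i 1)

theorem Real.exp_mul_le_chord {R x : ℝ} (θ : ℝ) (hR : 0 < R) (h0 : 0 ≤ x) (h1 : x ≤ R) :
    Real.exp (θ * x) ≤ 1 + (Real.exp (θ * R) - 1) / R * x := by
  have h := convexOn_exp.2 (Set.mem_univ 0) (Set.mem_univ (θ * R))
    (sub_nonneg.2 ((div_le_one hR).2 h1)) (div_nonneg h0 hR.le) (sub_add_cancel 1 (x / R))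
  simp only [smul_eq_mul, mul_zero, zero_add, Real.exp_zero, mul_one] at h
  rw [show x / R * (θ * R) = θ * x by field_simp] at h
  refine h.trans (le_of_eq ?_)
  field_simp
  ring

/-- In an eigenbasis of `X` the trace sees only the diagonal of `P`, which is nonnegative; there the
scalar chord bound on `[0, R]` applies, although `P` and `X` need not commute. -/
theorem Matrix.trace_mul_exp_smul_le {P X : Matrix ι ι ℝ} (hP : ∀ v, 0 ≤ v ⬝ᵥ P *ᵥ v)
    (hX : Xᵀ = X) {R : ℝ} (hR : 0 < R) (hX0 : ∀ v, 0 ≤ v ⬝ᵥ X *ᵥ v)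
    (hXR : ∀ v, v ⬝ᵥ X *ᵥ v ≤ R * (v ⬝ᵥ v)) (θ : ℝ) :
    trace (P * NormedSpace.exp (θ • X)) ≤
      trace P + (Real.exp (θ * R) - 1) / R * trace (P * X) := by
  obtain ⟨V, l, h1, h2, rfl⟩ := exists_orthogonal_diagonalization X hX
  have hl : ∀ i, 0 ≤ l i ∧ l i ≤ R := fun i => by
    have e : Vᵀ *ᵥ (V *ᵥ Pi.single i 1) = Pi.single i 1 := by rw [mulVec_mulVec, h2, one_mulVec]
    have h3 := hX0 (V *ᵥ Pi.single i 1)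
    have h4 := hXR (V *ᵥ Pi.single i 1)
    rw [dotProduct_orthogonal_conj_diagonal, e] at h3 h4
    rw [dotProduct_self_orthogonal h1, e] at h4
    simp only [Pi.single_apply, ite_pow, one_pow, ne_eq, OfNat.ofNat_ne_zero, not_false_eq_true,
      zero_pow, mul_ite, mul_one, mul_zero, Finset.sum_ite_eq', Finset.mem_univ, if_true] at h3 h4
    exact ⟨h3, h4⟩
  have key : ∀ g : ι → ℝ, trace (P * (V * diagonal g * Vᵀ)) =
      ∑ i, (V *ᵥ Pi.single i 1) ⬝ᵥ P *ᵥ (V *ᵥ Pi.single i 1) * g i := fun g => by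
    rw [← Matrix.mul_assoc, trace_mul_comm, ← Matrix.mul_assoc, ← Matrix.mul_assoc]
    simp only [trace, diag_apply, mul_diagonal]
    refine Finset.sum_congr rfl fun i _ => ?_
    congr 1
    rw [mulVec_mulVec, ← vecMul_transpose, ← dotProduct_mulVec, mulVec_mulVec, ← Matrix.mul_assoc]
    simp
  have hsm : θ • (V * diagonal l * Vᵀ) = V * diagonal (fun i => θ * l i) * Vᵀ := by
    rw [show (fun i => θ * l i) = θ • l from rfl, diagonal_smul, Matrix.mul_smul, Matrix.smul_mul]
  have h1' : trace P = trace (P * (V * diagonal (fun _ => 1) * Vᵀ)) := by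
    simp [h1]
  rw [hsm, exp_orthogonal_conj_diagonal h1, h1', key, key, key, Finset.mul_sum,
    ← Finset.sum_add_distrib]
  refine Finset.sum_le_sum fun i _ => ?_
  have := mul_le_mul_of_nonneg_left (Real.exp_mul_le_chord θ hR (hl i).1 (hl i).2)
    (hP (V *ᵥ Pi.single i 1))
  linarith

/-- Exponential moment of a sum of `s` independent uniform draws from a family of matrices with
spectrum in `[0, R]` and average `1`. -/
theorem Matrix.sum_trace_exp_add_le {n : ℕ} (X : Fin n → Matrix ι ι ℝ) (hX : ∀ j, (X j)ᵀ = X j)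
    {R : ℝ} (hR : 0 < R) (hX0 : ∀ j v, 0 ≤ v ⬝ᵥ X j *ᵥ v)
    (hXR : ∀ j v, v ⬝ᵥ X j *ᵥ v ≤ R * (v ⬝ᵥ v)) (hsum : ∑ j, X j = (n : ℝ) • 1) (θ : ℝ) (s : ℕ)
    (A : Matrix ι ι ℝ) (hA : Aᵀ = A) :
    ∑ σ : Fin s → Fin n, trace (NormedSpace.exp (A + θ • ∑ r, X (σ r))) ≤
      (n * Real.exp ((Real.exp (θ * R) - 1) / R)) ^ s * trace (NormedSpace.exp A) := by
  induction s generalizing A with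
  | zero => simp
  | succ s ih =>
    rw [← (Fin.consEquiv fun _ => Fin n).sum_comp, Fintype.sum_prod_type]
    have e : ∀ (j : Fin n) (σ : Fin s → Fin n),
        A + θ • ∑ r, X ((Fin.consEquiv fun _ => Fin n) (j, σ) r) =
          (A + θ • X j) + θ • ∑ r, X (σ r) := fun j σ => by
      rw [Fin.sum_univ_succ, smul_add, add_assoc]; simp [Fin.consEquiv]
    simp only [e]
    have hs : ∀ j, (A + θ • X j)ᵀ = A + θ • X j := fun j => by simp [hA, hX]
    -- One draw: Golden-Thompson separates `X j` from the matrix `A` of the earlier draws, and the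
    -- average `1` of the `X j` replaces `X j` after the chord bound.
    have hstep : ∑ j, trace (NormedSpace.exp (A + θ • X j)) ≤
        n * Real.exp ((Real.exp (θ * R) - 1) / R) * trace (NormedSpace.exp A) := by
      calc _ ≤ ∑ j, (trace (NormedSpace.exp A) +
              (Real.exp (θ * R) - 1) / R * trace (NormedSpace.exp A * X j)) := by
            refine Finset.sum_le_sum fun j _ => ?_
            exact (trace_exp_add_le A (θ • X j) hA (by simp [hX])).trans
              (trace_mul_exp_smul_le (dotProduct_exp_mulVec_nonneg hA) (hX j) hR (hX0 j) (hXR j) θ)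
        _ = n * (((Real.exp (θ * R) - 1) / R + 1) * trace (NormedSpace.exp A)) := by
            rw [Finset.sum_add_distrib, ← Finset.mul_sum, ← trace_sum Finset.univ
              (fun j => NormedSpace.exp A * X j), ← Finset.mul_sum, hsum]
            simp
            ring
        _ ≤ n * (Real.exp ((Real.exp (θ * R) - 1) / R) * trace (NormedSpace.exp A)) := by
            gcongr
            · exact trace_exp_nonneg hA
            · exact Real.add_one_le_exp _
        _ = _ := by ring
    calc _ ≤ ∑ j, (n * Real.exp ((Real.exp (θ * R) - 1) / R)) ^ s *
          trace (NormedSpace.exp (A + θ • X j)) := Finset.sum_le_sum fun j _ => ih _ (hs j)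
      _ ≤ (n * Real.exp ((Real.exp (θ * R) - 1) / R)) ^ s *
          (n * Real.exp ((Real.exp (θ * R) - 1) / R) * trace (NormedSpace.exp A)) := by
        rw [← Finset.mul_sum]
        gcongr
      _ = _ := by ring

/-- Markov's inequality for the trace exponential: the number of samples for which `∑ r, X (σ r)`
has quadratic form at least `t`, scaled by `θ`, in some direction. -/
theorem Matrix.card_exists_mulVec_ge_le {n : ℕ} (X : Fin n → Matrix ι ι ℝ)
    (hX : ∀ j, (X j)ᵀ = X j) {R : ℝ} (hR : 0 < R) (hX0 : ∀ j v, 0 ≤ v ⬝ᵥ X j *ᵥ v)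
    (hXR : ∀ j v, v ⬝ᵥ X j *ᵥ v ≤ R * (v ⬝ᵥ v)) (hsum : ∑ j, X j = (n : ℝ) • 1) (θ : ℝ) (s : ℕ)
    (t : ℝ) (bad : Finset (Fin s → Fin n))
    (hbad : ∀ σ ∈ bad, ∃ v : ι → ℝ, v ≠ 0 ∧ θ * t * (v ⬝ᵥ v) ≤ θ * (v ⬝ᵥ (∑ r, X (σ r)) *ᵥ v)) :
    (bad.card : ℝ) ≤ n ^ s * (Fintype.card ι *
      Real.exp (s * ((Real.exp (θ * R) - 1) / R) - θ * t)) := by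
  have h1 : ∀ σ : Fin s → Fin n, (θ • ∑ r, X (σ r))ᵀ = θ • ∑ r, X (σ r) := fun σ => by
    rw [transpose_smul, transpose_sum]; simp only [hX]
  have h := sum_trace_exp_add_le X hX hR hX0 hXR hsum θ s 0 transpose_zero
  simp only [zero_add, NormedSpace.exp_zero, trace_one] at h
  -- The sign of `θ` is free: positive values give the upper tail and negative values the lower
  -- tail.
  have h2 : (bad.card : ℝ) * Real.exp (θ * t) ≤
      ∑ σ : Fin s → Fin n, trace (NormedSpace.exp (θ • ∑ r, X (σ r))) := by
    rw [← nsmul_eq_mul, ← Finset.sum_const]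
    refine (Finset.sum_le_sum fun σ hσ => ?_).trans
      (Finset.sum_le_sum_of_subset_of_nonneg bad.subset_univ fun σ _ _ => trace_exp_nonneg (h1 σ))
    obtain ⟨v, hv, hvt⟩ := hbad σ hσ
    refine exp_le_trace_exp (h1 σ) hv ?_
    rwa [smul_mulVec, dotProduct_smul, smul_eq_mul]
  rw [Real.exp_sub, ← mul_div_assoc, ← mul_div_assoc, le_div_iff₀ (Real.exp_pos _)]
  refine (h2.trans h).trans (le_of_eq ?_)
  rw [mul_pow, ← Real.exp_nat_mul]
  ring

/-- Since `(k + 2)! ≥ 2 · 3^k`, the tail of the exponential series is dominated by a geometric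
series of ratio `u / 3`. -/
theorem Real.exp_sub_one_sub_le {u : ℝ} (h0 : 0 ≤ u) (h3 : u < 3) :
    Real.exp u - 1 - u ≤ u ^ 2 / (2 * (1 - u / 3)) := by
  have h := NormedSpace.expSeries_div_hasSum_exp (𝔸 := ℝ) u
  rw [← Real.exp_eq_exp_ℝ] at h
  have h2 := (hasSum_nat_add_iff' 2).2 h
  have hg := (hasSum_geometric_of_lt_one (r := u / 3) (by positivity) (by linarith)).mul_left
    (u ^ 2 / 2)
  have hle := hasSum_le (fun k => ?_) h2 hg
  · simp only [Finset.sum_range_succ, Finset.sum_range_zero] at hle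
    norm_num at hle
    have e : u ^ 2 / (2 * (1 - u / 3)) = u ^ 2 / 2 * (1 - u / 3)⁻¹ := by
      rw [div_mul_eq_div_div, div_eq_mul_inv (u ^ 2 / 2)]
    rw [e]
    linarith
  · have hf : 2 * 3 ^ k ≤ ((k + 2).factorial : ℝ) := by
      induction k with
      | zero => simp
      | succ k ih =>
        rw [show k + 1 + 2 = (k + 2) + 1 by ring, Nat.factorial_succ, pow_succ]
        push_cast
        nlinarith [Nat.cast_nonneg (α := ℝ) k, pow_pos (show (0 : ℝ) < 3 by norm_num) k]
    rw [div_pow, div_mul_div_comm, pow_add, mul_comm (u ^ k)]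
    gcongr

theorem Real.exp_neg_le_quadratic {u : ℝ} (h0 : 0 ≤ u) : Real.exp (-u) ≤ 1 - u + u ^ 2 / 2 := by
  have h : MonotoneOn (fun x : ℝ => 1 - x + x ^ 2 / 2 - Real.exp (-x)) (Set.Ici 0) := by
    refine monotoneOn_of_deriv_nonneg (convex_Ici 0) (by fun_prop) (by fun_prop) fun x _ => ?_
    have hd : HasDerivAt (fun x : ℝ => 1 - x + x ^ 2 / 2 - Real.exp (-x))
        (0 - 1 + (2 * x ^ (2 - 1) * 1) / 2 - Real.exp (-x) * (-1)) x := by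
      refine (((hasDerivAt_const x (1 : ℝ)).sub (hasDerivAt_id x)).add
        (((hasDerivAt_id x).pow 2).div_const 2)).sub ((hasDerivAt_id x).neg.exp)
    rw [hd.deriv]
    have := Real.add_one_le_exp (-x)
    norm_num
    linarith
  have := h (Set.self_mem_Ici) (Set.mem_Ici.2 h0) h0
  simp at this
  linarith

/-- The upper tail of the matrix Chernoff bound, in Bernstein form. -/
theorem Matrix.card_exists_mulVec_ge_one_add_le {n : ℕ} (X : Fin n → Matrix ι ι ℝ)
    (hX : ∀ j, (X j)ᵀ = X j) {R : ℝ} (hR : 0 < R) (hX0 : ∀ j v, 0 ≤ v ⬝ᵥ X j *ᵥ v)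
    (hXR : ∀ j v, v ⬝ᵥ X j *ᵥ v ≤ R * (v ⬝ᵥ v)) (hsum : ∑ j, X j = (n : ℝ) • 1) (s : ℕ)
    {h : ℝ} (hh : 0 ≤ h) (bad : Finset (Fin s → Fin n))
    (hbad : ∀ σ ∈ bad, ∃ v : ι → ℝ, v ≠ 0 ∧ (1 + h) * s * (v ⬝ᵥ v) ≤ v ⬝ᵥ (∑ r, X (σ r)) *ᵥ v) :
    (bad.card : ℝ) ≤ n ^ s * (Fintype.card ι *
      Real.exp (-(s / R * (h ^ 2 / (2 * (1 + h / 3)))))) := by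
  -- Bernstein's choice `θ = u / R`: then `1 - u / 3 = 1 / (1 + h / 3)`, and the exponent `e^u - 1 -
  -- u - u h` is at most `-u h / 2`.
  set u := h / (1 + h / 3) with hu
  have hpos : 0 < 1 + h / 3 := by positivity
  have hu0 : 0 ≤ u := by positivity
  have hu3 : u < 3 := by rw [hu, div_lt_iff₀ hpos]; linarith
  have hθ : 0 ≤ u / R := by positivity
  refine (card_exists_mulVec_ge_le X hX hR hX0 hXR hsum (u / R) s ((1 + h) * s) bad
    fun σ hσ => ?_).trans ?_
  · obtain ⟨v, hv, hvt⟩ := hbad σ hσ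
    exact ⟨v, hv, by rw [mul_assoc]; exact mul_le_mul_of_nonneg_left hvt hθ⟩
  · gcongr
    rw [div_mul_cancel₀ _ hR.ne']
    have h1 := Real.exp_sub_one_sub_le hu0 hu3
    have e1 : u ^ 2 / (2 * (1 - u / 3)) = u * h / 2 := by
      have : 1 - u / 3 = 1 / (1 + h / 3) := by rw [hu]; field_simp; ring
      rw [this, hu]; field_simp
    have e2 : h ^ 2 / (2 * (1 + h / 3)) = u * h / 2 := by rw [hu]; field_simp
    rw [e1] at h1
    rw [e2]
    have e3 : (s : ℝ) * ((Real.exp u - 1) / R) - u / R * ((1 + h) * s) =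
        s / R * (Real.exp u - 1 - u - u * h) := by field_simp; ring
    rw [e3, ← mul_neg]
    gcongr
    linarith

/-- The lower tail of the matrix Chernoff bound. -/
theorem Matrix.card_exists_mulVec_le_one_sub_le {n : ℕ} (X : Fin n → Matrix ι ι ℝ)
    (hX : ∀ j, (X j)ᵀ = X j) {R : ℝ} (hR : 0 < R) (hX0 : ∀ j v, 0 ≤ v ⬝ᵥ X j *ᵥ v)
    (hXR : ∀ j v, v ⬝ᵥ X j *ᵥ v ≤ R * (v ⬝ᵥ v)) (hsum : ∑ j, X j = (n : ℝ) • 1) (s : ℕ)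
    {h : ℝ} (hh : 0 ≤ h) (bad : Finset (Fin s → Fin n))
    (hbad : ∀ σ ∈ bad, ∃ v : ι → ℝ, v ≠ 0 ∧ v ⬝ᵥ (∑ r, X (σ r)) *ᵥ v ≤ (1 - h) * s * (v ⬝ᵥ v)) :
    (bad.card : ℝ) ≤ n ^ s * (Fintype.card ι * Real.exp (-(s / R * (h ^ 2 / 2)))) := by
  have hθ : 0 ≤ h / R := by positivity
  refine (card_exists_mulVec_ge_le X hX hR hX0 hXR hsum (-(h / R)) s ((1 - h) * s) bad
    fun σ hσ => ?_).trans ?_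
  · obtain ⟨v, hv, hvt⟩ := hbad σ hσ
    refine ⟨v, hv, ?_⟩
    have := mul_le_mul_of_nonneg_left hvt hθ
    linarith
  · gcongr
    rw [neg_mul, div_mul_cancel₀ _ hR.ne']
    have h1 := Real.exp_neg_le_quadratic hh
    have e3 : (s : ℝ) * ((Real.exp (-h) - 1) / R) - -(h / R) * ((1 - h) * s) =
        s / R * (Real.exp (-h) - 1 + h - h ^ 2) := by field_simp; ring
    rw [e3, ← mul_neg]
    gcongr
    linarith

end MatrixChernoff

/-! ### Hoeffding's inequality in a Hilbert space -/

section VectorHoeffding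

/-- The series `cosh √x = ∑ x^k / (2k)!` has nonnegative coefficients, and every power is convex on
`[0, ∞)`. -/
theorem Real.cosh_sqrt_convex_comb_le {a b t : ℝ} (ha : 0 ≤ a) (hb : 0 ≤ b) (ht0 : 0 ≤ t)
    (ht1 : t ≤ 1) :
    Real.cosh (√((1 - t) * a + t * b)) ≤ (1 - t) * Real.cosh (√a) + t * Real.cosh (√b) := by
  have hs : ∀ x : ℝ, 0 ≤ x →
      HasSum (fun k : ℕ => x ^ k / ((2 * k).factorial : ℝ)) (Real.cosh (√x)) := fun x hx => by
    have h := Real.hasSum_cosh (√x)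
    simp_rw [pow_mul, Real.sq_sqrt hx] at h
    exact h
  have h1 : 0 ≤ 1 - t := by linarith
  refine hasSum_le (fun k => ?_) (hs ((1 - t) * a + t * b) (by positivity))
    (((hs a ha).mul_left (1 - t)).add ((hs b hb).mul_left t))
  have h := (convexOn_pow k).2 (Set.mem_Ici.2 ha) (Set.mem_Ici.2 hb) h1 ht0 (by ring)
  simp only [smul_eq_mul] at h
  rw [mul_div_assoc', mul_div_assoc', ← add_div]
  gcongr

variable {V : Type*} [NormedAddCommGroup V] [InnerProductSpace ℝ V]

/-- With `‖y‖` raised to `R`, the square `‖x + y‖²` is affine in `⟨x, y⟩` and runs from `(‖x‖ - R)²`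
to `(‖x‖ + R)²`; convexity of `cosh √` bounds it by the chord. The result is affine in `y`, so
averaging over centred `y` removes the second term. -/
theorem cosh_norm_add_le (x y : V) {R : ℝ} (hR : 0 < R) (hx : x ≠ 0) (hy : ‖y‖ ≤ R) :
    Real.cosh ‖x + y‖ ≤ Real.cosh ‖x‖ * Real.cosh R +
      inner ℝ x y / (‖x‖ * R) * (Real.sinh ‖x‖ * Real.sinh R) := by
  have hx0 : 0 < ‖x‖ := norm_pos_iff.2 hx
  have hi := abs_le.1 ((abs_real_inner_le_norm x y).trans
    (mul_le_mul_of_nonneg_left hy hx0.le))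
  set q := inner ℝ x y / (‖x‖ * R) with hq
  have hqe : inner ℝ x y = q * (‖x‖ * R) := by rw [hq]; field_simp
  have hq1 : -1 ≤ q := by rw [hq, le_div_iff₀ (by positivity)]; linarith [hi.1]
  have hq2 : q ≤ 1 := by rw [hq, div_le_iff₀ (by positivity)]; linarith [hi.2]
  have h := Real.cosh_sqrt_convex_comb_le (sq_nonneg (‖x‖ - R)) (sq_nonneg (‖x‖ + R))
    (t := (1 + q) / 2) (by linarith) (by linarith)
  rw [Real.sqrt_sq_eq_abs, Real.sqrt_sq_eq_abs, Real.cosh_abs, Real.cosh_abs, Real.cosh_add,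
    Real.cosh_sub] at h
  refine le_trans ?_ (h.trans (le_of_eq (by ring)))
  rw [Real.cosh_le_cosh, abs_norm, abs_of_nonneg (Real.sqrt_nonneg _)]
  refine Real.le_sqrt_of_sq_le ?_
  rw [norm_add_sq_real, hqe]
  nlinarith [norm_nonneg y]

theorem sum_cosh_norm_add_le {n : ℕ} (y : Fin n → V) (hsum : ∑ j, y j = 0) {R : ℝ} (hR : 0 < R)
    (hy : ∀ j, ‖y j‖ ≤ R) (x : V) :
    ∑ j, Real.cosh ‖x + y j‖ ≤ n * Real.exp (R ^ 2 / 2) * Real.cosh ‖x‖ := by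
  have hc := Real.cosh_le_exp_half_sq R
  have h0 : ∑ j, Real.cosh ‖x + y j‖ ≤ n * (Real.cosh ‖x‖ * Real.cosh R) := by
    rcases eq_or_ne x 0 with rfl | hx
    · have : ∀ j ∈ Finset.univ, Real.cosh ‖0 + y j‖ ≤ Real.cosh R := fun j _ => by
        rw [zero_add, Real.cosh_le_cosh, abs_norm, abs_of_pos hR]; exact hy j
      simpa using Finset.sum_le_card_nsmul _ _ _ this
    · refine (Finset.sum_le_sum fun j _ => cosh_norm_add_le x (y j) hR hx (hy j)).trans ?_
      rw [Finset.sum_add_distrib, ← Finset.sum_mul Finset.univ (fun j => inner ℝ x (y j) / (‖x‖ * R)),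
        ← Finset.sum_div, ← inner_sum, hsum]
      simp
  calc _ ≤ _ := h0
    _ ≤ n * (Real.cosh ‖x‖ * Real.exp (R ^ 2 / 2)) := by
      gcongr
    _ = _ := by ring

theorem sum_cosh_norm_sum_le {n : ℕ} (y : Fin n → V) (hsum : ∑ j, y j = 0) {R : ℝ} (hR : 0 < R)
    (hy : ∀ j, ‖y j‖ ≤ R) (s : ℕ) (x : V) :
    ∑ σ : Fin s → Fin n, Real.cosh ‖x + ∑ r, y (σ r)‖ ≤
      (n * Real.exp (R ^ 2 / 2)) ^ s * Real.cosh ‖x‖ := by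
  induction s generalizing x with
  | zero => simp
  | succ s ih =>
    rw [← (Fin.consEquiv fun _ => Fin n).sum_comp, Fintype.sum_prod_type]
    have e : ∀ (j : Fin n) (σ : Fin s → Fin n),
        x + ∑ r, y ((Fin.consEquiv fun _ => Fin n) (j, σ) r) =
          (x + y j) + ∑ r, y (σ r) := fun j σ => by
      rw [Fin.sum_univ_succ, add_assoc]; simp [Fin.consEquiv]
    simp only [e]
    refine (Finset.sum_le_sum fun j _ => ih (x + y j)).trans ?_
    rw [← Finset.mul_sum, pow_succ (_ * _), mul_assoc (_ ^ s)]
    exact mul_le_mul_of_nonneg_left (sum_cosh_norm_add_le y hsum hR hy x) (by positivity)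

/-- Hoeffding's inequality in a Hilbert space, as a bound for the number of samples with a large
sum. -/
theorem card_norm_sum_ge_le {n : ℕ} (y : Fin n → V) (hsum : ∑ j, y j = 0) {R : ℝ} (hR : 0 < R)
    (hy : ∀ j, ‖y j‖ ≤ R) {s : ℕ} (hs : 0 < s) {t : ℝ} (ht : 0 < t) (bad : Finset (Fin s → Fin n))
    (hbad : ∀ σ ∈ bad, t ≤ ‖∑ r, y (σ r)‖) :
    (bad.card : ℝ) ≤ n ^ s * (2 * Real.exp (-(t ^ 2 / (2 * s * R ^ 2)))) := by
  have hs0 : (0 : ℝ) < s := by exact_mod_cast hs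
  -- The minimizer of `s θ² R² / 2 - θ t`. The factor `2` in the bound comes from `cosh x ≥ exp x /
  -- 2`.
  set θ := t / (s * R ^ 2) with hθ
  have hθ0 : 0 < θ := by positivity
  have hsum' : ∑ j, θ • y j = 0 := by rw [← Finset.smul_sum, hsum, smul_zero]
  have h := sum_cosh_norm_sum_le (fun j => θ • y j) hsum' (mul_pos hθ0 hR) (fun j => by
    rw [norm_smul, Real.norm_eq_abs, abs_of_pos hθ0]; gcongr; exact hy j) s 0
  have h2 : (bad.card : ℝ) * (Real.exp (θ * t) / 2) ≤
      ∑ σ : Fin s → Fin n, Real.cosh ‖0 + ∑ r, θ • y (σ r)‖ := by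
    rw [← nsmul_eq_mul, ← Finset.sum_const]
    refine (Finset.sum_le_sum fun σ hσ => ?_).trans
      (Finset.sum_le_sum_of_subset_of_nonneg bad.subset_univ fun σ _ _ => (Real.cosh_pos _).le)
    have h3 : θ * t ≤ ‖0 + ∑ r, θ • y (σ r)‖ := by
      rw [zero_add, ← Finset.smul_sum, norm_smul, Real.norm_eq_abs, abs_of_pos hθ0]
      exact mul_le_mul_of_nonneg_left (hbad σ hσ) hθ0.le
    rw [Real.cosh_eq]
    have := Real.exp_le_exp.2 h3
    have := Real.exp_pos (-‖0 + ∑ r, θ • y (σ r)‖)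
    linarith
  have h4 := h2.trans h
  rw [norm_zero, Real.cosh_zero, mul_one, mul_pow, ← Real.exp_nat_mul] at h4
  have e1 : (s : ℝ) * ((θ * R) ^ 2 / 2) = t ^ 2 / (2 * s * R ^ 2) := by
    rw [hθ]; field_simp
  have e2 : θ * t = t ^ 2 / (2 * s * R ^ 2) + t ^ 2 / (2 * s * R ^ 2) := by
    rw [hθ]; field_simp; ring
  rw [e1, e2, Real.exp_add] at h4
  set E := Real.exp (t ^ 2 / (2 * s * R ^ 2)) with hE
  have hE0 : 0 < E := Real.exp_pos _
  rw [Real.exp_neg, ← hE]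
  have h5 : (bad.card : ℝ) * E ≤ 2 * n ^ s := by
    have : (bad.card * E) * E ≤ (2 * n ^ s) * E := by linarith
    exact le_of_mul_le_mul_right this hE0
  calc (bad.card : ℝ) = bad.card * E * E⁻¹ := by field_simp
    _ ≤ 2 * n ^ s * E⁻¹ := by gcongr
    _ = _ := by ring

end VectorHoeffding

/-! ### Energy-norm estimates for one trimmed Newton step -/

section EnergyNorm

variable {E : Type*} [NormedAddCommGroup E] [InnerProductSpace ℝ E]

open scoped InnerProductSpace

/-- A symmetric form that is bounded by `M` times a positive definite form on the diagonal is
bounded by `M` times the product of the energy norms. -/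
theorem LinearMap.IsSymmetric.inner_le_energy {H S : E →ₗ[ℝ] E} (hH : H.IsSymmetric)
    (hS : S.IsSymmetric) (hpos : ∀ u, u ≠ 0 → 0 < ⟪u, H u⟫_ℝ) {M : ℝ}
    (hM : ∀ u, |⟪u, S u⟫_ℝ| ≤ M * ⟪u, H u⟫_ℝ) (u v : E) :
    ⟪u, S v⟫_ℝ ≤ M * (√⟪u, H u⟫_ℝ * √⟪v, H v⟫_ℝ) := by
  rcases eq_or_ne u 0 with rfl | hu
  · simp
  rcases eq_or_ne v 0 with rfl | hv
  · simp
  set a := √⟪u, H u⟫_ℝ with ha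
  set b := √⟪v, H v⟫_ℝ with hb
  have ha0 : 0 < a := Real.sqrt_pos.2 (hpos u hu)
  have hb0 : 0 < b := Real.sqrt_pos.2 (hpos v hv)
  have ha2 : ⟪u, H u⟫_ℝ = a ^ 2 := (Real.sq_sqrt (hpos u hu).le).symm
  have hb2 : ⟪v, H v⟫_ℝ = b ^ 2 := (Real.sq_sqrt (hpos v hv).le).symm
  -- The weights equalize the two energies: subtracting the bounds for `b u + a v` and `b u - a v`
  -- gives `4ab ⟨u, S v⟩ ≤ 4 M a² b²`.
  have h1 := (abs_le.1 (hM (b • u + a • v))).2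
  have h2 := (abs_le.1 (hM (b • u - a • v))).1
  have hsS : ⟪v, S u⟫_ℝ = ⟪u, S v⟫_ℝ := by rw [← hS v u, real_inner_comm]
  have hsH : ⟪v, H u⟫_ℝ = ⟪u, H v⟫_ℝ := by rw [← hH v u, real_inner_comm]
  simp only [map_add, map_sub, map_smul, inner_add_left, inner_sub_left, inner_add_right,
    inner_sub_right, real_inner_smul_left, real_inner_smul_right, hsS, hsH, ha2, hb2] at h1 h2
  have h3 : (a * b) * ⟪u, S v⟫_ℝ ≤ (a * b) * (M * (a * b)) := by nlinarith
  exact le_of_mul_le_mul_left h3 (by positivity)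

/-- Pairing `H x = S v` with `x` itself produces the squared energy of `x`, of which one factor
cancels. -/
theorem LinearMap.IsSymmetric.energy_le_of_apply_eq {H S : E →ₗ[ℝ] E} (hH : H.IsSymmetric)
    (hS : S.IsSymmetric) (hpos : ∀ u, u ≠ 0 → 0 < ⟪u, H u⟫_ℝ) {M : ℝ}
    (hM : ∀ u, |⟪u, S u⟫_ℝ| ≤ M * ⟪u, H u⟫_ℝ) {x v : E} (hx : H x = S v) :
    √⟪x, H x⟫_ℝ ≤ M * √⟪v, H v⟫_ℝ := by
  rcases eq_or_ne x 0 with rfl | hx0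
  · rcases eq_or_ne v 0 with rfl | hv0
    · simp
    have := (abs_nonneg _).trans (hM v)
    have hM0 : 0 ≤ M := by
      by_contra! hlt
      nlinarith [hpos v hv0]
    simp only [inner_zero_left, Real.sqrt_zero]
    positivity
  have h := hH.inner_le_energy hS hpos hM x v
  rw [← hx] at h
  have hp := Real.sqrt_pos.2 (hpos x hx0)
  have h2 := Real.mul_self_sqrt (hpos x hx0).le
  have h3 : √⟪x, H x⟫_ℝ * √⟪x, H x⟫_ℝ ≤ √⟪x, H x⟫_ℝ * (M * √⟪v, H v⟫_ℝ) := by linarith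
  exact le_of_mul_le_mul_left h3 hp

theorem LinearMap.IsSymmetric.energy_add_le {H : E →ₗ[ℝ] E} (hH : H.IsSymmetric)
    (hpos : ∀ u, u ≠ 0 → 0 < ⟪u, H u⟫_ℝ) (u v : E) :
    √⟪u + v, H (u + v)⟫_ℝ ≤ √⟪u, H u⟫_ℝ + √⟪v, H v⟫_ℝ := by
  have h0 : ∀ u, 0 ≤ ⟪u, H u⟫_ℝ := fun u => by
    rcases eq_or_ne u 0 with rfl | hu
    · simp
    · exact (hpos u hu).le
  have h := hH.inner_le_energy hH hpos (M := 1) (fun u => by rw [abs_of_nonneg (h0 u), one_mul]) u v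
  have hsH : ⟪v, H u⟫_ℝ = ⟪u, H v⟫_ℝ := by rw [← hH v u, real_inner_comm]
  refine Real.sqrt_le_left (by positivity) |>.2 ?_
  simp only [map_add, inner_add_left, inner_add_right, hsH]
  nlinarith [Real.sq_sqrt (h0 u), Real.sq_sqrt (h0 v)]

/-- Relative perturbation of the solution of `H q = b` when `H` is replaced by `K`, and `b` by
`b + ξ`. -/
theorem norm_sub_le_of_perturbed_system {H K : E →ₗ[ℝ] E} (hH : H.IsSymmetric) (hK : K.IsSymmetric)
    {σ τ : ℝ} (hσ : 0 < σ) (hlow : ∀ u, σ * ‖u‖ ^ 2 ≤ ⟪u, H u⟫_ℝ) (hτ1 : τ < 1)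
    (hτ : ∀ u, |⟪u, (H - K) u⟫_ℝ| ≤ τ * ⟪u, H u⟫_ℝ) {q p' n ξ b : E} (hq : H q = b) (hp : K p' = b)
    (hn : K n = ξ) :
    ‖p' + n - q‖ ≤ τ / (1 - τ) * (√⟪q, H q⟫_ℝ / √σ) + ‖ξ‖ / (σ * (1 - τ)) := by
  have hpos : ∀ u, u ≠ 0 → 0 < ⟪u, H u⟫_ℝ := fun u hu =>
    lt_of_lt_of_le (by have := norm_pos_iff.2 hu; positivity) (hlow u)
  have h1τ : 0 < 1 - τ := by linarith
  have hS : (H - K).IsSymmetric := hH.sub hK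
  -- The error `p' - q` has energy at most `τ` times that of `p'`, hence at most `τ` times the sum
  -- of its own energy and that of `q`; solving gives the factor `τ / (1 - τ)`.
  have he : H (p' - q) = (H - K) p' := by
    rw [map_sub, hq, LinearMap.sub_apply, hp]
  have h1 := hH.energy_le_of_apply_eq hS hpos hτ he
  have h2 := hH.energy_add_le hpos (p' - q) q
  rw [sub_add_cancel] at h2
  have hsq : ∀ u, √σ * ‖u‖ ≤ √⟪u, H u⟫_ℝ := fun u => by
    rw [← Real.sqrt_sq (norm_nonneg u), ← Real.sqrt_mul hσ.le]
    exact Real.sqrt_le_sqrt (hlow u)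
  have hsσ : 0 < √σ := Real.sqrt_pos.2 hσ
  have hτ0 : p' ≠ 0 → 0 ≤ τ := fun h => by
    have h3 := (abs_nonneg _).trans (hτ p')
    by_contra! hlt
    nlinarith [hpos p' h]
  have h4 : (1 - τ) * √⟪p' - q, H (p' - q)⟫_ℝ ≤ τ * √⟪q, H q⟫_ℝ := by
    rcases eq_or_ne p' 0 with rfl | hp'
    · have hb0 : b = 0 := by rw [← hp, map_zero]
      have hq0 : q = 0 := by
        by_contra hne
        have := hpos q hne
        rw [hq, hb0, inner_zero_right] at this
        exact lt_irrefl _ this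
      simp [hq0]
    · nlinarith [hτ0 hp']
  have h5 : ‖p' - q‖ ≤ τ / (1 - τ) * (√⟪q, H q⟫_ℝ / √σ) := by
    have := hsq (p' - q)
    rw [div_mul_div_comm, le_div_iff₀ (by positivity)]
    nlinarith
  -- Here `K ≥ (1 - τ) H ≥ (1 - τ) σ`, so the noise `ξ` is amplified by at most `1 / (σ (1 - τ))`.
  have h6 : ‖n‖ ≤ ‖ξ‖ / (σ * (1 - τ)) := by
    rw [le_div_iff₀ (by positivity)]
    have h7 := (abs_le.1 (hτ n)).2
    rw [LinearMap.sub_apply, inner_sub_right, hn] at h7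
    have h8 := real_inner_le_norm n ξ
    have h9 := hlow n
    rcases eq_or_ne n 0 with rfl | hn0
    · simp
    have hnp := norm_pos_iff.2 hn0
    have : ‖n‖ * (‖n‖ * (σ * (1 - τ))) ≤ ‖n‖ * ‖ξ‖ := by nlinarith
    exact le_of_mul_le_mul_left this hnp
  calc ‖p' + n - q‖ = ‖(p' - q) + n‖ := by congr 1; abel
    _ ≤ ‖p' - q‖ + ‖n‖ := norm_add_le _ _
    _ ≤ _ := add_le_add h5 h6

/-- Honest vectors are compared with `q` and Byzantine ones with `0`, so the centre of the
comparison is `(1 - r) q`. -/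
theorem norm_sub_average_le {κ : Type*} [DecidableEq κ] (U B : Finset κ) (hU : 0 < U.card)
    (p : κ → E) (x q : E) {e₁ e₂ : ℝ} (h₁ : ∀ i ∈ U, i ∉ B → ‖p i - q‖ ≤ e₁)
    (h₂ : ∀ i ∈ U, i ∈ B → ‖p i‖ ≤ e₂) {r : ℝ} (hr : r = ((U ∩ B).card : ℝ) / U.card) :
    ‖x - (1 / (U.card : ℝ)) • ∑ i ∈ U, p i‖ ≤ ‖x - (1 - r) • q‖ + (1 - r) * e₁ + r * e₂ := by
  have hU0 : (0 : ℝ) < U.card := by exact_mod_cast hU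
  have hcard : ((U \ B).card : ℝ) = (1 - r) * U.card := by
    have := Finset.card_sdiff_add_card_inter U B
    have h : ((U \ B).card : ℝ) + ((U ∩ B).card : ℝ) = U.card := by exact_mod_cast this
    rw [hr]; field_simp; linarith
  have hcard2 : ((U ∩ B).card : ℝ) = r * U.card := by rw [hr]; field_simp
  have e : x - (1 / (U.card : ℝ)) • ∑ i ∈ U, p i = (x - (1 - r) • q)
      - (1 / (U.card : ℝ)) • ∑ i ∈ U \ B, (p i - q) - (1 / (U.card : ℝ)) • ∑ i ∈ U ∩ B, p i := by
    rw [Finset.sum_sub_distrib, Finset.sum_const, ← Finset.sum_sdiff (Finset.inter_subset_left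
      (s₁ := U) (s₂ := B)), Finset.sdiff_inter_self_left, smul_sub, ← Nat.cast_smul_eq_nsmul ℝ,
      hcard, smul_smul, smul_add, show 1 / (U.card : ℝ) * ((1 - r) * U.card) = 1 - r by
        rw [one_div, mul_comm, mul_assoc, mul_inv_cancel₀ hU0.ne', mul_one]]
    abel
  have hs1 : ‖∑ i ∈ U \ B, (p i - q)‖ ≤ (1 - r) * U.card * e₁ := by
    rw [← hcard, ← nsmul_eq_mul]
    refine (norm_sum_le _ _).trans (Finset.sum_le_card_nsmul _ _ _ fun i hi => ?_)
    rw [Finset.mem_sdiff] at hi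
    exact h₁ i hi.1 hi.2
  have hs2 : ‖∑ i ∈ U ∩ B, p i‖ ≤ r * U.card * e₂ := by
    rw [← hcard2, ← nsmul_eq_mul]
    refine (norm_sum_le _ _).trans (Finset.sum_le_card_nsmul _ _ _ fun i hi => ?_)
    rw [Finset.mem_inter] at hi
    exact h₂ i hi.1 hi.2
  have hn : ∀ v : E, ‖(1 / (U.card : ℝ)) • v‖ = ‖v‖ / U.card := fun v => by
    rw [norm_smul, Real.norm_eq_abs, abs_of_pos (one_div_pos.2 hU0), one_div, div_eq_inv_mul]
  rw [e]
  refine (norm_sub_le _ _).trans (add_le_add ((norm_sub_le _ _).trans (add_le_add le_rfl ?_)) ?_)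
  · rw [hn, div_le_iff₀ hU0]; linarith
  · rw [hn, div_le_iff₀ hU0]; linarith

/-- One step of a trimmed approximate Newton method. The true Hessian is `H`, the averaged Hessian
`G` satisfies `G Δ = g`, and each machine outside `B` reports a solution of
`K i (p i) = g + ξ i`. -/
theorem norm_sub_trimmed_average_le {κ : Type*} [DecidableEq κ] {H G : E →ₗ[ℝ] E}
    (K : κ → E →ₗ[ℝ] E) (hH : H.IsSymmetric) (hG : G.IsSymmetric) (hK : ∀ i, (K i).IsSymmetric)
    {σ c ν β τ ε : ℝ} (hσ : 0 < σ) (hc : 0 ≤ c) (hν : 0 ≤ ν) (hν1 : ν < 1) (hβ : 0 ≤ β)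
    (hτ0 : 0 ≤ τ) (hτ1 : τ < 1)
    (hlow : ∀ u, σ * ‖u‖ ^ 2 ≤ ⟪u, H u⟫_ℝ) (hup : ∀ u, ⟪u, H u⟫_ℝ ≤ c ^ 2 * σ * ‖u‖ ^ 2)
    (hGν : ∀ u, (1 - ν) * ⟪u, H u⟫_ℝ ≤ ⟪u, G u⟫_ℝ)
    (hGH : ∀ u, |⟪u, (H - G) u⟫_ℝ| ≤ β * σ * ‖u‖ ^ 2)
    (U B : Finset κ) (hU : 0 < U.card)
    (hKτ : ∀ i ∉ B, ∀ u, |⟪u, (H - K i) u⟫_ℝ| ≤ τ * ⟪u, H u⟫_ℝ)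
    {Δ q : E} (hq : H q = G Δ) (p p' n ξ : κ → E) (hp : ∀ i ∉ B, p i = p' i + n i)
    (hp' : ∀ i ∉ B, K i (p' i) = G Δ) (hn : ∀ i ∉ B, K i (n i) = ξ i)
    (hξ : ∀ i ∉ B, ‖ξ i‖ ≤ σ * (1 - τ) * ε)
    {k : κ} (hkB : k ∉ B) (hk : ∀ i ∈ U, ‖p i‖ ≤ ‖p k‖)
    {r : ℝ} (hr : r = ((U ∩ B).card : ℝ) / U.card) :
    ‖Δ - (1 / (U.card : ℝ)) • ∑ i ∈ U, p i‖ ≤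
      (c * max (r + (1 - r) * ν) ((1 - r) * β - r) + (r + c * (τ / (1 - τ))) * (1 + β)) * ‖Δ‖
        + ε := by
  have hpos : ∀ u, u ≠ 0 → 0 < ⟪u, H u⟫_ℝ := fun u hu =>
    lt_of_lt_of_le (by have := norm_pos_iff.2 hu; positivity) (hlow u)
  have hH0 : ∀ u, 0 ≤ ⟪u, H u⟫_ℝ := fun u => le_trans (by positivity) (hlow u)
  have hU0 : (0 : ℝ) < U.card := by exact_mod_cast hU
  have hr0 : 0 ≤ r := by rw [hr]; positivity
  have hr1 : r ≤ 1 := by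
    rw [hr, div_le_one hU0]; exact_mod_cast Finset.card_le_card Finset.inter_subset_left
  have h1r : 0 ≤ 1 - r := by linarith
  have hsσ : 0 < √σ := Real.sqrt_pos.2 hσ
  have h1τ : 0 < 1 - τ := by linarith
  have hsq : ∀ u, √σ * ‖u‖ ≤ √⟪u, H u⟫_ℝ := fun u => by
    rw [← Real.sqrt_sq (norm_nonneg u), ← Real.sqrt_mul hσ.le]
    exact Real.sqrt_le_sqrt (hlow u)
  have hsq2 : ∀ u, √⟪u, H u⟫_ℝ ≤ c * √σ * ‖u‖ := fun u => by
    rw [← Real.sqrt_sq (show 0 ≤ c * √σ * ‖u‖ by positivity), mul_pow, mul_pow, Real.sq_sqrt hσ.le]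
    exact Real.sqrt_le_sqrt (hup u)
  have hGb : ∀ u, (1 - β) * ⟪u, H u⟫_ℝ ≤ ⟪u, G u⟫_ℝ ∧ ⟪u, G u⟫_ℝ ≤ (1 + β) * ⟪u, H u⟫_ℝ := fun u => by
    have h := abs_le.1 (hGH u)
    rw [LinearMap.sub_apply, inner_sub_right] at h
    have := mul_le_mul_of_nonneg_left (hlow u) hβ
    constructor <;> nlinarith
  -- the averaged part
  set M := max (r + (1 - r) * ν) ((1 - r) * β - r) with hM
  have hfirst : ‖Δ - (1 - r) • q‖ ≤ c * M * ‖Δ‖ := by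
    have hS : (H - (1 - r) • G).IsSymmetric := hH.sub (hG.smul (by simp))
    have hx : H (Δ - (1 - r) • q) = (H - (1 - r) • G) Δ := by
      rw [map_sub, map_smul, hq, LinearMap.sub_apply, LinearMap.smul_apply]
    -- The upper side uses `G ≥ (1 - ν) H`, the lower side `G ≤ (1 + β) H`. Keeping them apart, as a
    -- maximum, is what later lets the linear and the quadratic terms be compared separately.
    have hb : ∀ u, |⟪u, (H - (1 - r) • G) u⟫_ℝ| ≤ M * ⟪u, H u⟫_ℝ := fun u => by
      rw [LinearMap.sub_apply, LinearMap.smul_apply, inner_sub_right, real_inner_smul_right, abs_le]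
      have h1 := mul_le_mul_of_nonneg_left (hGν u) h1r
      have h2 := mul_le_mul_of_nonneg_left (hGb u).2 h1r
      have h3 := mul_le_mul_of_nonneg_right (le_max_left (r + (1 - r) * ν) ((1 - r) * β - r)) (hH0 u)
      have h4 := mul_le_mul_of_nonneg_right (le_max_right (r + (1 - r) * ν) ((1 - r) * β - r)) (hH0 u)
      rw [← hM] at h3 h4
      constructor <;> nlinarith
    have h1 := hH.energy_le_of_apply_eq hS hpos hb hx
    have hM0 : 0 ≤ M := le_trans (by positivity) (le_max_left _ _)
    have h2 := (hsq _).trans (h1.trans (mul_le_mul_of_nonneg_left (hsq2 Δ) hM0))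
    have h3 : √σ * ‖Δ - (1 - r) • q‖ ≤ √σ * (c * M * ‖Δ‖) := by linarith
    exact le_of_mul_le_mul_left h3 hsσ
  have hqH : √⟪q, H q⟫_ℝ / √σ ≤ c * (1 + β) * ‖Δ‖ := by
    have h1 := hH.energy_le_of_apply_eq hG hpos (M := 1 + β) (fun u => by
      have := mul_nonneg (sub_nonneg.2 hν1.le) (hH0 u)
      rw [abs_of_nonneg (this.trans (hGν u))]
      exact (hGb u).2) hq
    rw [div_le_iff₀ hsσ]
    have := mul_le_mul_of_nonneg_left (hsq2 Δ) (show 0 ≤ 1 + β by positivity)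
    linarith
  -- The Lipschitz bound compares `H - G` with a multiple of the identity, so the Euclidean norm
  -- serves here as energy norm and no factor `c` is lost.
  have hqn : ‖q‖ ≤ (1 + β) * ‖Δ‖ := by
    have hS : (H - G).IsSymmetric := hH.sub hG
    have hx : H (Δ - q) = (H - G) Δ := by rw [map_sub, hq, LinearMap.sub_apply]
    have h1 := LinearMap.IsSymmetric.inner_le_energy (H := LinearMap.id) (S := H - G)
      LinearMap.IsSymmetric.id hS (fun u hu => by simpa using sq_pos_of_pos (norm_pos_iff.2 hu)) (M := β * σ)
      (fun u => by simpa using hGH u) (Δ - q) Δ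
    rw [← hx] at h1
    simp only [LinearMap.id_apply, real_inner_self_eq_norm_sq, Real.sqrt_sq (norm_nonneg _)] at h1
    have h2 : ‖Δ - q‖ ≤ β * ‖Δ‖ := by
      rcases eq_or_ne (Δ - q) 0 with h0 | h0
      · rw [h0, norm_zero]; positivity
      have hnp := norm_pos_iff.2 h0
      have : (σ * ‖Δ - q‖) * ‖Δ - q‖ ≤ (σ * ‖Δ - q‖) * (β * ‖Δ‖) := by
        have := hlow (Δ - q); nlinarith
      exact le_of_mul_le_mul_left this (by positivity)
    have h3 := norm_sub_norm_le q Δ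
    rw [norm_sub_rev] at h3
    linarith
  set e₁ := τ / (1 - τ) * (c * (1 + β) * ‖Δ‖) + ε with he₁
  have hhon : ∀ i ∉ B, ‖p i - q‖ ≤ e₁ := fun i hi => by
    rw [hp i hi]
    refine (norm_sub_le_of_perturbed_system hH (hK i) hσ hlow hτ1 (hKτ i hi) hq (hp' i hi)
      (hn i hi)).trans (add_le_add ?_ ?_)
    · gcongr
    · rw [div_le_iff₀ (by positivity)]; linarith [hξ i hi]
  -- Machine `k` is honest and its message is at least as long as every kept one. Its noise `ε`
  -- enters with weight `r`, that of the kept honest machines with weight `1 - r`: together exactly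
  -- one `ε`.
  have hbyz : ∀ i ∈ U, i ∈ B → ‖p i‖ ≤ (1 + β) * ‖Δ‖ + e₁ := fun i hi _ => by
    have h1 := hhon k hkB
    have h2 := norm_sub_norm_le (p k) q
    linarith [hk i hi]
  refine (norm_sub_average_le U B hU p Δ q (fun i _ hi => hhon i hi) hbyz hr).trans ?_
  rw [he₁]
  have : c * M * ‖Δ‖ + (1 - r) * (τ / (1 - τ) * (c * (1 + β) * ‖Δ‖) + ε) +
      r * ((1 + β) * ‖Δ‖ + (τ / (1 - τ) * (c * (1 + β) * ‖Δ‖) + ε)) =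
      (c * M + (r + c * (τ / (1 - τ))) * (1 + β)) * ‖Δ‖ + ε := by ring
  linarith

end EnergyNorm

/-! ### Polynomial inequalities on the circle `a² + b² = 1/2` -/

section ScalarBounds

/-- This cubic is the ratio `τ / Y` of the relative Hessian error to `Y = a ν / (1 - η)`. Its
maximum, near `η = 0.53`, is about `0.293`. -/
theorem cubic_profile_le {η : ℝ} (h0 : 0 ≤ η) (h1 : η ≤ 1) :
    η * (1 - η) * (1 + η / 3) ≤ 0.3 := by
  nlinarith [mul_nonneg h0 (sq_nonneg (η - 0.53)), sq_nonneg (η - 0.53)]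

theorem cubic_profile_quadratic_le {η : ℝ} (h0 : 0 ≤ η) (h1 : η ≤ 1) :
    η * (1 - η) * (1 + η / 3) + 0.9 * (η * (1 - η) * (1 + η / 3)) ^ 2 ≤
      1.08 * η - 0.43 * η ^ 2 := by
  set P := η * (1 - η) * (1 + η / 3) with hP
  have hP0 : 0 ≤ P := by have : 0 ≤ 1 - η := by linarith
                         positivity
  have hPq : P ≤ η - 2 / 3 * η ^ 2 := by rw [hP]; nlinarith [pow_nonneg h0 3]
  have hq : 0 ≤ 1 - 2 / 3 * η := by linarith
  have h2 : P ^ 2 ≤ (η - 2 / 3 * η ^ 2) ^ 2 := by gcongr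
  have e : P = η - 2 / 3 * η ^ 2 - η ^ 3 / 3 := by rw [hP]; ring
  have h3 : 0 ≤ η * (0.08 - 0.66333 * η + 1.53333 * η ^ 2 - 0.4 * η ^ 3) := by
    refine mul_nonneg h0 ?_
    nlinarith [sq_nonneg (η - 0.25), mul_nonneg h0 (sq_nonneg (η - 0.25)), sq_nonneg (η * (η - 1)),
      mul_nonneg (mul_nonneg h0 h0) (sub_nonneg.2 h1)]
  nlinarith [pow_nonneg h0 2]

theorem four_mul_sq_profile_ge {η : ℝ} (h0 : 0 ≤ η) (h1 : η ≤ 1) :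
    1 ≤ 4 * (1 - η * (1 - η) * (1 + η / 3)) ^ 2 * (1 - 0.7072 * (1 - η)) := by
  have hg : 0 ≤ 1 - η + 2 / 3 * η ^ 2 := by nlinarith
  have h2 : (1 - η + 2 / 3 * η ^ 2) ^ 2 ≤ (1 - η * (1 - η) * (1 + η / 3)) ^ 2 := by
    gcongr
    nlinarith [pow_nonneg h0 3]
  have h3 : 1 ≤ 4 * (1 - η + 2 / 3 * η ^ 2) ^ 2 * (1 - 0.7072 * (1 - η)) := by
    have : 0 ≤ 1 - η := by linarith
    nlinarith [mul_nonneg h0 (sq_nonneg (η - 0.5)), sq_nonneg (η - 0.45), sq_nonneg (η * (η - 0.6)), mul_nonneg h0 (sq_nonneg (η * (η - 0.7))), mul_nonneg h0 this]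
  have h4 : 0 ≤ 1 - 0.7072 * (1 - η) := by nlinarith
  nlinarith [mul_le_mul_of_nonneg_right h2 h4]

/-- For `a ≤ 1/2` the cross term is negative, but on the circle `1 - 2a ≤ 2(b - a)`, so completing a
square against `(a - b)² / 2` absorbs it at the cost of about `W² / 16`. -/
theorem circle_cross_term_le {a b W : ℝ} (ha : 0 ≤ a) (hb : 0 ≤ b) (hab : a ^ 2 + b ^ 2 = 1 / 2)
    (hW : 0 ≤ W) (h12 : a ≤ 1 / 2) :
    0 ≤ (a - b) ^ 2 / 2 + W * b * (2 * a - 1) / 4 + 0.0626 * W ^ 2 := by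
  have hb1 : b ≤ 0.70711 := by nlinarith
  have hba : a ≤ b := by nlinarith
  have hs : b + a ≤ 1 := by nlinarith [sq_nonneg (a - b)]
  have e : (1 - 2 * a) * (1 + 2 * a) = 2 * ((b - a) * (b + a)) := by nlinarith
  have h10 : 1 - 2 * a ≤ 2 * (b - a) := by
    have h11 : (b - a) * (b + a) ≤ (b - a) * 1 := mul_le_mul_of_nonneg_left hs (by linarith)
    have h12' : 0 ≤ (1 - 2 * a) * a := mul_nonneg (by linarith) ha
    linarith
  have h9 : b * (1 - 2 * a) ≤ 0.70711 * (2 * (b - a)) :=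
    mul_le_mul hb1 h10 (by linarith) (by norm_num)
  have h12' : W * (b * (1 - 2 * a)) ≤ W * (0.70711 * (2 * (b - a))) := by gcongr
  nlinarith [sq_nonneg ((b - a) - 0.353555 * W), sq_nonneg W]

/-- A quadratic in `η` with leading coefficient `a t`, where `t = 2/3 + 0.43 W`: multiplied by `4t`,
it splits off `a (2tη - W S)²`, and the remaining discriminant is treated by the sign of `2a - 1`.
-/
theorem circle_quadratic_nonneg {a b W : ℝ} (ha : 0 ≤ a) (hb : 0 ≤ b)
    (hab : a ^ 2 + b ^ 2 = 1 / 2) (hW : 0 ≤ W) (hW1 : W ≤ 1) (η : ℝ) :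
    0 ≤ (a - b) ^ 2 / 2 + W ^ 2 * (0.5 - 0.1381 * W) + W * b * (2 * a - 1) / 4
      - W * a * (1.08 + b / 2) * η + a * η ^ 2 * (2 / 3 + 0.43 * W) := by
  have ha1 : a ≤ 0.70711 := by nlinarith
  have hab4 : a * b ≤ 1 / 4 := by nlinarith [sq_nonneg (a - b)]
  have hab2 : a * b ^ 2 ≤ 0.14 := by
    have : b ^ 2 = 1 / 2 - a ^ 2 := by linarith
    rw [this]
    nlinarith [mul_nonneg ha (sq_nonneg (a - 0.41)), sq_nonneg (a - 0.41)]
  have haS : a * (1.08 + b / 2) ^ 2 ≤ 1.1664 * a + 0.305 := by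
    have e : a * (1.08 + b / 2) ^ 2 = 1.1664 * a + 1.08 * (a * b) + a * b ^ 2 / 4 := by ring
    rw [e]; linarith
  generalize 1.08 + b / 2 = S at *
  have htW : 1.333 ≤ (0.5 - 0.1381 * W) * (4 * (2 / 3 + 0.43 * W)) := by nlinarith
  have ht1 : 4 * (2 / 3 + 0.43 * W) ≤ 4.4 := by linarith
  have ht0 : 0 < 4 * (2 / 3 + 0.43 * W) := by positivity
  generalize ht : 2 / 3 + 0.43 * W = t at *
  have hsq : 0 ≤ a * (2 * t * η - W * S) ^ 2 := mul_nonneg ha (sq_nonneg _)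
  have h4t := ht0
  suffices h : 0 ≤ (4 * t) * ((a - b) ^ 2 / 2 + W ^ 2 * (0.5 - 0.1381 * W)
      + W * b * (2 * a - 1) / 4) - W ^ 2 * (a * S ^ 2) by
    have h2 : 0 ≤ (4 * t) * ((a - b) ^ 2 / 2 + W ^ 2 * (0.5 - 0.1381 * W)
        + W * b * (2 * a - 1) / 4 - W * a * S * η + a * η ^ 2 * t) := by
      have e : (4 * t) * ((a - b) ^ 2 / 2 + W ^ 2 * (0.5 - 0.1381 * W)
          + W * b * (2 * a - 1) / 4 - W * a * S * η + a * η ^ 2 * t) =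
          ((4 * t) * ((a - b) ^ 2 / 2 + W ^ 2 * (0.5 - 0.1381 * W)
            + W * b * (2 * a - 1) / 4) - W ^ 2 * (a * S ^ 2)) + a * (2 * t * η - W * S) ^ 2 := by
        ring
      rw [e]
      exact add_nonneg h hsq
    exact nonneg_of_mul_nonneg_right h2 h4t
  have h5 : W ^ 2 * 1.333 ≤ W ^ 2 * ((0.5 - 0.1381 * W) * (4 * t)) := by gcongr
  rcases le_total (1 / 2) a with h12 | h12
  · have h6 : W ^ 2 * (a * S ^ 2) ≤ W ^ 2 * 1.13 := by gcongr; linarith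
    have h7 : 0 ≤ (4 * t) * ((a - b) ^ 2 / 2) := by positivity
    have h8 : 0 ≤ (4 * t) * (W * b * (2 * a - 1) / 4) := by
      have : 0 ≤ 2 * a - 1 := by linarith
      positivity
    have e : (4 * t) * ((a - b) ^ 2 / 2 + W ^ 2 * (0.5 - 0.1381 * W) + W * b * (2 * a - 1) / 4) =
        (4 * t) * ((a - b) ^ 2 / 2) + (4 * t) * (W * b * (2 * a - 1) / 4) +
        W ^ 2 * ((0.5 - 0.1381 * W) * (4 * t)) := by ring
    rw [e]
    linarith [sq_nonneg W]
  · have h6 : W ^ 2 * (a * S ^ 2) ≤ W ^ 2 * 0.889 := by gcongr; linarith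
    have h13 := circle_cross_term_le ha hb hab hW h12
    have h14 : 0 ≤ (4 * t) * ((a - b) ^ 2 / 2 + W * b * (2 * a - 1) / 4 + 0.0626 * W ^ 2) := by
      exact mul_nonneg h4t.le h13
    have h15 : 4 * t * (0.0626 * W ^ 2) ≤ 4.4 * (0.0626 * W ^ 2) := by gcongr
    have e : (4 * t) * ((a - b) ^ 2 / 2 + W ^ 2 * (0.5 - 0.1381 * W) + W * b * (2 * a - 1) / 4) =
        (4 * t) * ((a - b) ^ 2 / 2 + W * b * (2 * a - 1) / 4 + 0.0626 * W ^ 2) +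
        W ^ 2 * ((0.5 - 0.1381 * W) * (4 * t)) - 4 * t * (0.0626 * W ^ 2) := by ring
    rw [e]
    linarith [sq_nonneg W]

/-- Equality holds at `W = η = 0`, `a = b = 1/2`, the point of the circle where `a + b` is largest.
The gain `(a - b)² / 2` away from it, together with `W² / 2`, pays for the terms linear in `W`. -/
theorem circle_profile_le {a b W η P : ℝ} (ha : 0 ≤ a) (hb : 0 ≤ b) (hab : a ^ 2 + b ^ 2 = 1 / 2)
    (hW : 0 ≤ W) (hW1 : W ≤ 1) (hη : 0 ≤ η) (hη1 : η ≤ 1) (hP : P = η * (1 - η) * (1 + η / 3)) :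
    b + (1 - b * W / 2) * (a * (1 - η)) + a * P + 1.27 * a ^ 2 * W * P ^ 2 ≤
      (1 + W ^ 2 / 2) * (1 - b * W / 4 - a * W * P) := by
  have hP0 : 0 ≤ P := by
    have : 0 ≤ 1 - η := by linarith
    rw [hP]; positivity
  have hP3 : P ≤ 0.3 := hP ▸ cubic_profile_le hη hη1
  have hPq : P + 0.9 * P ^ 2 ≤ 1.08 * η - 0.43 * η ^ 2 := hP ▸ cubic_profile_quadratic_le hη hη1
  have ha1 : a ≤ 0.70711 := by nlinarith
  have hb1 : b ≤ 0.70711 := by nlinarith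
  have hsum : a + b ≤ 1 - (a - b) ^ 2 / 2 := by
    refine abs_le_of_sq_le_sq' ?_ (by nlinarith) |>.2
    nlinarith [sq_nonneg ((a - b) ^ 2)]
  have hPe : a * (1 - η) + a * P ≤ a - 2 / 3 * a * η ^ 2 := by
    rw [hP]; nlinarith [mul_nonneg ha (pow_nonneg hη 3)]
  -- Cauchy-Schwarz on the circle: `√(1/2) · √(1/16 + 0.09) < 0.2762`.
  have hbaP : b / 4 + a * P ≤ 0.2762 := by
    have : b / 4 + 0.3 * a ≤ 0.2762 := by
      refine abs_le_of_sq_le_sq' ?_ (by norm_num) |>.2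
      nlinarith [sq_nonneg (0.3 * b - a / 4)]
    nlinarith
  have hW3 : W ^ 3 / 2 * (b / 4 + a * P) ≤ W ^ 2 * (0.1381 * W) := by
    have : W ^ 3 / 2 * (b / 4 + a * P) ≤ W ^ 3 / 2 * 0.2762 := by gcongr
    linarith
  have hPW : W * (a * P + 1.27 * a ^ 2 * P ^ 2) ≤ W * (a * (1.08 * η - 0.43 * η ^ 2)) := by
    gcongr
    have : 1.27 * a ^ 2 * P ^ 2 ≤ a * (0.9 * P ^ 2) := by
      have : 1.27 * a * (a * P ^ 2) ≤ 0.9 * (a * P ^ 2) := by gcongr; linarith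
      linarith
    nlinarith [mul_le_mul_of_nonneg_left hPq ha]
  have hquad := circle_quadratic_nonneg ha hb hab hW hW1 η
  have key : (a - b) ^ 2 / 2 + W ^ 2 * (0.5 - 0.1381 * W) + W * b * (2 * a - 1) / 4
      - W * a * (1.08 + b / 2) * η + a * η ^ 2 * (2 / 3 + 0.43 * W) =
      ((a - b) ^ 2 / 2 - 1 + a + b) + (1 - (b + a - 2 / 3 * a * η ^ 2) + b * W / 2 * (a * (1 - η))
        + W ^ 2 / 2 - W ^ 2 * (0.1381 * W) - b * W / 4 - W * (a * (1.08 * η - 0.43 * η ^ 2))) := by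
    ring
  rw [key] at hquad
  have key2 : (1 + W ^ 2 / 2) * (1 - b * W / 4 - a * W * P) =
      1 + W ^ 2 / 2 - b * W / 4 - W * (a * P) - W ^ 3 / 2 * (b / 4 + a * P) := by ring
  rw [key2]
  linarith

end ScalarBounds

/-! ### The contraction factor -/

section TrimmedScalar

/-- The bound `1 + w/2 ≤ 1/√(1 - w)`, and monotonicity of `z / (1 - z)`. -/
theorem mul_one_add_half_sq_le_sqrt {W z : ℝ} (hz : W ^ 2 ≤ z) (hz1 : z < 1) :
    W * (1 + W ^ 2 / 2) ≤ √(z / (1 - z)) := by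
  have h1 : 0 < 1 - z := by linarith
  refine Real.le_sqrt_of_sq_le ?_
  rw [le_div_iff₀ h1]
  set w := W ^ 2 with hw
  have hw0 : 0 ≤ w := sq_nonneg W
  have e : (W * (1 + w / 2)) ^ 2 = w * (1 + w / 2) ^ 2 := by rw [mul_pow, ← hw]
  rw [e]
  have h2 : (1 + w / 2) ^ 2 * (1 - w) ≤ 1 := by nlinarith [pow_nonneg hw0 3, pow_nonneg hw0 2]
  have h3 : w * ((1 + w / 2) ^ 2 * (1 - w)) ≤ w * 1 := mul_le_mul_of_nonneg_left h2 hw0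
  have h4 : w * (1 + w / 2) ^ 2 * (1 - z) ≤ w * (1 + w / 2) ^ 2 * (1 - w) := by gcongr
  nlinarith

/-- Dividing by `W` places `(Y/W, 2r/W)` on the circle of radius `√(1/2)`. -/
theorem two_mul_add_le_of_profile {Y r η P W : ℝ} (hY : 0 ≤ Y) (hr : 0 ≤ r) (hη : 0 ≤ η)
    (hη1 : η ≤ 1) (hP : P = η * (1 - η) * (1 + η / 3)) (hW : 0 ≤ W) (hW1 : W ≤ 1)
    (hWe : W ^ 2 = 2 * Y ^ 2 + 8 * r ^ 2) :
    2 * r + (1 - r) * (Y * (1 - η)) + Y * P + 1.27 * (Y * P) ^ 2 ≤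
      W * (1 + W ^ 2 / 2) * (1 - r / 2 - Y * P) := by
  rcases hW.eq_or_lt with h0 | hpos
  · have hY0 : Y = 0 := by nlinarith
    have hr0 : r = 0 := by nlinarith
    simp [hY0, hr0, ← h0]
  have hab : (Y / W) ^ 2 + (2 * r / W) ^ 2 = 1 / 2 := by
    rw [div_pow, div_pow, ← add_div, div_eq_iff (by positivity)]
    linarith
  have h := circle_profile_le (div_nonneg hY hW) (by positivity : 0 ≤ 2 * r / W) hab hW hW1 hη hη1 hP
  have h2 := mul_le_mul_of_nonneg_left h hW
  have eY : Y / W * W = Y := div_mul_cancel₀ _ hpos.ne'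
  have er : 2 * r / W * W = 2 * r := div_mul_cancel₀ _ hpos.ne'
  have e1 : W * (2 * r / W + (1 - 2 * r / W * W / 2) * (Y / W * (1 - η)) + Y / W * P
      + 1.27 * (Y / W) ^ 2 * W * P ^ 2) =
      2 * r / W * W + (1 - 2 * r / W * W / 2) * (Y / W * W * (1 - η)) + (Y / W * W) * P
      + 1.27 * (Y / W * W * P) ^ 2 := by ring
  have e2 : W * ((1 + W ^ 2 / 2) * (1 - 2 * r / W * W / 4 - Y / W * W * P)) =
      W * (1 + W ^ 2 / 2) * (1 - 2 * r / W * W / 4 - Y / W * W * P) := by ring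
  rw [e1, e2, eY, er] at h2
  linarith

/-- The condition number is controlled by `ν` alone, `K² ≤ 1 / (1 - ν)`, and `ν ≤ 0.7072 (1 - η)`.
-/
theorem le_two_mul_one_sub_profile {ν η K Y : ℝ} (hη : 0 ≤ η) (hη1 : η ≤ 1) (hY1 : Y ≤ 0.7072)
    (hνY : ν ≤ Y * (1 - η)) (hKν : K ^ 2 * (1 - ν) ≤ 1) :
    K ≤ 2 * (1 - η * (1 - η) * (1 + η / 3)) := by
  have hP3 := cubic_profile_le hη hη1
  have h := four_mul_sq_profile_ge hη hη1
  generalize η * (1 - η) * (1 + η / 3) = P at *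
  have h5 : 1 - 0.7072 * (1 - η) ≤ 1 - ν := by nlinarith
  have h6 : 0 < 1 - 0.7072 * (1 - η) := by nlinarith
  have h7 : K ^ 2 * (1 - 0.7072 * (1 - η)) ≤ (2 * (1 - P)) ^ 2 * (1 - 0.7072 * (1 - η)) := by
    nlinarith [mul_le_mul_of_nonneg_left h5 (sq_nonneg K)]
  exact abs_le_of_sq_le_sq' (le_of_mul_le_mul_right h7 h6) (by linarith) |>.2

/-- In the worst case `z = 2Y²` the squared inequality reduces to `Y² (1 - 2Y)² ≥ 0`. -/
theorem le_sqrt_mul_one_sub {Y z : ℝ} (hY1 : Y < 1) (hz : 2 * Y ^ 2 ≤ z) (hz1 : z < 1) :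
    Y ≤ √(z / (1 - z)) * (1 - Y) := by
  have h1Y : 0 < 1 - Y := by linarith
  have h1z : 0 < 1 - z := by linarith
  rw [← div_le_iff₀ h1Y]
  refine Real.le_sqrt_of_sq_le ?_
  rw [div_pow, div_le_div_iff₀ (by positivity) h1z]
  nlinarith [mul_nonneg (sq_nonneg Y) (sq_nonneg (1 - 2 * Y)),
    mul_le_mul_of_nonneg_right hz (add_nonneg (sq_nonneg Y) (sq_nonneg (1 - Y)))]

/-- The last two inequalities are what the two branches of the maximum in the contraction factor
become once `β` is replaced by half of the target and the terms proportional to the target are moved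
to its side. -/
theorem trimmed_newton_margins {ν η r K Y z τ : ℝ} (hη : 0 ≤ η) (hη1 : η ≤ 1)
    (hr : 0 ≤ r) (hK : 1 ≤ K) (hY : 0 ≤ Y) (hνY : ν ≤ Y * (1 - η)) (hKν : K ^ 2 * (1 - ν) ≤ 1)
    (hz : 2 * Y ^ 2 + 8 * K ^ 2 * r ^ 2 ≤ z) (hz1 : z < 1)
    (hτ : τ = Y * (η * (1 - η) * (1 + η / 3))) :
    0 ≤ τ / (1 - τ) ∧ K * (τ / (1 - τ)) ≤ 0.4244 ∧ K * (1 + τ / (1 - τ)) ≤ 2 ∧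
    2 * r + (1 - r) * ν + τ / (1 - τ) ≤
      √(z / (1 - z)) * (1 - r / 2 - K * (τ / (1 - τ)) / 2) ∧
    τ / (1 - τ) ≤ √(z / (1 - z)) * (1 - K * (1 + τ / (1 - τ)) / 2) := by
  set P := η * (1 - η) * (1 + η / 3) with hP
  have h1η : 0 ≤ 1 - η := by linarith
  have hP0 : 0 ≤ P := by rw [hP]; positivity
  have hP3 : P ≤ 0.3 := cubic_profile_le hη hη1
  have hK2 : 1 ≤ K ^ 2 := by nlinarith
  have hr8 : 8 * r ^ 2 ≤ 8 * K ^ 2 * r ^ 2 := by nlinarith [sq_nonneg r]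
  -- From `2Y² < 1` and `8r² < 1`. The later constants follow: `τ ≤ 0.7072 · 0.3 < 0.2122` and `1 /
  -- (1 - 0.2122) < 1.27`.
  have hY1 : Y ≤ 0.7072 := by nlinarith [sq_nonneg r]
  have hr1 : r ≤ 0.36 := by nlinarith [sq_nonneg Y]
  have hτ0 : 0 ≤ τ := by rw [hτ]; positivity
  have hτP : τ ≤ P := by rw [hτ]; nlinarith
  have hτ1 : τ ≤ 0.2122 := by rw [hτ]; nlinarith
  have h1τ : 0 < 1 - τ := by linarith
  set θ := τ / (1 - τ) with hθ
  have hθ0 : 0 ≤ θ := by positivity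
  have hθ2 : θ ≤ τ + 1.27 * τ ^ 2 := by
    rw [hθ, div_le_iff₀ h1τ]; nlinarith [sq_nonneg τ, mul_nonneg hτ0 (sq_nonneg τ)]
  have hK2P : K ≤ 2 * (1 - P) := le_two_mul_one_sub_profile hη hη1 hY1 hνY hKν
  have hKθ : K * θ ≤ 2 * τ := by
    rw [hθ, mul_div_assoc', div_le_iff₀ h1τ]
    nlinarith
  set Z := √(z / (1 - z)) with hZ
  have hZ0 : 0 ≤ Z := Real.sqrt_nonneg _
  -- the branch dominated by the Byzantine machines
  have hS1 : 2 * r + (1 - r) * ν + θ ≤ Z * (1 - r / 2 - K * θ / 2) := by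
    have hW2 : √(2 * Y ^ 2 + 8 * r ^ 2) ^ 2 = 2 * Y ^ 2 + 8 * r ^ 2 := Real.sq_sqrt (by positivity)
    have hW1 : √(2 * Y ^ 2 + 8 * r ^ 2) ≤ 1 := by
      rw [Real.sqrt_le_one]; linarith
    have h8 := two_mul_add_le_of_profile hY hr hη hη1 hP (Real.sqrt_nonneg _) hW1 hW2
    have h9 := mul_one_add_half_sq_le_sqrt (W := √(2 * Y ^ 2 + 8 * r ^ 2))
      (z := z) (by rw [hW2]; linarith) hz1
    rw [← hτ] at h8
    have h10 : (1 - r) * ν ≤ (1 - r) * (Y * (1 - η)) := by gcongr; linarith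
    calc _ ≤ _ := by linarith
      _ ≤ _ := h8
      _ ≤ Z * (1 - r / 2 - τ) := by gcongr; linarith
      _ ≤ _ := by gcongr; linarith
  have h1θ : 1 + θ = 1 / (1 - τ) := by rw [hθ]; field_simp; ring
  have h11 : K * (1 + θ) / 2 ≤ (1 - P) / (1 - τ) := by
    rw [h1θ, mul_one_div, div_div, mul_comm (1 - τ), ← div_div]
    gcongr
    linarith
  have hK1θ : K * (1 + θ) ≤ 2 := by
    have : (1 - P) / (1 - τ) ≤ 1 := by rw [div_le_one h1τ]; linarith
    linarith
  -- the branch dominated by the curvature of the loss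
  have hS2 : θ ≤ Z * (1 - K * (1 + θ) / 2) := by
    have hZY : Y ≤ Z * (1 - Y) := le_sqrt_mul_one_sub (by linarith) (by nlinarith [sq_nonneg r]) hz1
    have h12 : 1 - (1 - P) / (1 - τ) = P * (1 - Y) / (1 - τ) := by
      
      rw [eq_div_iff h1τ.ne', sub_mul, div_mul_cancel₀ _ h1τ.ne', hτ]; ring
    calc θ = Y * (P / (1 - τ)) := by rw [hθ, hτ]; ring
      _ ≤ Z * (1 - Y) * (P / (1 - τ)) := by gcongr
      _ = Z * (1 - (1 - P) / (1 - τ)) := by rw [h12]; ring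
      _ ≤ _ := by gcongr
  exact ⟨hθ0, by linarith, hK1θ, hS1, hS2⟩

/-- The scalar inequality behind the contraction factor of the trimmed approximate Newton step. -/
theorem trimmed_newton_factor_le {ν η r K Y z β τ : ℝ} (hη : 0 ≤ η) (hη1 : η ≤ 1)
    (hr : 0 ≤ r) (hK : 1 ≤ K) (hY : 0 ≤ Y) (hνY : ν ≤ Y * (1 - η)) (hKν : K ^ 2 * (1 - ν) ≤ 1)
    (hz : 2 * Y ^ 2 + 8 * K ^ 2 * r ^ 2 ≤ z) (hz1 : z < 1)
    (hτ : τ = Y * (η * (1 - η) * (1 + η / 3))) :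
    K * max (r + (1 - r) * ν) ((1 - r) * β - r) + (r + K * (τ / (1 - τ))) * (1 + β) ≤
      max (K * √(z / (1 - z))) (2 * β) := by
  obtain ⟨hθ0, hKθ, hK1θ, hS1, hS2⟩ :=
    trimmed_newton_margins hη hη1 hr hK hY hνY hKν hz hz1 hτ
  have hr1 : r ≤ 0.36 := by
    have hK2 : 1 ≤ K ^ 2 := by nlinarith
    have hr8 : 8 * r ^ 2 ≤ 8 * K ^ 2 * r ^ 2 := by nlinarith [sq_nonneg r]
    nlinarith [sq_nonneg Y]
  have hZ0 : 0 ≤ √(z / (1 - z)) := Real.sqrt_nonneg _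
  generalize √(z / (1 - z)) = Z at *
  generalize τ / (1 - τ) = θ at *
  -- Replacing `β` by `T / 2` makes both branches linear in `T`, so that each needs checking only
  -- against `T ≥ K Z`.
  set T := max (K * Z) (2 * β) with hT
  have hTZ : K * Z ≤ T := le_max_left _ _
  have hTβ : 2 * β ≤ T := le_max_right _ _
  have hT0 : 0 ≤ T := le_trans (by positivity) hTZ
  have hKθ0 : 0 ≤ K * θ := by positivity
  have hc1 : 0 ≤ 1 - r / 2 - K * θ / 2 := by linarith
  have hc2 : 0 ≤ 1 - K * (1 + θ) / 2 := by
    linarith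
  have hA1 : K * (2 * r + (1 - r) * ν + θ) ≤ T * (1 - r / 2 - K * θ / 2) :=
    calc _ ≤ K * (Z * (1 - r / 2 - K * θ / 2)) := by gcongr
      _ = K * Z * (1 - r / 2 - K * θ / 2) := by ring
      _ ≤ _ := by gcongr
  have hA2 : K * θ ≤ T * (1 - K * (1 + θ) / 2) :=
    calc _ ≤ K * (Z * (1 - K * (1 + θ) / 2)) := by gcongr
      _ = K * Z * (1 - K * (1 + θ) / 2) := by ring
      _ ≤ _ := by gcongr
  have hq : (r + K * θ) * (1 + β) ≤ (r + K * θ) * (1 + T / 2) := by gcongr; linarith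
  have hKr : r ≤ K * r := by nlinarith
  rw [mul_max_of_nonneg _ _ (by linarith : (0 : ℝ) ≤ K), max_add, max_le_iff]
  constructor
  · nlinarith
  · have h13 : K * ((1 - r) * β - r) ≤ K * ((1 - r) * (T / 2) - r) := by
      gcongr
      · linarith
      · linarith
    have h14 : T * r ≤ T * (K * r) := by gcongr
    nlinarith

end TrimmedScalar

/-! ### Singular values as bounds for quadratic forms -/

section SingularValues

open scoped InnerProductSpace

theorem LinearMap.IsSymmetric.inner_apply_eq_sum {E : Type*} [NormedAddCommGroup E]
    [InnerProductSpace ℝ E] [FiniteDimensional ℝ E] {T : E →ₗ[ℝ] E} (hT : T.IsSymmetric) {d : ℕ}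
    (hd : Module.finrank ℝ E = d) (u : E) :
    ⟪u, T u⟫_ℝ = ∑ i, hT.eigenvalues hd i * (hT.eigenvectorBasis hd).repr u i ^ 2 := by
  rw [← (hT.eigenvectorBasis hd).repr.inner_map_map, PiLp.inner_apply]
  refine Finset.sum_congr rfl fun i _ => ?_
  rw [hT.eigenvectorBasis_apply_self_apply hd u i]
  simp
  ring

theorem OrthonormalBasis.norm_sq_eq_sum_repr {E ι : Type*} [NormedAddCommGroup E]
    [InnerProductSpace ℝ E] [Fintype ι] (b : OrthonormalBasis ι ℝ E) (u : E) :
    ‖u‖ ^ 2 = ∑ i, b.repr u i ^ 2 := by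
  rw [← b.repr.norm_map, EuclideanSpace.real_norm_sq_eq]

namespace Comrade

variable {d : ℕ} (M : Matrix (Fin d) (Fin d) ℝ)

theorem norm_sq_toEuclideanLin_eq (u : EuclideanSpace ℝ (Fin d)) :
    ‖Matrix.toEuclideanLin M u‖ ^ 2 = ∑ i : Fin d, (Matrix.toEuclideanLin M).singularValues i ^ 2 *
      ((Matrix.toEuclideanLin M).isSymmetric_adjoint_comp_self.eigenvectorBasis
        finrank_euclideanSpace_fin).repr u i ^ 2 := by
  set T := Matrix.toEuclideanLin M
  have h := T.isSymmetric_adjoint_comp_self.inner_apply_eq_sum finrank_euclideanSpace_fin u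
  rw [LinearMap.comp_apply, LinearMap.adjoint_inner_right, real_inner_self_eq_norm_sq] at h
  rw [h]
  exact Finset.sum_congr rfl fun i _ => by rw [T.sq_singularValues_fin finrank_euclideanSpace_fin]

theorem sigmaMax_nonneg : 0 ≤ sigmaMax M := LinearMap.singularValues_nonneg _ _

theorem sigmaMin_nonneg : 0 ≤ sigmaMin M := LinearMap.singularValues_nonneg _ _

theorem norm_toEuclideanLin_le (u : EuclideanSpace ℝ (Fin d)) :
    ‖Matrix.toEuclideanLin M u‖ ≤ sigmaMax M * ‖u‖ := by
  refine abs_le_of_sq_le_sq' ?_ (mul_nonneg (sigmaMax_nonneg M) (norm_nonneg u)) |>.2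
  rw [norm_sq_toEuclideanLin_eq, mul_pow, OrthonormalBasis.norm_sq_eq_sum_repr
    ((Matrix.toEuclideanLin M).isSymmetric_adjoint_comp_self.eigenvectorBasis
        finrank_euclideanSpace_fin), Finset.mul_sum]
  refine Finset.sum_le_sum fun i _ => ?_
  gcongr
  · exact LinearMap.singularValues_nonneg _ _
  · exact LinearMap.singularValues_antitone _ (Nat.zero_le _)

theorem sigmaMin_mul_norm_le (u : EuclideanSpace ℝ (Fin d)) :
    sigmaMin M * ‖u‖ ≤ ‖Matrix.toEuclideanLin M u‖ := by
  refine abs_le_of_sq_le_sq' ?_ (norm_nonneg _) |>.2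
  rw [norm_sq_toEuclideanLin_eq, mul_pow, OrthonormalBasis.norm_sq_eq_sum_repr
    ((Matrix.toEuclideanLin M).isSymmetric_adjoint_comp_self.eigenvectorBasis
        finrank_euclideanSpace_fin), Finset.mul_sum]
  refine Finset.sum_le_sum fun i _ => ?_
  gcongr
  · exact sigmaMin_nonneg M
  · exact LinearMap.singularValues_antitone _ (by have := i.2; omega)

theorem exists_norm_toEuclideanLin_eq {k : ℕ} (hk : k < d) :
    ∃ u : EuclideanSpace ℝ (Fin d), u ≠ 0 ∧
      ‖Matrix.toEuclideanLin M u‖ = (Matrix.toEuclideanLin M).singularValues k * ‖u‖ := by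
  set T := Matrix.toEuclideanLin M
  obtain ⟨u, hu⟩ := (T.hasEigenvalue_adjoint_comp_self_sq_singularValues
    (n := k) (by simpa using hk)).exists_hasEigenvector
  refine ⟨u, hu.2, ?_⟩
  have h := hu.apply_eq_smul
  have h2 : ⟪u, (LinearMap.adjoint T ∘ₗ T) u⟫_ℝ = ‖T u‖ ^ 2 := by
    rw [LinearMap.comp_apply, LinearMap.adjoint_inner_right, real_inner_self_eq_norm_sq]
  rw [h, real_inner_smul_right, real_inner_self_eq_norm_sq, ← mul_pow] at h2
  exact ((pow_left_inj₀ (mul_nonneg (LinearMap.singularValues_nonneg _ _) (norm_nonneg _))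
    (norm_nonneg _) two_ne_zero).1 h2).symm

theorem sigmaMax_le (hd : 0 < d) {C : ℝ}
    (h : ∀ u, ‖Matrix.toEuclideanLin M u‖ ≤ C * ‖u‖) : sigmaMax M ≤ C := by
  obtain ⟨u, hu, he⟩ := exists_norm_toEuclideanLin_eq M hd
  exact le_of_mul_le_mul_right (he ▸ h u) (norm_pos_iff.2 hu)

theorem le_sigmaMin (hd : 0 < d) {c : ℝ}
    (h : ∀ u, c * ‖u‖ ≤ ‖Matrix.toEuclideanLin M u‖) : c ≤ sigmaMin M := by
  obtain ⟨u, hu, he⟩ := exists_norm_toEuclideanLin_eq M (k := d - 1) (by omega)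
  exact le_of_mul_le_mul_right (he ▸ h u) (norm_pos_iff.2 hu)

theorem inner_toEuclideanLin_le (u : EuclideanSpace ℝ (Fin d)) :
    ⟪u, Matrix.toEuclideanLin M u⟫_ℝ ≤ sigmaMax M * ‖u‖ ^ 2 := by
  have h1 := real_inner_le_norm u (Matrix.toEuclideanLin M u)
  have h2 := mul_le_mul_of_nonneg_left (norm_toEuclideanLin_le M u) (norm_nonneg u)
  linarith

variable {M}

/-- For a positive semidefinite symmetric matrix each eigenvalue is `‖M e‖` for a unit eigenvector
`e`, hence at least the smallest singular value. -/
theorem sigmaMin_mul_norm_sq_le (hM : (Matrix.toEuclideanLin M).IsSymmetric)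
    (h0 : ∀ u, 0 ≤ ⟪u, Matrix.toEuclideanLin M u⟫_ℝ) (u : EuclideanSpace ℝ (Fin d)) :
    sigmaMin M * ‖u‖ ^ 2 ≤ ⟪u, Matrix.toEuclideanLin M u⟫_ℝ := by
  rw [hM.inner_apply_eq_sum finrank_euclideanSpace_fin, OrthonormalBasis.norm_sq_eq_sum_repr
    (hM.eigenvectorBasis finrank_euclideanSpace_fin), Finset.mul_sum]
  refine Finset.sum_le_sum fun i _ => mul_le_mul_of_nonneg_right ?_ (sq_nonneg _)
  have he := hM.apply_eigenvectorBasis finrank_euclideanSpace_fin i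
  have hn := (hM.eigenvectorBasis finrank_euclideanSpace_fin).orthonormal.1 i
  have h1 := sigmaMin_mul_norm_le M (hM.eigenvectorBasis finrank_euclideanSpace_fin i)
  have h2 := h0 (hM.eigenvectorBasis finrank_euclideanSpace_fin i)
  rw [he, real_inner_smul_right, real_inner_self_eq_norm_sq, hn] at h2
  rw [he, norm_smul, hn] at h1
  simp only [RCLike.ofReal_real_eq_id, id_eq, one_pow, mul_one, Real.norm_eq_abs] at h1 h2
  rwa [abs_of_nonneg h2] at h1

/-- The smallest singular value is at least any coercivity constant. -/
theorem le_sigmaMin_of_coercive (hd : 0 < d) {c : ℝ}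
    (h : ∀ u, c * ‖u‖ ^ 2 ≤ ⟪u, Matrix.toEuclideanLin M u⟫_ℝ) : c ≤ sigmaMin M := by
  refine le_sigmaMin M hd fun u => ?_
  rcases eq_or_ne u 0 with rfl | hu
  · simp
  have h1 := (h u).trans (real_inner_le_norm u (Matrix.toEuclideanLin M u))
  exact le_of_mul_le_mul_left (by linarith : ‖u‖ * (c * ‖u‖) ≤ _) (norm_pos_iff.2 hu)

end Comrade

end SingularValues

/-! ### Hessians as weighted sums of rank-one forms, and the averaged Hessian -/

open scoped InnerProductSpace Matrix

namespace Comrade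

namespace Erm

variable {n d : ℕ} (D : Erm n d)

/-- The matrix `(1/k) ∑_r c_{σ r} x_{σ r} x_{σ r}ᵀ + λ I`. -/
noncomputable def weightMat {k : ℕ} (σ : Fin k → Fin n) (c : Fin n → ℝ) :
    Matrix (Fin d) (Fin d) ℝ :=
  (1 / (k : ℝ)) • ∑ r, c (σ r) • Matrix.vecMulVec (D.x (σ r)).ofLp (D.x (σ r)).ofLp
    + D.lam • (1 : Matrix (Fin d) (Fin d) ℝ)

/-- The curvatures `ℓ''_j(wᵀ x_j)`. -/
noncomputable def curv (w : EuclideanSpace ℝ (Fin d)) (j : Fin n) : ℝ :=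
  deriv (deriv (D.ell j)) ⟪D.x j, w⟫_ℝ

theorem hessOn_eq_weightMat {k : ℕ} (σ : Fin k → Fin n) (w : EuclideanSpace ℝ (Fin d)) :
    D.hessOn σ w = D.weightMat σ (D.curv w) := rfl

theorem hess_eq_weightMat (w : EuclideanSpace ℝ (Fin d)) :
    D.hess w = D.weightMat id (D.curv w) := rfl

theorem toEuclideanLin_weightMat {k : ℕ} (σ : Fin k → Fin n) (c : Fin n → ℝ)
    (v : EuclideanSpace ℝ (Fin d)) :
    Matrix.toEuclideanLin (D.weightMat σ c) v =
      (1 / (k : ℝ)) • ∑ r, (c (σ r) * ⟪D.x (σ r), v⟫_ℝ) • D.x (σ r) + D.lam • v := by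
  ext i
  simp [weightMat, Matrix.toEuclideanLin, Matrix.toLpLin_apply,
    Matrix.vecMulVec_mulVec, PiLp.inner_apply, dotProduct, mul_comm, mul_left_comm]

theorem inner_weightMat {k : ℕ} (σ : Fin k → Fin n) (c : Fin n → ℝ)
    (u v : EuclideanSpace ℝ (Fin d)) :
    ⟪u, Matrix.toEuclideanLin (D.weightMat σ c) v⟫_ℝ =
      (1 / (k : ℝ)) * ∑ r, c (σ r) * ⟪D.x (σ r), u⟫_ℝ * ⟪D.x (σ r), v⟫_ℝ + D.lam * ⟪u, v⟫_ℝ := by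
  rw [toEuclideanLin_weightMat, inner_add_right, real_inner_smul_right, real_inner_smul_right,
    inner_sum]
  congr 2
  refine Finset.sum_congr rfl fun r _ => ?_
  rw [real_inner_smul_right, real_inner_comm u]
  ring

theorem inner_weightMat_self {k : ℕ} (σ : Fin k → Fin n) (c : Fin n → ℝ)
    (u : EuclideanSpace ℝ (Fin d)) :
    ⟪u, Matrix.toEuclideanLin (D.weightMat σ c) u⟫_ℝ =
      (1 / (k : ℝ)) * ∑ r, c (σ r) * ⟪D.x (σ r), u⟫_ℝ ^ 2 + D.lam * ‖u‖ ^ 2 := by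
  rw [inner_weightMat, real_inner_self_eq_norm_sq]
  simp only [sq, mul_assoc]

theorem isSymmetric_weightMat {k : ℕ} (σ : Fin k → Fin n) (c : Fin n → ℝ) :
    (Matrix.toEuclideanLin (D.weightMat σ c)).IsSymmetric := fun u v => by
  rw [real_inner_comm, inner_weightMat, inner_weightMat, real_inner_comm v u]
  congr 2
  exact Finset.sum_congr rfl fun r _ => by ring

theorem lam_mul_norm_sq_le {k : ℕ} (σ : Fin k → Fin n) {c : Fin n → ℝ} (hc : ∀ j, 0 ≤ c j)
    (u : EuclideanSpace ℝ (Fin d)) :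
    D.lam * ‖u‖ ^ 2 ≤ ⟪u, Matrix.toEuclideanLin (D.weightMat σ c) u⟫_ℝ := by
  rw [inner_weightMat_self]
  have : 0 ≤ (1 / (k : ℝ)) * ∑ r, c (σ r) * ⟪D.x (σ r), u⟫_ℝ ^ 2 :=
    mul_nonneg (by positivity) (Finset.sum_nonneg fun r _ => mul_nonneg (hc _) (sq_nonneg _))
  linarith

variable {D}

theorem monotone_deriv_ell (hconv : ∀ j, ConvexOn ℝ Set.univ (D.ell j))
    (hdiff : ∀ j, Differentiable ℝ (D.ell j)) (j : Fin n) : Monotone (deriv (D.ell j)) := by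
  have h := (hconv j).monotoneOn_deriv fun x _ => hdiff j x
  exact monotoneOn_univ.1 h

theorem curv_nonneg (hconv : ∀ j, ConvexOn ℝ Set.univ (D.ell j))
    (hdiff : ∀ j, Differentiable ℝ (D.ell j)) (w : EuclideanSpace ℝ (Fin d)) (j : Fin n) :
    0 ≤ D.curv w j :=
  (monotone_deriv_ell hconv hdiff j).deriv_nonneg

theorem grad_eq_zero_of_isMinOn (hdiff : ∀ j, Differentiable ℝ (D.ell j))
    {w : EuclideanSpace ℝ (Fin d)} (hw : IsMinOn D.loss Set.univ w) : D.grad w = 0 := by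
  have h := (hw.isLocalMin Filter.univ_mem).hasFDerivAt_eq_zero
    (hasGradientAt_iff_hasFDerivAt.1 (D.hasGradientAt_loss hdiff w))
  simpa using h

/-- Strong convexity bounds the Hessian from below. -/
theorem coercive_hess (hdiff : ∀ j, Differentiable ℝ (D.ell j))
    (hdiff2 : ∀ j, Differentiable ℝ (deriv (D.ell j))) {c : ℝ}
    (hc : StrongConvexOn Set.univ c D.loss) (w u : EuclideanSpace ℝ (Fin d)) :
    c * ‖u‖ ^ 2 ≤ ⟪u, Matrix.toEuclideanLin (D.hess w) u⟫_ℝ := by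
  rw [strongConvexOn_iff_convex] at hc
  have hline : ∀ t : ℝ, HasDerivAt (fun t : ℝ => w + t • u) u t := fun t => by
    simpa using ((hasDerivAt_id t).smul_const u).const_add w
  have hc2 : ConvexOn ℝ Set.univ
      (fun t : ℝ => D.loss (w + t • u) - c / 2 * ‖w + t • u‖ ^ 2) := by
    have h := hc.comp_affineMap (AffineMap.lineMap w (w + u))
    refine (h.congr fun t _ => ?_)
    simp [AffineMap.lineMap_apply, add_comm]
  have hd1 : ∀ t : ℝ, HasDerivAt (fun t : ℝ => D.loss (w + t • u) - c / 2 * ‖w + t • u‖ ^ 2)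
      (⟪D.grad (w + t • u), u⟫_ℝ - c * ⟪w + t • u, u⟫_ℝ) t := fun t => by
    have h1 := (hasGradientAt_iff_hasFDerivAt.1
      (D.hasGradientAt_loss hdiff (w + t • u))).comp_hasDerivAt t (hline t)
    have h2 := (hline t).norm_sq.const_mul (c / 2)
    refine (h1.sub h2).congr_deriv ?_
    simp
    ring
  -- Along a line the loss minus `(c/2)‖·‖²` is convex, so its derivative is monotone; the
  -- derivative of that at `0` is the quadratic form of `H - c I`.
  have hmono : Monotone fun t : ℝ => ⟪D.grad (w + t • u), u⟫_ℝ - c * ⟪w + t • u, u⟫_ℝ := by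
    have h := hc2.monotoneOn_deriv fun t _ => (hd1 t).differentiableAt
    rw [monotoneOn_univ] at h
    exact (funext fun t => (hd1 t).deriv) ▸ h
  have hd2 : HasDerivAt (fun t : ℝ => ⟪D.grad (w + t • u), u⟫_ℝ - c * ⟪w + t • u, u⟫_ℝ)
      (⟪Matrix.toEuclideanLin (D.hess w) u, u⟫_ℝ - c * ⟪u, u⟫_ℝ) 0 := by
    have h0 := D.hasFDerivAt_grad hdiff2 w
    have h0' : HasFDerivAt D.grad (Matrix.toEuclideanCLM (𝕜 := ℝ) (n := Fin d) (D.hess w))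
        (w + (0 : ℝ) • u) := by simpa using h0
    have h1 := (h0'.comp_hasDerivAt (0 : ℝ) (hline 0)).inner ℝ (hasDerivAt_const (0 : ℝ) u)
    have h2 := ((hline 0).inner ℝ (hasDerivAt_const (0 : ℝ) u)).const_mul c
    refine (h1.sub h2).congr_deriv ?_
    simp
    rfl
  have h := hmono.deriv_nonneg (x := 0)
  rw [hd2.deriv, real_inner_comm, real_inner_self_eq_norm_sq] at h
  linarith

/-- The weights of the Hessian averaged over the segment from `v` to `w`. -/
noncomputable def meanCurv (D : Erm n d) (v w : EuclideanSpace ℝ (Fin d)) (j : Fin n) : ℝ :=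
  -- A secant slope of `ℓ'_j`. When it degenerates, the argument of `ℓ''_j` is constant on the
  -- segment, and the curvature there is the average.
  if ⟪D.x j, w - v⟫_ℝ = 0 then D.curv w j
  else (deriv (D.ell j) ⟪D.x j, w⟫_ℝ - deriv (D.ell j) ⟪D.x j, v⟫_ℝ) / ⟪D.x j, w - v⟫_ℝ

theorem meanCurv_nonneg (hconv : ∀ j, ConvexOn ℝ Set.univ (D.ell j))
    (hdiff : ∀ j, Differentiable ℝ (D.ell j)) (v w : EuclideanSpace ℝ (Fin d)) (j : Fin n) :
    0 ≤ D.meanCurv v w j := by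
  rw [meanCurv]
  split_ifs with h
  · exact curv_nonneg hconv hdiff w j
  · have hm := monotone_deriv_ell hconv hdiff j
    rw [inner_sub_right]
    rcases le_total ⟪D.x j, v⟫_ℝ ⟪D.x j, w⟫_ℝ with h1 | h1
    · exact div_nonneg (sub_nonneg.2 (hm h1)) (sub_nonneg.2 h1)
    · exact div_nonneg_of_nonpos (sub_nonpos.2 (hm h1)) (sub_nonpos.2 h1)

theorem meanCurv_apply_sub (v w : EuclideanSpace ℝ (Fin d)) :
    Matrix.toEuclideanLin (D.weightMat id (D.meanCurv v w)) (w - v) = D.grad w - D.grad v := by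
  rw [toEuclideanLin_weightMat, grad, grad, gradOn, gradOn, add_sub_add_comm, ← smul_sub, ← smul_sub,
    ← Finset.sum_sub_distrib]
  congr 2
  refine Finset.sum_congr rfl fun j _ => ?_
  rw [← sub_smul, id, meanCurv]
  congr 1
  split_ifs with h
  · rw [h, mul_zero]
    rw [inner_sub_right, sub_eq_zero] at h
    rw [h, sub_self]
  · rw [div_mul_cancel₀ _ h]

/-- Formally the integral of `f' 1 - f' t` over `[0, 1]`; monotonicity of an auxiliary function
replaces the integral, as the second derivatives of the losses need not be integrable. -/
theorem abs_sub_sub_le_of_deriv_near_end {f f' : ℝ → ℝ} {C : ℝ} (hf : ∀ t, HasDerivAt f (f' t) t)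
    (h : ∀ t ∈ Set.Icc (0 : ℝ) 1, |f' 1 - f' t| ≤ C * (1 - t)) :
    |f' 1 - (f 1 - f 0)| ≤ C / 2 := by
  have key : ∀ s : ℝ, s = 1 ∨ s = -1 → s * (f' 1 - (f 1 - f 0)) ≤ C / 2 := fun s hs => by
    have hd : ∀ t, HasDerivAt (fun t => s * (t * f' 1 - f t) - C * (t - t ^ 2 / 2))
        (s * (1 * f' 1 - f' t) - C * (1 - (2 * t ^ (2 - 1) * 1) / 2)) t := fun t =>
      ((((hasDerivAt_id t).mul_const (f' 1)).sub (hf t)).const_mul s).sub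
        (((hasDerivAt_id t).sub (((hasDerivAt_id t).pow 2).div_const 2)).const_mul C)
    have hanti := antitoneOn_of_deriv_nonpos (convex_Icc (0 : ℝ) 1)
      (f := fun t => s * (t * f' 1 - f t) - C * (t - t ^ 2 / 2))
      (fun t _ => (hd t).continuousAt.continuousWithinAt)
      (fun t _ => (hd t).differentiableAt.differentiableWithinAt) (fun t ht => by
        rw [(hd t).deriv]
        have h1 := abs_le.1 (h t (interior_subset ht))
        norm_num
        rcases hs with rfl | rfl <;> linarith [h1.1, h1.2])
    have h2 := hanti (Set.left_mem_Icc.2 zero_le_one) (Set.right_mem_Icc.2 zero_le_one) zero_le_one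
    norm_num at h2
    rcases hs with rfl | rfl <;> linarith
  rw [abs_le]
  constructor
  · linarith [key (-1) (Or.inr rfl)]
  · linarith [key 1 (Or.inl rfl)]

theorem inner_weightMat_sub {k l : ℕ} (σ : Fin k → Fin n) (ρ : Fin l → Fin n) (c e : Fin n → ℝ)
    (u : EuclideanSpace ℝ (Fin d)) :
    ⟪u, (Matrix.toEuclideanLin (D.weightMat σ c) - Matrix.toEuclideanLin (D.weightMat ρ e)) u⟫_ℝ =
      (1 / (k : ℝ)) * ∑ r, c (σ r) * ⟪D.x (σ r), u⟫_ℝ ^ 2 -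
        (1 / (l : ℝ)) * ∑ r, e (ρ r) * ⟪D.x (ρ r), u⟫_ℝ ^ 2 := by
  rw [LinearMap.sub_apply, inner_sub_right, inner_weightMat_self, inner_weightMat_self]
  ring

theorem abs_inner_sub_le_specNorm (M N : Matrix (Fin d) (Fin d) ℝ) (u : EuclideanSpace ℝ (Fin d)) :
    |⟪u, (Matrix.toEuclideanLin M - Matrix.toEuclideanLin N) u⟫_ℝ| ≤
      specNorm (M - N) * ‖u‖ ^ 2 := by
  rw [← map_sub]
  have h := (Matrix.toEuclideanCLM (𝕜 := ℝ) (n := Fin d) (M - N)).le_opNorm u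
  refine (abs_real_inner_le_norm _ _).trans ?_
  have := mul_le_mul_of_nonneg_left h (norm_nonneg u)
  calc _ ≤ _ := this
    _ = _ := by rw [specNorm]; ring

/-- The averaged Hessian is close to the Hessian at the end of the segment. -/
theorem abs_inner_hess_sub_mean_le (hdiff2 : ∀ j, Differentiable ℝ (deriv (D.ell j))) {L : ℝ}
    (hL : ∀ w w', specNorm (D.hess w - D.hess w') ≤ L * ‖w - w'‖)
    (v w u : EuclideanSpace ℝ (Fin d)) :
    |⟪u, (Matrix.toEuclideanLin (D.hess w) -
      Matrix.toEuclideanLin (D.weightMat id (D.meanCurv v w))) u⟫_ℝ| ≤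
      L * ‖w - v‖ / 2 * ‖u‖ ^ 2 := by
  -- An explicit antiderivative of the curvature along the segment, whose increment over `[0, 1]` is
  -- `meanCurv`.
  set a : Fin n → ℝ → ℝ := fun j t => if ⟪D.x j, w - v⟫_ℝ = 0 then t * D.curv w j
    else deriv (D.ell j) (⟪D.x j, v⟫_ℝ + t * ⟪D.x j, w - v⟫_ℝ) / ⟪D.x j, w - v⟫_ℝ with ha
  have hpt : ∀ (j : Fin n) (t : ℝ), ⟪D.x j, v + t • (w - v)⟫_ℝ = ⟪D.x j, v⟫_ℝ + t * ⟪D.x j, w - v⟫_ℝ :=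
    fun j t => by rw [inner_add_right, real_inner_smul_right]
  have had : ∀ j t, HasDerivAt (a j) (D.curv (v + t • (w - v)) j) t := fun j t => by
    by_cases h : ⟪D.x j, w - v⟫_ℝ = 0
    · have e : a j = fun t => t * D.curv w j := by simp only [ha, h, if_true]
      have e2 : D.curv (v + t • (w - v)) j = 1 * D.curv w j := by
        rw [curv, hpt, h, mul_zero, add_zero, one_mul, curv]
        rw [inner_sub_right, sub_eq_zero] at h
        rw [h]
      rw [e, e2]
      exact (hasDerivAt_id t).mul_const _
    · have e : a j = fun t => deriv (D.ell j) (⟪D.x j, v⟫_ℝ + t * ⟪D.x j, w - v⟫_ℝ) /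
          ⟪D.x j, w - v⟫_ℝ := by simp only [ha, h, if_false]
      rw [e, curv, hpt]
      have h1 : HasDerivAt (fun t : ℝ => ⟪D.x j, v⟫_ℝ + t * ⟪D.x j, w - v⟫_ℝ)
          ⟪D.x j, w - v⟫_ℝ t := by
        simpa using ((hasDerivAt_id t).mul_const ⟪D.x j, w - v⟫_ℝ).const_add ⟪D.x j, v⟫_ℝ
      have h2 := (((hdiff2 j _).hasDerivAt).comp t h1).div_const ⟪D.x j, w - v⟫_ℝ
      rw [mul_div_assoc, div_self h, mul_one] at h2
      exact h2
  have ha01 : ∀ j, a j 1 - a j 0 = D.meanCurv v w j := fun j => by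
    simp only [ha, meanCurv]
    split_ifs with h
    · ring
    · rw [← sub_div, one_mul, zero_mul, add_zero, inner_sub_right, add_sub_cancel]
  have hf : ∀ t, HasDerivAt (fun t => (1 / (n : ℝ)) * ∑ j, a j t * ⟪D.x j, u⟫_ℝ ^ 2)
      ((1 / (n : ℝ)) * ∑ j, D.curv (v + t • (w - v)) j * ⟪D.x j, u⟫_ℝ ^ 2) t := fun t =>
    (HasDerivAt.fun_sum fun j _ => (had j t).mul_const _).const_mul _
  have e1 : v + (1 : ℝ) • (w - v) = w := by rw [one_smul, add_sub_cancel]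
  have h := abs_sub_sub_le_of_deriv_near_end (C := L * ‖w - v‖ * ‖u‖ ^ 2) hf fun t ht => by
    have h1 := abs_inner_sub_le_specNorm (D.hess w) (D.hess (v + t • (w - v))) u
    rw [hess_eq_weightMat, hess_eq_weightMat, inner_weightMat_sub] at h1
    rw [e1]
    refine h1.trans ?_
    have h2 := hL w (v + t • (w - v))
    have e3 : w - (v + t • (w - v)) = (1 - t) • (w - v) := by rw [sub_smul, one_smul]; abel
    rw [e3, norm_smul, Real.norm_eq_abs, abs_of_nonneg (by linarith [ht.2])] at h2
    calc _ ≤ L * ((1 - t) * ‖w - v‖) * ‖u‖ ^ 2 := mul_le_mul_of_nonneg_right h2 (sq_nonneg _)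
      _ = _ := by ring
  rw [hess_eq_weightMat, inner_weightMat_sub]
  have e2 : (1 / (n : ℝ)) * ∑ j, a j 1 * ⟪D.x j, u⟫_ℝ ^ 2 -
      (1 / (n : ℝ)) * ∑ j, a j 0 * ⟪D.x j, u⟫_ℝ ^ 2 =
      (1 / (n : ℝ)) * ∑ j, D.meanCurv v w j * ⟪D.x j, u⟫_ℝ ^ 2 := by
    rw [← mul_sub, ← Finset.sum_sub_distrib]
    congr 1
    exact Finset.sum_congr rfl fun j _ => by rw [← ha01]; ring
  rw [e1, e2] at h
  calc _ ≤ _ := h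
    _ = _ := by ring

end Erm

end Comrade

/-! ### Row sampling and coherence; bounds through `ν` and `κ` -/

namespace Comrade

/-- The coordinates, in the left singular vectors of `A`, of the `j`-th row of `A`. -/
noncomputable def leftRow {n d : ℕ} (A : Matrix (Fin n) (Fin d) ℝ) (j : Fin n) :
    Fin (Module.finrank ℝ (colSpace A)) → ℝ :=
  fun k => (stdOrthonormalBasis ℝ (colSpace A) k : EuclideanSpace ℝ (Fin n)) j

section LeftRow

variable {n d : ℕ} (A : Matrix (Fin n) (Fin d) ℝ)

theorem sum_vecMulVec_leftRow :
    ∑ j, Matrix.vecMulVec (leftRow A j) (leftRow A j) = 1 := by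
  ext k l
  have h := orthonormal_iff_ite.1 (stdOrthonormalBasis ℝ (colSpace A)).orthonormal k l
  rw [Submodule.coe_inner, PiLp.inner_apply] at h
  simp only [Matrix.sum_apply, Matrix.vecMulVec_apply, leftRow, Matrix.one_apply]
  rw [← h]
  exact Finset.sum_congr rfl fun j _ => by simp [mul_comm]

theorem natCast_mul_dotProduct_leftRow_le (hd : 0 < d) (j : Fin n) :
    (n : ℝ) * (leftRow A j ⬝ᵥ leftRow A j) ≤ coherence A * d := by
  have hd0 : (d : ℝ) ≠ 0 := by exact_mod_cast hd.ne'
  rw [coherence, div_mul_eq_mul_div, div_mul_cancel₀ _ hd0]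
  gcongr
  refine le_trans (le_of_eq ?_) (le_ciSup (f := fun i : Fin n =>
    ∑ k, ((stdOrthonormalBasis ℝ (colSpace A) k : EuclideanSpace ℝ (Fin n)) i) ^ 2)
    (Set.finite_range _).bddAbove j)
  simp only [dotProduct, leftRow, sq]

/-- Every `A u` lies in the column space, so the form of `A` in `u` is that of the left singular
rows in the coordinates of `A u`; the rank and conditioning of `A` disappear. -/
theorem exists_leftRow_coordinates (u : EuclideanSpace ℝ (Fin d)) :
    ∃ c : Fin (Module.finrank ℝ (colSpace A)) → ℝ,
      ∀ j, Matrix.toEuclideanLin A u j = leftRow A j ⬝ᵥ c := by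
  set v : colSpace A := ⟨Matrix.toEuclideanLin A u, LinearMap.mem_range_self _ u⟩ with hv
  refine ⟨fun k => (stdOrthonormalBasis ℝ (colSpace A)).repr v k, fun j => ?_⟩
  have h := congrArg (fun z : colSpace A => (z : EuclideanSpace ℝ (Fin n)) j)
    ((stdOrthonormalBasis ℝ (colSpace A)).sum_repr v)
  simp only [Submodule.coe_sum, Submodule.coe_smul, WithLp.ofLp_sum, WithLp.ofLp_smul,
    Finset.sum_apply, Pi.smul_apply, smul_eq_mul] at h
  rw [show Matrix.toEuclideanLin A u j = (v : EuclideanSpace ℝ (Fin n)) j from rfl, ← h]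
  simp only [dotProduct, leftRow]
  exact Finset.sum_congr rfl fun k _ => mul_comm _ _

theorem finrank_colSpace_le : Module.finrank ℝ (colSpace A) ≤ d := by
  have h := LinearMap.finrank_range_le (Matrix.toEuclideanLin A)
  rwa [finrank_euclideanSpace_fin] at h

/-- Row sampling preserves the quadratic form of a matrix up to a factor in `[1 - h, 1 + h]`, with
few exceptions. -/
theorem card_sketch_bad_le (hd : 0 < d) (hn : 0 < n) {s : ℕ} (hs : 0 < s) {h e l : ℝ} (hh : 0 ≤ h)
    (he : coherence A * d * e * l ≤ s * (h ^ 2 / (2 * (1 + h / 3))))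
    (bad : Finset (Fin s → Fin n))
    (hbad : ∀ σ ∈ bad, ∃ u, h * ((1 / (n : ℝ)) * ∑ j, Matrix.toEuclideanLin A u j ^ 2) <
      |(1 / (s : ℝ)) * ∑ r, Matrix.toEuclideanLin A u (σ r) ^ 2 -
        (1 / (n : ℝ)) * ∑ j, Matrix.toEuclideanLin A u j ^ 2|) :
    (bad.card : ℝ) ≤ n ^ s * (2 * (d * Real.exp (-(e * l)))) := by
  classical
  rcases bad.eq_empty_or_nonempty with rfl | ⟨σ₀, hσ₀⟩
  · simp only [Finset.card_empty, Nat.cast_zero]; positivity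
  have hn0 : (0 : ℝ) < n := by exact_mod_cast hn
  have hs0 : (0 : ℝ) < s := by exact_mod_cast hs
  set R := coherence A * d with hR
  set X : Fin n → Matrix _ _ ℝ := fun j => (n : ℝ) • Matrix.vecMulVec (leftRow A j) (leftRow A j)
    with hX
  have hXT : ∀ j, (X j)ᵀ = X j := fun j => by
    simp only [hX, Matrix.transpose_smul, Matrix.transpose_vecMulVec]
  have hXq : ∀ j v, v ⬝ᵥ X j *ᵥ v = n * (leftRow A j ⬝ᵥ v) ^ 2 := fun j v => by
    simp only [hX, Matrix.smul_mulVec, Matrix.vecMulVec_mulVec, dotProduct_smul, smul_eq_mul,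
      MulOpposite.smul_eq_mul_unop, MulOpposite.unop_op]
    rw [dotProduct_comm v]
    ring
  have hXsum : ∑ j, X j = (n : ℝ) • 1 := by
    rw [← sum_vecMulVec_leftRow A, Finset.smul_sum]
  have hself : ∀ v, ∑ j, (leftRow A j ⬝ᵥ v) ^ 2 = v ⬝ᵥ v := fun v => by
    have h1 := congrArg (fun M => v ⬝ᵥ M *ᵥ v) hXsum
    simp only [Matrix.sum_mulVec, dotProduct_sum, hXq, Matrix.smul_mulVec, Matrix.one_mulVec,
      dotProduct_smul, smul_eq_mul, ← Finset.mul_sum] at h1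
    exact mul_left_cancel₀ hn0.ne' h1
  have hX0 : ∀ j v, 0 ≤ v ⬝ᵥ X j *ᵥ v := fun j v => by rw [hXq]; positivity
  have hXR : ∀ j v, v ⬝ᵥ X j *ᵥ v ≤ R * (v ⬝ᵥ v) := fun j v => by
    rw [hXq]
    have h1 : (leftRow A j ⬝ᵥ v) ^ 2 ≤ (leftRow A j ⬝ᵥ leftRow A j) * (v ⬝ᵥ v) := by
      simp only [dotProduct, ← sq]
      exact Finset.sum_mul_sq_le_sq_mul_sq _ _ _
    have hv0 : 0 ≤ v ⬝ᵥ v := by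
      rw [← hself]; positivity
    calc (n : ℝ) * (leftRow A j ⬝ᵥ v) ^ 2 ≤ n * ((leftRow A j ⬝ᵥ leftRow A j) * (v ⬝ᵥ v)) := by gcongr
      _ = (n * (leftRow A j ⬝ᵥ leftRow A j)) * (v ⬝ᵥ v) := by ring
      _ ≤ _ := mul_le_mul_of_nonneg_right (natCast_mul_dotProduct_leftRow_le A hd j) hv0
  have hdir : ∀ σ ∈ bad, ∃ v, v ≠ 0 ∧ ((1 + h) * s * (v ⬝ᵥ v) ≤ v ⬝ᵥ (∑ r, X (σ r)) *ᵥ v ∨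
      v ⬝ᵥ (∑ r, X (σ r)) *ᵥ v ≤ (1 - h) * s * (v ⬝ᵥ v)) := fun σ hσ => by
    obtain ⟨u, hu⟩ := hbad σ hσ
    obtain ⟨c, hc⟩ := exists_leftRow_coordinates A u
    simp only [hc, hself] at hu
    have hq : c ⬝ᵥ (∑ r, X (σ r)) *ᵥ c = n * ∑ r, (leftRow A (σ r) ⬝ᵥ c) ^ 2 := by
      simp only [Matrix.sum_mulVec, dotProduct_sum, hXq, Finset.mul_sum]
    refine ⟨c, ?_, ?_⟩
    -- The deviation in `hbad` is strict, which excludes the zero vector of coordinates.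
    · rintro rfl
      simp at hu
    · rw [hq]
      set q := ∑ r, (leftRow A (σ r) ⬝ᵥ c) ^ 2
      rcases lt_abs.1 hu with h1 | h1
      · left
        have h2 : (1 + h) * (1 / (n : ℝ) * (c ⬝ᵥ c)) * (s * n) ≤ 1 / (s : ℝ) * q * (s * n) := by
          exact mul_le_mul_of_nonneg_right (by linarith) (by positivity)
        field_simp at h2
        linarith
      · right
        have h2 : 1 / (s : ℝ) * q * (s * n) ≤ (1 - h) * (1 / (n : ℝ) * (c ⬝ᵥ c)) * (s * n) := by
          exact mul_le_mul_of_nonneg_right (by linarith) (by positivity)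
        field_simp at h2
        linarith
  -- The `X j` average to `1`, so `R ≥ 1` as soon as the column space is nonzero; a bad sample
  -- supplies a nonzero vector.
  have hRpos : 0 < R := by
    obtain ⟨v, hv, -⟩ := hdir σ₀ hσ₀
    have hvv : 0 < v ⬝ᵥ v := by
      have h0 : 0 ≤ v ⬝ᵥ v := by rw [← hself]; positivity
      exact lt_of_le_of_ne h0 fun h1 => hv (dotProduct_self_eq_zero.1 h1.symm)
    have h1 : (n : ℝ) * (v ⬝ᵥ v) ≤ n * (R * (v ⬝ᵥ v)) := by
      calc (n : ℝ) * (v ⬝ᵥ v) = ∑ j, v ⬝ᵥ X j *ᵥ v := by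
            simp only [hXq, ← Finset.mul_sum, hself]
        _ ≤ ∑ j : Fin n, R * (v ⬝ᵥ v) := Finset.sum_le_sum fun j _ => hXR j v
        _ = _ := by simp
    have h2 : 1 * (v ⬝ᵥ v) ≤ R * (v ⬝ᵥ v) := by
      rw [one_mul]; exact le_of_mul_le_mul_left h1 hn0
    linarith [le_of_mul_le_mul_right h2 hvv]
  have hexp : e * l ≤ s / R * (h ^ 2 / (2 * (1 + h / 3))) := by
    rw [div_mul_eq_mul_div, le_div_iff₀ hRpos]; linarith
  have hexp2 : s / R * (h ^ 2 / (2 * (1 + h / 3))) ≤ s / R * (h ^ 2 / 2) := by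
    gcongr
    linarith
  have hcard : (Fintype.card (Fin (Module.finrank ℝ (colSpace A))) : ℝ) ≤ d := by
    rw [Fintype.card_fin]; exact_mod_cast finrank_colSpace_le A
  set p : (Fin s → Fin n) → Prop := fun σ => ∃ v : Fin (Module.finrank ℝ (colSpace A)) → ℝ, v ≠ 0 ∧
    (1 + h) * s * (v ⬝ᵥ v) ≤ v ⬝ᵥ (∑ r, X (σ r)) *ᵥ v with hp
  have h1 := Matrix.card_exists_mulVec_ge_one_add_le X hXT hRpos hX0 hXR hXsum s hh (bad.filter p)
    fun σ hσ => (Finset.mem_filter.1 hσ).2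
  have h2 := Matrix.card_exists_mulVec_le_one_sub_le X hXT hRpos hX0 hXR hXsum s hh
    (bad.filter fun σ => ¬ p σ) fun σ hσ => by
      obtain ⟨hσ1, hσ2⟩ := Finset.mem_filter.1 hσ
      obtain ⟨v, hv, h3 | h3⟩ := hdir σ hσ1
      · exact absurd ⟨v, hv, h3⟩ hσ2
      · exact ⟨v, hv, h3⟩
  have hsplit : (bad.card : ℝ) = (bad.filter p).card + (bad.filter fun σ => ¬ p σ).card := by
    exact_mod_cast (Finset.card_filter_add_card_filter_not (s := bad) p).symm
  rw [hsplit]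
  have h3 : (n : ℝ) ^ s * (Fintype.card (Fin (Module.finrank ℝ (colSpace A))) *
      Real.exp (-(s / R * (h ^ 2 / (2 * (1 + h / 3)))))) ≤ n ^ s * (d * Real.exp (-(e * l))) := by
    gcongr
  have h4 : (n : ℝ) ^ s * (Fintype.card (Fin (Module.finrank ℝ (colSpace A))) *
      Real.exp (-(s / R * (h ^ 2 / 2)))) ≤ n ^ s * (d * Real.exp (-(e * l))) := by
    refine mul_le_mul_of_nonneg_left (mul_le_mul hcard (Real.exp_le_exp.2 ?_) ?_ ?_) ?_ <;>
      first | positivity | linarith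
  linarith

end LeftRow

namespace Erm

variable {n d : ℕ} {D : Erm n d}

theorem toEuclideanLin_rowMat_apply (w u : EuclideanSpace ℝ (Fin d)) (j : Fin n) :
    Matrix.toEuclideanLin (D.rowMat w) u j = √(D.curv w j) * ⟪D.x j, u⟫_ℝ := by
  simp only [Matrix.toEuclideanLin, Matrix.toLpLin_apply, rowMat, Matrix.mulVec, dotProduct,
    Matrix.of_apply, PiLp.inner_apply, Finset.mul_sum, curv]
  refine Finset.sum_congr rfl fun i _ => ?_
  simp
  ring

theorem sq_toEuclideanLin_rowMat_apply {w : EuclideanSpace ℝ (Fin d)} (hc : ∀ j, 0 ≤ D.curv w j)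
    (u : EuclideanSpace ℝ (Fin d)) (j : Fin n) :
    Matrix.toEuclideanLin (D.rowMat w) u j ^ 2 = D.curv w j * ⟪D.x j, u⟫_ℝ ^ 2 := by
  rw [toEuclideanLin_rowMat_apply, mul_pow, Real.sq_sqrt (hc j)]

theorem hess_eq_gram {w : EuclideanSpace ℝ (Fin d)} (hc : ∀ j, 0 ≤ D.curv w j) :
    D.hess w = (1 / (n : ℝ)) • ((D.rowMat w).transpose * D.rowMat w) + D.lam • 1 := by
  rw [hess_eq_weightMat, weightMat]
  congr 2
  ext a b
  rw [Matrix.sum_apply, Matrix.mul_apply]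
  refine Finset.sum_congr rfl fun j _ => ?_
  have h := Real.mul_self_sqrt (hc j)
  simp only [Matrix.smul_apply, Matrix.vecMulVec_apply, Matrix.transpose_apply, rowMat,
    Matrix.of_apply, smul_eq_mul, id, curv] at h ⊢
  linear_combination (-(D.x j a * D.x j b)) * h

/-- `σ_max(AᵀA) / n`. -/
noncomputable def gramTop (D : Erm n d) (w : EuclideanSpace ℝ (Fin d)) : ℝ :=
  sigmaMax ((D.rowMat w).transpose * D.rowMat w) / n

theorem gramTop_nonneg (w : EuclideanSpace ℝ (Fin d)) : 0 ≤ D.gramTop w :=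
  div_nonneg (sigmaMax_nonneg _) (Nat.cast_nonneg n)

theorem nu_eq (hn : 0 < n) (w : EuclideanSpace ℝ (Fin d)) :
    D.nu w = D.gramTop w / (D.gramTop w + D.lam) := by
  have hn0 : (n : ℝ) ≠ 0 := by exact_mod_cast hn.ne'
  rw [nu, gramTop, ← mul_div_mul_right _ (_ + D.lam) hn0, add_mul, div_mul_cancel₀ _ hn0,
    mul_comm D.lam]

theorem norm_hess_apply_le (hlam : 0 ≤ D.lam) {w : EuclideanSpace ℝ (Fin d)}
    (hc : ∀ j, 0 ≤ D.curv w j) (u : EuclideanSpace ℝ (Fin d)) :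
    ‖Matrix.toEuclideanLin (D.hess w) u‖ ≤ (D.gramTop w + D.lam) * ‖u‖ := by
  rw [hess_eq_gram hc, map_add, map_smul, map_smul, LinearMap.add_apply, LinearMap.smul_apply,
    LinearMap.smul_apply]
  refine (norm_add_le _ _).trans ?_
  rw [norm_smul, norm_smul, add_mul, Real.norm_eq_abs, Real.norm_eq_abs, abs_of_nonneg hlam,
    abs_of_nonneg (by positivity)]
  have h1 := norm_toEuclideanLin_le ((D.rowMat w).transpose * D.rowMat w) u
  have e : Matrix.toEuclideanLin (1 : Matrix (Fin d) (Fin d) ℝ) u = u := by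
    ext i; simp [Matrix.toEuclideanLin]
  rw [e]
  refine add_le_add ?_ le_rfl
  calc _ ≤ 1 / (n : ℝ) * (sigmaMax ((D.rowMat w).transpose * D.rowMat w) * ‖u‖) :=
        mul_le_mul_of_nonneg_left h1 (by positivity)
    _ = _ := by rw [gramTop]; ring

theorem inner_hess_le (hlam : 0 ≤ D.lam) {w : EuclideanSpace ℝ (Fin d)}
    (hc : ∀ j, 0 ≤ D.curv w j) (u : EuclideanSpace ℝ (Fin d)) :
    ⟪u, Matrix.toEuclideanLin (D.hess w) u⟫_ℝ ≤ (D.gramTop w + D.lam) * ‖u‖ ^ 2 := by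
  have h1 := real_inner_le_norm u (Matrix.toEuclideanLin (D.hess w) u)
  have h2 := mul_le_mul_of_nonneg_left (norm_hess_apply_le hlam hc u) (norm_nonneg u)
  linarith

/-- Here `1 - ν = λ / (σ_max(AᵀA)/n + λ)`, and the denominator is an upper bound for `H`. So `ν`
measures how far `H` is from its ridge part. -/
theorem one_sub_nu_mul_inner_hess_le (hn : 0 < n) (hlam : 0 < D.lam)
    {w : EuclideanSpace ℝ (Fin d)} (hc : ∀ j, 0 ≤ D.curv w j) (u : EuclideanSpace ℝ (Fin d)) :
    (1 - D.nu w) * ⟪u, Matrix.toEuclideanLin (D.hess w) u⟫_ℝ ≤ D.lam * ‖u‖ ^ 2 := by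
  have hpos : 0 < D.gramTop w + D.lam := by have := gramTop_nonneg (D := D) w; linarith
  have e : 1 - D.nu w = D.lam / (D.gramTop w + D.lam) := by
    rw [nu_eq hn]; field_simp; ring
  rw [e, div_mul_eq_mul_div, div_le_iff₀ hpos]
  have := mul_le_mul_of_nonneg_left (inner_hess_le hlam.le hc u) hlam.le
  linarith

theorem sum_curv_mul_le_nu_mul (hn : 0 < n) (hlam : 0 < D.lam)
    {w : EuclideanSpace ℝ (Fin d)} (hc : ∀ j, 0 ≤ D.curv w j) (u : EuclideanSpace ℝ (Fin d)) :
    (1 / (n : ℝ)) * ∑ j, D.curv w j * ⟪D.x j, u⟫_ℝ ^ 2 ≤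
      D.nu w * ⟪u, Matrix.toEuclideanLin (D.hess w) u⟫_ℝ := by
  have h := one_sub_nu_mul_inner_hess_le hn hlam hc u
  have h2 := D.inner_weightMat_self id (D.curv w) u
  rw [← hess_eq_weightMat] at h2
  simp only [id] at h2
  linarith

theorem nu_nonneg (hn : 0 < n) (hlam : 0 ≤ D.lam) (w : EuclideanSpace ℝ (Fin d)) : 0 ≤ D.nu w := by
  rw [nu_eq hn]
  have := gramTop_nonneg (D := D) w
  positivity

theorem nu_lt_one (hn : 0 < n) (hlam : 0 < D.lam) (w : EuclideanSpace ℝ (Fin d)) : D.nu w < 1 := by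
  have := gramTop_nonneg (D := D) w
  rw [nu_eq hn, div_lt_one (by linarith)]
  linarith

theorem lam_le_sigmaMin_hess (hd : 0 < d) {w : EuclideanSpace ℝ (Fin d)}
    (hc : ∀ j, 0 ≤ D.curv w j) : D.lam ≤ sigmaMin (D.hess w) :=
  le_sigmaMin_of_coercive hd fun u => D.lam_mul_norm_sq_le id hc u

theorem kappa_mul_one_sub_nu_le (hn : 0 < n) (hd : 0 < d) (hlam : 0 < D.lam)
    {w : EuclideanSpace ℝ (Fin d)} (hc : ∀ j, 0 ≤ D.curv w j) :
    D.kappa w * (1 - D.nu w) ≤ 1 := by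
  have hpos : 0 < D.gramTop w + D.lam := by have := gramTop_nonneg (D := D) w; linarith
  have e : 1 - D.nu w = D.lam / (D.gramTop w + D.lam) := by
    rw [nu_eq hn]; field_simp; ring
  have h1 := lam_le_sigmaMin_hess hd hc
  have h2 := sigmaMax_le _ hd (norm_hess_apply_le hlam.le hc)
  have h3 := sigmaMax_nonneg (D.hess w)
  rw [kappa, e, div_mul_div_comm, div_le_one (by nlinarith)]
  nlinarith

theorem one_le_kappa {w : EuclideanSpace ℝ (Fin d)} (hσ : 0 < sigmaMin (D.hess w)) :
    1 ≤ D.kappa w := by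
  rw [kappa, one_le_div hσ]
  exact LinearMap.singularValues_antitone _ (Nat.zero_le _)

/-- The ridge parameter is positive as soon as `ν < 1`. -/
theorem lam_pos_of_nu_lt_one (hn : 0 < n) (hlam : 0 ≤ D.lam) {w : EuclideanSpace ℝ (Fin d)}
    (hc : ∀ j, 0 ≤ D.curv w j) (hd : 0 < d) {c : ℝ} (hc0 : 0 < c)
    (hcoer : ∀ u, c * ‖u‖ ^ 2 ≤ ⟪u, Matrix.toEuclideanLin (D.hess w) u⟫_ℝ)
    (hν : D.nu w < 1) : 0 < D.lam := by
  refine lt_of_le_of_ne hlam fun h0 => ?_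
  rw [nu_eq hn, ← h0, add_zero] at hν
  -- With `λ = 0` the quotient `ν` is `1`, except for the convention `0 / 0 = 0`; in that case the
  -- Hessian vanishes, against coercivity.
  have hg : D.gramTop w = 0 := by
    by_contra hne
    rw [div_self hne] at hν
    exact lt_irrefl _ hν
  have hu := inner_hess_le hlam hc (EuclideanSpace.single (⟨0, hd⟩ : Fin d) (1 : ℝ))
  have hu2 := hcoer (EuclideanSpace.single (⟨0, hd⟩ : Fin d) (1 : ℝ))
  rw [hg, ← h0] at hu
  simp at hu hu2
  linarith

end Erm

end Comrade

/-! ### Counting atypical samples of one machine -/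

/-- The left side is `d^(1-e) (δ/m)^e`, and `d^(1-e) ≤ 1`: the logarithm of the sample size absorbs
the dimension. -/
theorem Real.natCast_mul_exp_neg_mul_log_le {d : ℕ} (hd : 0 < d) {m δ e : ℝ} (hm : 0 < m)
    (hδ : 0 < δ) (he : 1 ≤ e) :
    (d : ℝ) * Real.exp (-(e * Real.log (m * d / δ))) ≤ (δ / m) ^ e := by
  have hd0 : (0 : ℝ) < d := by exact_mod_cast hd
  have hd1 : (1 : ℝ) ≤ d := by exact_mod_cast hd
  have h1 : Real.log (m * d / δ) = Real.log d - Real.log (δ / m) := by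
    rw [← Real.log_div hd0.ne' (by positivity)]
    congr 1
    field_simp
  rw [h1, Real.rpow_def_of_pos (by positivity)]
  nth_rewrite 1 [← Real.exp_log hd0]
  rw [← Real.exp_add, Real.exp_le_exp]
  nlinarith [Real.log_nonneg hd1]

theorem Real.exp_neg_three_halves_le : Real.exp (-(3 / 2)) ≤ 0.2232 := by
  have h1 : Real.exp (-(3 / 2)) ^ 2 = Real.exp (-1) ^ 3 := by
    rw [← Real.exp_nat_mul, ← Real.exp_nat_mul]; norm_num
  have h2 := Real.exp_neg_one_lt_d9
  have h3 : Real.exp (-1) ^ 3 ≤ 0.3678794412 ^ 3 := by gcongr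
  refine abs_le_of_sq_le_sq' (?_ : _ ≤ (0.2232 : ℝ) ^ 2) (by norm_num) |>.2
  rw [h1]
  exact h3.trans (by norm_num)

namespace Comrade

namespace Erm

variable {n d : ℕ} (D : Erm n d)

/-- The Hessian or the gradient over the samples `σ` is far from the exact one: by more than `h`
times the Hessian of the unregularized risk, or by more than `c` times `max_j ‖b_j‖`. -/
def IsAtypical (h c : ℝ) {s : ℕ} (σ : Fin s → Fin n) (w : EuclideanSpace ℝ (Fin d)) : Prop :=
  (∃ u : EuclideanSpace ℝ (Fin d), h * ((1 / (n : ℝ)) * ∑ j, D.curv w j * ⟪D.x j, u⟫_ℝ ^ 2) <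
    |(1 / (s : ℝ)) * ∑ r, D.curv w (σ r) * ⟪D.x (σ r), u⟫_ℝ ^ 2 -
      (1 / (n : ℝ)) * ∑ j, D.curv w j * ⟪D.x j, u⟫_ℝ ^ 2|) ∨
  c * D.maxGradNorm w < ‖D.gradOn σ w - D.grad w‖

variable {D}

/-- The deviation is enlarged from `η` to `a η (1 + η/3)` to cancel the Bernstein denominator: `1 +
h/3 ≤ (1 + η/3)²`, so the sample size gives the exponent `(3/2) a²` uniformly in `η`. -/
theorem card_hessOn_far_le (hn : 0 < n) (hd : 0 < d) {s : ℕ} (hs : 0 < s)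
    {w : EuclideanSpace ℝ (Fin d)} (hc : ∀ j, 0 ≤ D.curv w j) {η a m δ : ℝ}
    (hη : η ∈ Set.Ioo (0 : ℝ) 1) (ha : a ∈ Set.Icc (1 : ℝ) (4 / 3)) (hm : 0 < m) (hδ : 0 < δ)
    (hsample : 3 * coherence (D.rowMat w) * d / η ^ 2 * Real.log (m * d / δ) ≤ s)
    (bad : Finset (Fin s → Fin n))
    (hbad : ∀ σ ∈ bad, ∃ u : EuclideanSpace ℝ (Fin d),
      a * (η * (1 + η / 3)) * ((1 / (n : ℝ)) * ∑ j, D.curv w j * ⟪D.x j, u⟫_ℝ ^ 2) <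
      |(1 / (s : ℝ)) * ∑ r, D.curv w (σ r) * ⟪D.x (σ r), u⟫_ℝ ^ 2 -
        (1 / (n : ℝ)) * ∑ j, D.curv w j * ⟪D.x j, u⟫_ℝ ^ 2|) :
    (bad.card : ℝ) ≤ n ^ s * (2 * (δ / m) ^ (3 / 2 * a ^ 2)) := by
  obtain ⟨hη0, hη1⟩ := hη
  obtain ⟨ha1, ha2⟩ := ha
  have hs0 : (0 : ℝ) < s := by exact_mod_cast hs
  set h := a * (η * (1 + η / 3)) with hh
  have hh0 : 0 < h := by positivity
  have hsq : 1 + h / 3 ≤ (1 + η / 3) ^ 2 := by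
    have : h ≤ 4 / 3 * (η * (1 + η / 3)) :=
      mul_le_mul_of_nonneg_right ha2 (by positivity)
    nlinarith
  have he : coherence (D.rowMat w) * d * (3 / 2 * a ^ 2) * Real.log (m * d / δ) ≤
      s * (h ^ 2 / (2 * (1 + h / 3))) := by
    have h1 : 3 * coherence (D.rowMat w) * d * Real.log (m * d / δ) ≤ s * η ^ 2 := by
      rw [div_mul_eq_mul_div, div_le_iff₀ (by positivity)] at hsample
      exact hsample
    have h2 : a ^ 2 * η ^ 2 / 2 ≤ h ^ 2 / (2 * (1 + h / 3)) := by
      rw [div_le_div_iff₀ (by norm_num) (by positivity)]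
      calc a ^ 2 * η ^ 2 * (2 * (1 + h / 3)) ≤ a ^ 2 * η ^ 2 * (2 * (1 + η / 3) ^ 2) :=
          mul_le_mul_of_nonneg_left (mul_le_mul_of_nonneg_left hsq zero_le_two) (by positivity)
        _ = h ^ 2 * 2 := by rw [hh]; ring
    calc _ = a ^ 2 / 2 * (3 * coherence (D.rowMat w) * d * Real.log (m * d / δ)) := by ring
      _ ≤ a ^ 2 / 2 * (s * η ^ 2) := by gcongr
      _ = s * (a ^ 2 * η ^ 2 / 2) := by ring
      _ ≤ _ := by gcongr
  refine (card_sketch_bad_le (D.rowMat w) hd hn hs hh0.le he bad fun σ hσ => ?_).trans ?_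
  · simp only [sq_toEuclideanLin_rowMat_apply hc]
    exact hbad σ hσ
  · have := Real.natCast_mul_exp_neg_mul_log_le hd hm hδ (e := 3 / 2 * a ^ 2) (by nlinarith)
    exact mul_le_mul_of_nonneg_left (mul_le_mul_of_nonneg_left this zero_le_two) (by positivity)

/-- Hoeffding for the gradients minus their mean, of norm at most `2M`. The threshold gives the
exponent `(3/2)(1 + T)²`, where `T² = 2 log (m/δ)`, and `(1 + T)² ≥ 1 + T²`. -/
theorem card_gradOn_far_le (hn : 0 < n) {s : ℕ} (hs : 0 < s)
    (w : EuclideanSpace ℝ (Fin d)) {m δ : ℝ} (hδ : 0 < δ) (hδm : δ ≤ m)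
    (bad : Finset (Fin s → Fin n))
    (hbad : ∀ σ ∈ bad, 2 * √3 * ((1 + √(2 * Real.log (m / δ))) * √(1 / (s : ℝ))) *
      D.maxGradNorm w < ‖D.gradOn σ w - D.grad w‖) :
    (bad.card : ℝ) ≤ n ^ s * (2 * (Real.exp (-(3 / 2)) * (δ / m) ^ 3)) := by
  have hn0 : (0 : ℝ) < n := by exact_mod_cast hn
  have hs0 : (0 : ℝ) < s := by exact_mod_cast hs
  have hm : 0 < m := hδ.trans_le hδm
  set b : Fin n → EuclideanSpace ℝ (Fin d) :=
    fun j => deriv (D.ell j) (inner ℝ (D.x j) w) • D.x j with hb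
  set M := D.maxGradNorm w with hM
  set T := √(2 * Real.log (m / δ)) with hT
  have hT0 : 0 ≤ T := Real.sqrt_nonneg _
  have hT2 : T ^ 2 = 2 * Real.log (m / δ) :=
    Real.sq_sqrt (mul_nonneg zero_le_two (Real.log_nonneg ((one_le_div hδ).2 hδm)))
  have hbM : ∀ j, ‖b j‖ ≤ M := fun j =>
    le_ciSup (f := fun j => ‖b j‖) (Set.finite_range _).bddAbove j
  have hM0 : 0 ≤ M := (norm_nonneg _).trans (hbM ⟨0, hn⟩)
  set g := (1 / (n : ℝ)) • ∑ j, b j with hg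
  have hgM : ‖g‖ ≤ M := by
    rw [hg, norm_smul, Real.norm_of_nonneg (by positivity), one_div, inv_mul_le_iff₀ hn0]
    refine (norm_sum_le _ _).trans ((Finset.sum_le_sum fun j _ => hbM j).trans ?_)
    simp
  set y : Fin n → EuclideanSpace ℝ (Fin d) := fun j => b j - g with hy
  have hyM : ∀ j, ‖y j‖ ≤ 2 * M := fun j => (norm_sub_le _ _).trans (by linarith [hbM j])
  have hsum : ∑ j, y j = 0 := by
    simp only [hy, Finset.sum_sub_distrib, Finset.sum_const, Finset.card_univ, Fintype.card_fin,
      hg, ← Nat.cast_smul_eq_nsmul ℝ, smul_smul]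
    rw [mul_one_div_cancel hn0.ne', one_smul, sub_self]
  have hdev : ∀ σ : Fin s → Fin n, D.gradOn σ w - D.grad w = (1 / (s : ℝ)) • ∑ r, y (σ r) :=
    fun σ => by
      rw [gradOn, grad, gradOn, add_sub_add_right_eq_sub]
      simp only [hy, Finset.sum_sub_distrib, Finset.sum_const, Finset.card_univ, Fintype.card_fin,
        ← Nat.cast_smul_eq_nsmul ℝ, smul_sub, smul_smul]
      rw [one_div_mul_cancel hs0.ne', one_smul, hg]
      rfl
  rcases hM0.eq_or_lt with h0 | hMpos
  · have hempty : bad = ∅ := by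
      refine Finset.eq_empty_of_forall_notMem fun σ hσ => ?_
      have h1 := hbad σ hσ
      have h2 : ∀ j, y j = 0 := fun j => norm_le_zero_iff.1 (by linarith [hyM j])
      rw [hdev] at h1
      simp [h2, ← h0] at h1
    rw [hempty, Finset.card_empty, Nat.cast_zero]
    positivity
  have h3 : √3 ^ 2 = (3 : ℝ) := Real.sq_sqrt (by norm_num)
  have hss : √(1 / (s : ℝ)) ^ 2 = 1 / s := Real.sq_sqrt (by positivity)
  have hsq0 : 0 < √(1 / (s : ℝ)) := Real.sqrt_pos.2 (by positivity)
  refine (card_norm_sum_ge_le y hsum (R := 2 * M) (by positivity) hyM hs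
    (t := s * (2 * √3 * ((1 + T) * √(1 / (s : ℝ))) * M)) (by positivity) bad fun σ hσ => ?_).trans ?_
  · have h1 := hbad σ hσ
    rw [hdev, norm_smul, Real.norm_of_nonneg (by positivity), one_div_mul_eq_div,
      lt_div_iff₀ hs0] at h1
    linarith
  · have e : (s * (2 * √3 * ((1 + T) * √(1 / (s : ℝ))) * M)) ^ 2 / (2 * s * (2 * M) ^ 2) =
        3 / 2 * (1 + T) ^ 2 := by
      calc _ = s ^ 2 * (4 * √3 ^ 2 * ((1 + T) ^ 2 * √(1 / (s : ℝ)) ^ 2) * M ^ 2) /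
            (2 * s * (2 * M) ^ 2) := by ring
        _ = _ := by rw [h3, hss]; field_simp; norm_num
    rw [e]
    have h4 : Real.exp (-(3 / 2 * (1 + T) ^ 2)) ≤ Real.exp (-(3 / 2)) * (δ / m) ^ 3 := by
      rw [← Real.exp_log (show 0 < (δ / m) ^ 3 by positivity), ← Real.exp_add, Real.exp_le_exp,
        Real.log_pow, ← inv_div m δ, Real.log_inv]
      push_cast
      nlinarith
    gcongr

/-- A constant between `1` and `(1 - α) / (1 - β)` that makes `card_isAtypical_le` hold. -/
noncomputable def slack (m : ℕ) : ℝ := if m ≤ 4 then 4 / 3 else 1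

theorem slack_mem (m : ℕ) : slack m ∈ Set.Icc (1 : ℝ) (4 / 3) := by
  rw [slack]; split_ifs <;> constructor <;> norm_num

/-- For `m ≥ 5` the exponent `3/2` suffices because `2√(1/5) < 0.9`; for `m = 3, 4` the larger slack
raises it above `2`. -/
theorem two_mul_rpow_slack_add_le {m : ℕ} (hm : 3 ≤ m) {z : ℝ} (hz : 0 < z) (hzm : z ≤ 1 / m) :
    2 * z ^ (3 / 2 * slack m ^ 2) + 2 * (Real.exp (-(3 / 2)) * z ^ 3) ≤ 0.95 * z := by
  have hm0 : (3 : ℝ) ≤ m := by exact_mod_cast hm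
  have he := Real.exp_neg_three_halves_le
  have hz3 : z ≤ 1 / 3 := hzm.trans (one_div_le_one_div_of_le (by norm_num) hm0)
  rw [slack]
  split_ifs with h
  · have h1 : z ^ (3 / 2 * (4 / 3 : ℝ) ^ 2) ≤ z ^ (2 : ℝ) :=
      Real.rpow_le_rpow_of_exponent_ge hz (by linarith) (by norm_num)
    rw [Real.rpow_two] at h1
    have h2 : Real.exp (-(3 / 2)) * z ^ 3 ≤ 0.2232 * z ^ 3 := by gcongr
    have h3 : z ^ 2 ≤ 1 / 3 * z := by nlinarith
    have h4 : z ^ 3 ≤ 1 / 9 * z := by nlinarith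
    linarith
  · have h5 : (5 : ℝ) ≤ m := by exact_mod_cast (by omega : 5 ≤ m)
    have hz5 : z ≤ 1 / 5 := hzm.trans (one_div_le_one_div_of_le (by norm_num) h5)
    have h1 : z ^ (3 / 2 * (1 : ℝ) ^ 2) = z * √z := by
      rw [Real.sqrt_eq_rpow, ← Real.rpow_one_add' hz.le (by norm_num)]; norm_num
    have h2 : Real.exp (-(3 / 2)) * z ^ 3 ≤ 0.2232 * z ^ 3 := by gcongr
    have h3 : √z ≤ 0.4473 := (Real.sqrt_le_sqrt hz5).trans (Real.sqrt_le_iff.2 (by norm_num))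
    have h4 : z ^ 3 ≤ 1 / 25 * z := by nlinarith [mul_nonneg hz.le hz.le]
    have h6 : z * √z ≤ z * 0.4473 := by gcongr
    rw [h1]
    linarith

theorem card_isAtypical_le (hn : 0 < n) (hd : 0 < d) {s : ℕ} (hs : 0 < s)
    {w : EuclideanSpace ℝ (Fin d)} (hc : ∀ j, 0 ≤ D.curv w j) {η δ : ℝ} {m : ℕ}
    (hη : η ∈ Set.Ioo (0 : ℝ) 1) (hm : 3 ≤ m) (hδ : δ ∈ Set.Ioo (0 : ℝ) 1)
    (hsample : 3 * coherence (D.rowMat w) * d / η ^ 2 * Real.log (m * d / δ) ≤ s)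
    (bad : Finset (Fin s → Fin n))
    (hbad : ∀ σ ∈ bad, D.IsAtypical (slack m * (η * (1 + η / 3)))
      (2 * √3 * ((1 + √(2 * Real.log (m / δ))) * √(1 / (s : ℝ)))) σ w) :
    (bad.card : ℝ) ≤ n ^ s * (0.95 * (δ / m)) := by
  classical
  have hm0 : (3 : ℝ) ≤ m := by exact_mod_cast hm
  set p : (Fin s → Fin n) → Prop := fun σ =>
    2 * √3 * ((1 + √(2 * Real.log (m / δ))) * √(1 / (s : ℝ))) * D.maxGradNorm w <
      ‖D.gradOn σ w - D.grad w‖ with hp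
  have h1 := card_gradOn_far_le hn hs w hδ.1 (by linarith [hδ.2] : δ ≤ m) (bad.filter p)
    fun σ hσ => (Finset.mem_filter.1 hσ).2
  have h2 := card_hessOn_far_le hn hd hs hc hη (slack_mem m) (by linarith : (0 : ℝ) < m) hδ.1
    hsample (bad.filter fun σ => ¬ p σ) fun σ hσ =>
      (hbad σ (Finset.mem_filter.1 hσ).1).resolve_right (Finset.mem_filter.1 hσ).2
  have hsplit : (bad.card : ℝ) = (bad.filter p).card + (bad.filter fun σ => ¬ p σ).card := by
    exact_mod_cast (Finset.card_filter_add_card_filter_not (s := bad) p).symm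
  have h3 := two_mul_rpow_slack_add_le hm (z := δ / m) (div_pos hδ.1 (by linarith))
    (by gcongr; exact hδ.2.le)
  have h4 := mul_le_mul_of_nonneg_left h3 (show (0 : ℝ) ≤ n ^ s by positivity)
  linarith

end Erm

end Comrade

/-! ### One step from typical samples -/

namespace Comrade

/-- Coercivity makes the determinant nonzero, so `M⁻¹` is a true inverse and not the default value.
-/
theorem toEuclideanLin_toEuclideanCLM_inv {d : ℕ} {M : Matrix (Fin d) (Fin d) ℝ} {c : ℝ}
    (hc : 0 < c) (h : ∀ u, c * ‖u‖ ^ 2 ≤ ⟪u, Matrix.toEuclideanLin M u⟫_ℝ)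
    (v : EuclideanSpace ℝ (Fin d)) :
    Matrix.toEuclideanLin M (Matrix.toEuclideanCLM (𝕜 := ℝ) (n := Fin d) M⁻¹ v) = v := by
  have hdet : IsUnit M.det := by
    rw [isUnit_iff_ne_zero]
    intro h0
    obtain ⟨u, hu, hMu⟩ := Matrix.exists_mulVec_eq_zero_iff.2 h0
    have h1 := h (WithLp.toLp 2 u)
    have h2 : Matrix.toEuclideanLin M (WithLp.toLp 2 u) = 0 := by
      ext i
      simp [Matrix.toEuclideanLin, Matrix.toLpLin_apply, hMu]
    have h3 : 0 < ‖WithLp.toLp 2 u‖ := norm_pos_iff.2 fun h4 => hu (by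
      simpa using congrArg WithLp.ofLp h4)
    rw [h2, inner_zero_right] at h1
    have : 0 < c * ‖WithLp.toLp 2 u‖ ^ 2 := by positivity
    linarith
  have h1 : Matrix.toEuclideanCLM (𝕜 := ℝ) (n := Fin d) M *
      Matrix.toEuclideanCLM (𝕜 := ℝ) (n := Fin d) M⁻¹ = 1 := by
    rw [← map_mul, Matrix.mul_nonsing_inv M hdet, map_one]
  exact congrArg (fun T => T v) h1

namespace Erm

variable {n d : ℕ} {D : Erm n d}

theorem zetaByz_sq {m : ℕ} {α β η : ℝ} {w : EuclideanSpace ℝ (Fin d)} (hκ : 0 ≤ D.kappa w) :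
    D.zetaByz m α β η w ^ 2 = 2 * ((1 - α) / (1 - β)) ^ 2 * (D.nu w / (1 - η)) ^ 2
      + D.nu w ^ 2 * ((1 - α) / (1 - β)) ^ 2 * (η / √((1 - α) * m) + η ^ 2 / (1 - η)) ^ 2
      + 4 * D.kappa w * (α / (1 - β)) ^ 2 * (2 + (D.nu w / (1 - η)) ^ 2) :=
  Real.sq_sqrt (by positivity)

/-- Only the first summand of `ζ²` and the part `8 κ (α/(1-β))²` of the last one are needed; the
rest is nonnegative. -/
theorem two_mul_sq_add_le_zetaByz_sq {m : ℕ} {α β η a r : ℝ} {w : EuclideanSpace ℝ (Fin d)}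
    (hκ : 0 ≤ D.kappa w) (ha0 : 0 ≤ a) (ha : a ≤ (1 - α) / (1 - β)) (hr : 0 ≤ r)
    (hrb : r ≤ α / (1 - β)) :
    2 * (a * (D.nu w / (1 - η))) ^ 2 + 8 * D.kappa w * r ^ 2 ≤ D.zetaByz m α β η w ^ 2 := by
  have h1 : a ^ 2 ≤ ((1 - α) / (1 - β)) ^ 2 := pow_le_pow_left₀ ha0 ha 2
  have h2 : r ^ 2 ≤ (α / (1 - β)) ^ 2 := pow_le_pow_left₀ hr hrb 2
  have h3 := mul_le_mul_of_nonneg_right h1 (sq_nonneg (D.nu w / (1 - η)))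
  have h4 := mul_le_mul_of_nonneg_left h2 (mul_nonneg (show (0 : ℝ) ≤ 8 by norm_num) hκ)
  have h5 : 0 ≤ D.nu w ^ 2 * ((1 - α) / (1 - β)) ^ 2 *
      (η / √((1 - α) * m) + η ^ 2 / (1 - η)) ^ 2 := by positivity
  have h6 : 0 ≤ 4 * D.kappa w * (α / (1 - β)) ^ 2 * (D.nu w / (1 - η)) ^ 2 := by positivity
  rw [zetaByz_sq hκ, mul_pow]
  linarith

theorem sqrt_three_mul_eps_le_epsByz {m s : ℕ} {α β η δ : ℝ} {w : EuclideanSpace ℝ (Fin d)}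
    (hκ : 0 ≤ D.kappa w) (ha : 1 ≤ (1 - α) / (1 - β)) :
    √3 * D.eps m s η δ w ≤ D.epsByz m s α β η δ w := by
  rw [epsByz]
  refine Real.le_sqrt_of_sq_le ?_
  rw [mul_pow, Real.sq_sqrt (by norm_num)]
  have h : 0 ≤ 4 * D.kappa w * (α / (1 - β)) ^ 2 := by positivity
  have h2 : 1 ≤ ((1 - α) / (1 - β)) ^ 2 := one_le_pow₀ ha
  gcongr
  linarith

theorem abs_inner_hess_sub_hessOn_le (hn : 0 < n) (hlam : 0 < D.lam)
    {w : EuclideanSpace ℝ (Fin d)} (hc : ∀ j, 0 ≤ D.curv w j) {h c : ℝ} (hh : 0 ≤ h) {s : ℕ}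
    {σ : Fin s → Fin n} (htyp : ¬ D.IsAtypical h c σ w) (u : EuclideanSpace ℝ (Fin d)) :
    |⟪u, (Matrix.toEuclideanLin (D.hess w) - Matrix.toEuclideanLin (D.hessOn σ w)) u⟫_ℝ| ≤
      D.nu w * h * ⟪u, Matrix.toEuclideanLin (D.hess w) u⟫_ℝ := by
  have h1 := not_lt.1 fun h => htyp (Or.inl ⟨u, h⟩)
  have h2 := mul_le_mul_of_nonneg_left (sum_curv_mul_le_nu_mul hn hlam hc u) hh
  have h3 := D.inner_weightMat_sub id σ (D.curv w) (D.curv w) u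
  rw [← hess_eq_weightMat, ← hessOn_eq_weightMat] at h3
  rw [h3, abs_sub_comm]
  refine (h1.trans h2).trans (le_of_eq ?_)
  ring

/-- The typical gradient error is exactly `√σ_min (1 - η) · 2√3 ε`; the `√3` is covered by the term
`3((1-α)/(1-β))²` of `ε_byz²`, and `1 - η ≤ 1 - τ`. -/
theorem norm_gradOn_sub_grad_le {m s : ℕ} {α β η δ h τ : ℝ} {w : EuclideanSpace ℝ (Fin d)}
    (hκ : 0 ≤ D.kappa w) (hσ : 0 < sigmaMin (D.hess w)) (ha : 1 ≤ (1 - α) / (1 - β)) (hη1 : η < 1)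
    (hτη : τ ≤ η) {σ : Fin s → Fin n}
    (htyp : ¬ D.IsAtypical h (2 * √3 * ((1 + √(2 * Real.log (m / δ))) * √(1 / (s : ℝ)))) σ w) :
    ‖D.gradOn σ w - D.grad w‖ ≤ sigmaMin (D.hess w) * (1 - τ) *
      (2 * D.epsByz m s α β η δ w / √(sigmaMin (D.hess w))) := by
  refine (not_lt.1 fun h => htyp (Or.inr h)).trans ?_
  have h2 := sqrt_three_mul_eps_le_epsByz (D := D) (m := m) (s := s) (η := η) (δ := δ)
    (w := w) hκ ha
  have hMg : 0 ≤ D.maxGradNorm w := Real.iSup_nonneg fun _ => norm_nonneg _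
  have h1η : 0 < 1 - η := by linarith
  have h3 : 2 * √3 * ((1 + √(2 * Real.log (m / δ))) * √(1 / (s : ℝ))) * D.maxGradNorm w =
      √(sigmaMin (D.hess w)) * (1 - η) * (2 * (√3 * D.eps m s η δ w)) := by
    have hs0 : 0 < √(sigmaMin (D.hess w)) := Real.sqrt_pos.2 hσ
    rw [eps]
    generalize √(sigmaMin (D.hess w)) = x at hs0
    field_simp
  have h4 : 0 ≤ D.eps m s η δ w := by rw [eps]; positivity
  have h5 : sigmaMin (D.hess w) * (1 - τ) *
      (2 * D.epsByz m s α β η δ w / √(sigmaMin (D.hess w))) =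
      √(sigmaMin (D.hess w)) * (1 - τ) * (2 * D.epsByz m s α β η δ w) := by
    calc _ = sigmaMin (D.hess w) / √(sigmaMin (D.hess w)) *
          ((1 - τ) * (2 * D.epsByz m s α β η δ w)) := by ring
      _ = _ := by rw [Real.div_sqrt]; ring
  rw [h3, h5]
  have h6 := mul_le_mul_of_nonneg_left (show 1 - η ≤ 1 - τ by linarith)
    (Real.sqrt_nonneg (sigmaMin (D.hess w)))
  exact mul_le_mul h6 (by linarith) (by positivity) (h6.trans' (by positivity))

theorem card_inter_div_card_le {m : ℕ} (hm : 0 < m) {α β : ℝ} (hβ : β < 1)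
    {U B : Finset (Fin m)} (hB : (B.card : ℝ) = α * m) (hU : (U.card : ℝ) = (1 - β) * m) :
    ((U ∩ B).card : ℝ) / U.card ≤ α / (1 - β) := by
  have hm0 : (0 : ℝ) < m := by exact_mod_cast hm
  have h1β : 0 < 1 - β := by linarith
  have h1 : ((U ∩ B).card : ℝ) ≤ α * m := by
    rw [← hB]; exact_mod_cast Finset.card_le_card Finset.inter_subset_right
  rw [hU, div_le_div_iff₀ (by positivity) h1β]
  calc _ ≤ α * m * (1 - β) := by gcongr
    _ = _ := by ring

theorem exists_notMem_notMem_of_card {m : ℕ} (hm : 0 < m) {α β : ℝ} (hαβ : α < β)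
    {U B : Finset (Fin m)} (hB : (B.card : ℝ) = α * m) (hU : (U.card : ℝ) = (1 - β) * m) :
    ∃ k, k ∉ U ∧ k ∉ B := by
  have hm0 : (0 : ℝ) < m := by exact_mod_cast hm
  by_contra! hall
  have h1 : m ≤ (U ∪ B).card := by
    calc m = (Finset.univ : Finset (Fin m)).card := by simp
      _ ≤ _ := Finset.card_le_card fun i _ => Finset.mem_union.2 (or_iff_not_imp_left.2 (hall i))
  have h2 : (m : ℝ) ≤ U.card + B.card := by exact_mod_cast h1.trans (Finset.card_union_le U B)
  rw [hU, hB] at h2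
  nlinarith

theorem mul_profile_le {ν η a : ℝ} (hη : η ∈ Set.Ioo (0 : ℝ) 1) (hY1 : a * (ν / (1 - η)) ≤ 1) :
    ν * (a * (η * (1 + η / 3))) = a * (ν / (1 - η)) * (η * (1 - η) * (1 + η / 3)) ∧
      ν * (a * (η * (1 + η / 3))) ≤ η := by
  obtain ⟨hη0, hη1⟩ := hη
  have h1η : 0 < 1 - η := by linarith
  have h0 : ν * (a * (η * (1 + η / 3))) = a * (ν / (1 - η)) * (η * (1 - η) * (1 + η / 3)) := by
    field_simp
  refine ⟨h0, h0.trans_le ?_⟩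
  have h1 : (1 - η) * (1 + η / 3) ≤ 1 := by nlinarith
  calc _ = a * (ν / (1 - η)) * (η * ((1 - η) * (1 + η / 3))) := by ring
    _ ≤ 1 * (η * 1) := mul_le_mul hY1 (mul_le_mul_of_nonneg_left h1 hη0.le) (by positivity) zero_le_one
    _ = η := by ring

/-- One step of the trimmed approximate Newton method from `w`, when the samples of all honest
machines are typical. -/
theorem norm_sub_trimmed_newton_le (hn : 0 < n) (hd : 0 < d)
    (hconv : ∀ j, ConvexOn ℝ Set.univ (D.ell j)) (hdiff : ∀ j, Differentiable ℝ (D.ell j))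
    (hdiff2 : ∀ j, Differentiable ℝ (deriv (D.ell j))) (hlam : 0 < D.lam)
    {wstar : EuclideanSpace ℝ (Fin d)} (hwstar : IsMinOn D.loss Set.univ wstar) {L : ℝ}
    (hL : ∀ w w', specNorm (D.hess w - D.hess w') ≤ L * ‖w - w'‖)
    {m s : ℕ} (hm : 0 < m) {α β η δ a : ℝ} (hαβ : α < β) (hβ : β < 1 / 2)
    (hη : η ∈ Set.Ioo (0 : ℝ) 1) {B : Finset (Fin m)} (hB : (B.card : ℝ) = α * m)
    (ha1 : 1 ≤ a) (ha : a ≤ (1 - α) / (1 - β)) {w : EuclideanSpace ℝ (Fin d)}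
    (hζ : D.zetaByz m α β η w < 1) {σ : Fin m → Fin s → Fin n}
    {p : Fin m → EuclideanSpace ℝ (Fin d)} {U : Finset (Fin m)} (hU : IsTrimmed β p U)
    (hp : ∀ i ∉ B, p i = D.localUpdate (σ i) w)
    (htyp : ∀ i ∉ B, ¬ D.IsAtypical (a * (η * (1 + η / 3)))
      (2 * √3 * ((1 + √(2 * Real.log (m / δ))) * √(1 / (s : ℝ)))) (σ i) w) :
    ‖w - (1 / (U.card : ℝ)) • ∑ i ∈ U, p i - wstar‖ ≤
      max (√(D.kappa w * (D.zetaByz m α β η w ^ 2 / (1 - D.zetaByz m α β η w ^ 2))) * ‖w - wstar‖)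
        (L / sigmaMin (D.hess w) * ‖w - wstar‖ ^ 2)
      + 2 * D.epsByz m s α β η δ w / √(sigmaMin (D.hess w)) := by
  have hc := curv_nonneg hconv hdiff w
  have hmc := meanCurv_nonneg hconv hdiff wstar w
  have hσ : 0 < sigmaMin (D.hess w) := hlam.trans_le (lam_le_sigmaMin_hess hd hc)
  have hκ1 := one_le_kappa hσ
  have hκ0 := zero_le_one.trans hκ1
  have hν0 := nu_nonneg hn hlam.le w
  have hζ1 : D.zetaByz m α β η w ^ 2 < 1 := pow_lt_one₀ (Real.sqrt_nonneg _) hζ two_ne_zero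
  have hK2 : √(D.kappa w) ^ 2 = D.kappa w := Real.sq_sqrt hκ0
  have h1η : 0 < 1 - η := by linarith [hη.2]
  have hUcard : 0 < U.card := by
    have : (0 : ℝ) < U.card := by
      rw [hU.card_eq]; exact mul_pos (by linarith) (by exact_mod_cast hm)
    exact_mod_cast this
  have hr0 : 0 ≤ ((U ∩ B).card : ℝ) / U.card := by positivity
  obtain ⟨k, hkU, hkB⟩ := exists_notMem_notMem_of_card hm hαβ hB hU.card_eq
  have hY0 : 0 ≤ a * (D.nu w / (1 - η)) :=
    mul_nonneg (zero_le_one.trans ha1) (div_nonneg hν0 h1η.le)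
  have hzY := two_mul_sq_add_le_zetaByz_sq (m := m) (η := η) hκ0 (zero_le_one.trans ha1) ha hr0
    (card_inter_div_card_le hm (by linarith) hB hU.card_eq)
  have hY1 : a * (D.nu w / (1 - η)) ≤ 1 := by
    have h1 := mul_nonneg (mul_nonneg (show (0 : ℝ) ≤ 8 by norm_num) hκ0)
      (sq_nonneg (((U ∩ B).card : ℝ) / U.card))
    exact abs_le_one_iff_mul_self_le_one.2 (by linarith) |> le_of_abs_le
  obtain ⟨hτY, hτη⟩ := mul_profile_le hη hY1
  have hh0 : 0 ≤ a * (η * (1 + η / 3)) :=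
    mul_nonneg (zero_le_one.trans ha1) (mul_nonneg hη.1.le (by linarith [hη.1]))
  have hL0 : 0 ≤ L * ‖w - wstar‖ := (norm_nonneg _).trans (hL w wstar)
  have hGΔ : Matrix.toEuclideanLin (D.weightMat id (D.meanCurv wstar w)) (w - wstar) =
      D.grad w := by
    rw [meanCurv_apply_sub, grad_eq_zero_of_isMinOn hdiff hwstar, sub_zero]
  have hsymm : (Matrix.toEuclideanLin (D.hess w)).IsSymmetric := by
    rw [hess_eq_weightMat]; exact D.isSymmetric_weightMat id _
  have hsymm' : ∀ i, (Matrix.toEuclideanLin (D.hessOn (σ i) w)).IsSymmetric := fun i => by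
    rw [hessOn_eq_weightMat]; exact D.isSymmetric_weightMat (σ i) _
  have hcoer : ∀ u, D.lam * ‖u‖ ^ 2 ≤ ⟪u, Matrix.toEuclideanLin (D.hess w) u⟫_ℝ := fun u => by
    rw [hess_eq_weightMat]; exact D.lam_mul_norm_sq_le id hc u
  have hcoer' : ∀ i u, D.lam * ‖u‖ ^ 2 ≤ ⟪u, Matrix.toEuclideanLin (D.hessOn (σ i) w) u⟫_ℝ :=
    fun i u => by rw [hessOn_eq_weightMat]; exact D.lam_mul_norm_sq_le (σ i) hc u
  have hinv : ∀ (i : Fin m) (v : EuclideanSpace ℝ (Fin d)), Matrix.toEuclideanLin (D.hessOn (σ i) w)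
      (Matrix.toEuclideanCLM (𝕜 := ℝ) (n := Fin d) (D.hessOn (σ i) w)⁻¹ v) = v := fun i v =>
    toEuclideanLin_toEuclideanCLM_inv hlam (hcoer' i) v
  -- An honest message splits as `K⁻¹ g + K⁻¹ (g_i - g)`. The abstract `β` is `L‖Δ‖ / (2 σ_min)`,
  -- not the trimming fraction.
  have hstep := norm_sub_trimmed_average_le (H := Matrix.toEuclideanLin (D.hess w))
    (G := Matrix.toEuclideanLin (D.weightMat id (D.meanCurv wstar w)))
    (fun i => Matrix.toEuclideanLin (D.hessOn (σ i) w))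
    hsymm (D.isSymmetric_weightMat id _) hsymm' (σ := sigmaMin (D.hess w)) (c := √(D.kappa w))
    (ν := D.nu w) (β := L * ‖w - wstar‖ / (2 * sigmaMin (D.hess w)))
    (τ := D.nu w * (a * (η * (1 + η / 3))))
    (ε := 2 * D.epsByz m s α β η δ w / √(sigmaMin (D.hess w))) hσ (Real.sqrt_nonneg _) hν0
    (nu_lt_one hn hlam w) (div_nonneg hL0 (by linarith)) (mul_nonneg hν0 hh0)
    (hτη.trans_lt hη.2)
    (sigmaMin_mul_norm_sq_le hsymm fun u =>
      (mul_nonneg hlam.le (sq_nonneg _)).trans (hcoer u))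
    (fun u => by
      rw [hK2, kappa, div_mul_cancel₀ _ hσ.ne']
      exact inner_toEuclideanLin_le _ u)
    (fun u => (one_sub_nu_mul_inner_hess_le hn hlam hc u).trans (D.lam_mul_norm_sq_le id hmc u))
    (fun u => by
      rw [div_mul_eq_mul_div, mul_div_mul_right _ _ hσ.ne']
      exact abs_inner_hess_sub_mean_le hdiff2 hL wstar w u)
    U B hUcard
    (fun i hi => abs_inner_hess_sub_hessOn_le hn hlam hc hh0 (htyp i hi))
    (Δ := w - wstar) (q := Matrix.toEuclideanCLM (𝕜 := ℝ) (n := Fin d) (D.hess w)⁻¹ (D.grad w))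
    ((toEuclideanLin_toEuclideanCLM_inv hlam hcoer _).trans hGΔ.symm) p
    (fun i => Matrix.toEuclideanCLM (𝕜 := ℝ) (n := Fin d) (D.hessOn (σ i) w)⁻¹ (D.grad w))
    (fun i => Matrix.toEuclideanCLM (𝕜 := ℝ) (n := Fin d) (D.hessOn (σ i) w)⁻¹
      (D.gradOn (σ i) w - D.grad w))
    (fun i => D.gradOn (σ i) w - D.grad w)
    (fun i hi => by rw [hp i hi, localUpdate, ← map_add, add_sub_cancel])
    (fun i _ => (hinv i _).trans hGΔ.symm) (fun i _ => hinv i _)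
    (fun i hi => norm_gradOn_sub_grad_le hκ0 hσ (ha1.trans ha) hη.2 hτη (htyp i hi))
    hkB (fun i hi => hU.norm_le i hi k hkU) rfl
  have hfac := trimmed_newton_factor_le (β := L * ‖w - wstar‖ / (2 * sigmaMin (D.hess w)))
    hη.1.le hη.2.le hr0 (Real.one_le_sqrt.2 hκ1) hY0
    (by
      rw [mul_assoc, div_mul_cancel₀ _ h1η.ne']
      exact le_mul_of_one_le_left hν0 ha1 : D.nu w ≤ a * (D.nu w / (1 - η)) * (1 - η))
    (by rw [hK2]; exact kappa_mul_one_sub_nu_le hn hd hlam hc) (by rw [hK2]; exact hzY) hζ1 hτY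
  rw [sub_right_comm]
  refine hstep.trans (add_le_add ?_ le_rfl)
  refine (mul_le_mul_of_nonneg_right hfac (norm_nonneg _)).trans (le_of_eq ?_)
  rw [max_mul_of_nonneg _ _ (norm_nonneg _), Real.sqrt_mul hκ0]
  congr 1
  field_simp

/-- The numbers of machines for which the hypotheses of the theorem can hold. -/
theorem three_le_and_slack_le {m : ℕ} (hm : 0 < m) {α β η : ℝ} (hα : 0 ≤ α) (hαβ : α < β)
    (hβ : β < 1 / 2) {B U : Finset (Fin m)} (hB : (B.card : ℝ) = α * m)
    (hU : (U.card : ℝ) = (1 - β) * m) {w : EuclideanSpace ℝ (Fin d)} (hκ : 1 ≤ D.kappa w)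
    (hζ : D.zetaByz m α β η w < 1) : 3 ≤ m ∧ slack m ≤ (1 - α) / (1 - β) := by
  have hm0 : (0 : ℝ) < m := by exact_mod_cast hm
  have h1β : 0 < 1 - β := by linarith
  have hUm : U.card + B.card < m := by
    have : (U.card : ℝ) + B.card < m := by rw [hU, hB]; nlinarith
    exact_mod_cast this
  have hUm2 : m < 2 * U.card := by
    have : (m : ℝ) < 2 * U.card := by rw [hU]; nlinarith
    exact_mod_cast this
  refine ⟨by omega, ?_⟩
  rw [slack]
  split_ifs with h4
  · have hζ0 : 0 ≤ D.zetaByz m α β η w := Real.sqrt_nonneg _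
    have hζ2 := zetaByz_sq (m := m) (α := α) (β := β) (η := η) (w := w) (by linarith)
    have hζ1 : D.zetaByz m α β η w ^ 2 < 1 := pow_lt_one₀ hζ0 hζ two_ne_zero
    have h8 : 8 * (α / (1 - β)) ^ 2 < 1 := by
      have e1 : 0 ≤ 2 * ((1 - α) / (1 - β)) ^ 2 * (D.nu w / (1 - η)) ^ 2 := by positivity
      have e2 : 0 ≤ D.nu w ^ 2 * ((1 - α) / (1 - β)) ^ 2 *
          (η / √((1 - α) * m) + η ^ 2 / (1 - η)) ^ 2 := by positivity
      have e3 : 4 * 1 * (α / (1 - β)) ^ 2 * 2 ≤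
          4 * D.kappa w * (α / (1 - β)) ^ 2 * (2 + (D.nu w / (1 - η)) ^ 2) := by
        have : 2 ≤ 2 + (D.nu w / (1 - η)) ^ 2 := by linarith [sq_nonneg (D.nu w / (1 - η))]
        gcongr
      linarith
    have h9 : 8 * B.card ^ 2 < U.card ^ 2 := by
      have e : α / (1 - β) = B.card / U.card := by rw [hB, hU]; field_simp
      have hU0 : (0 : ℝ) < U.card := by rw [hU]; positivity
      rw [e, div_pow, ← mul_div_assoc, div_lt_one (by positivity)] at h8
      exact_mod_cast h8
    -- With at most four machines a Byzantine one would leave `|U| ≤ 2`, against `8|B|² < |U|²`. So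
    -- `α = 0`, and `1/(1 - β) = m/|U| ≥ m/(m - 1) ≥ 4/3`.
    have hB0 : B.card = 0 := by
      by_contra hne
      have h1 : 1 ≤ B.card := by omega
      have h2 : U.card ≤ 2 := by omega
      nlinarith
    have hα0 : α = 0 := by
      rw [hB0, Nat.cast_zero] at hB
      rcases mul_eq_zero.1 hB.symm with h | h
      · exact h
      · linarith
    rw [hα0, sub_zero, le_div_iff₀ h1β]
    have h5 : (U.card : ℝ) + 1 ≤ m := by exact_mod_cast (by omega : U.card + 1 ≤ m)
    have h6 : (m : ℝ) ≤ 4 := by exact_mod_cast h4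
    rw [hU] at h5
    nlinarith
  · rw [one_le_div h1β]; linarith

end Erm

end Comrade

/-! ### Union bound, measurability and the final assembly -/

theorem Fintype.card_apply_mem {κ X : Type*} [Fintype κ] [DecidableEq κ] [Fintype X]
    [DecidableEq X] (i : κ) (A : Finset X) :
    (Finset.univ.filter fun σ : κ → X => σ i ∈ A).card =
      A.card * Fintype.card X ^ (Fintype.card κ - 1) := by
  have h : (Finset.univ.filter fun σ : κ → X => σ i ∈ A) =
      Fintype.piFinset (Function.update (fun _ => Finset.univ) i A) := by
    ext σ
    simp only [Finset.mem_filter, Finset.mem_univ, true_and, Fintype.mem_piFinset]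
    refine ⟨fun hσ k => ?_, fun hσ => by simpa using hσ i⟩
    rcases eq_or_ne k i with rfl | hk
    · simpa using hσ
    · simp [Function.update_of_ne hk]
  rw [h, Fintype.card_piFinset]
  have h2 : ∀ k, (Function.update (fun _ => (Finset.univ : Finset X)) i A k).card =
      Function.update (fun _ => Fintype.card X) i A.card k := fun k => by
    rcases eq_or_ne k i with rfl | hk
    · simp
    · simp [Function.update_of_ne hk]
  simp only [h2]
  rw [Finset.prod_update_of_mem (Finset.mem_univ i), Finset.prod_const,
    Finset.card_sdiff_of_subset (Finset.subset_univ _), Finset.card_singleton, Finset.card_univ]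

/-- If a uniform variable on a finite type is independent of `X`, and for almost every value of `X`
at most a fraction `c` of the points is bad, then it is bad with probability at most `c`. -/
theorem ProbabilityTheory.HasLaw.measure_bad_le {Ω E ι : Type*} [MeasurableSpace Ω]
    [MeasurableSpace E] [Fintype ι] [Nonempty ι] [MeasurableSpace ι] [MeasurableSingletonClass ι]
    {P : Measure Ω} [IsProbabilityMeasure P] {X : Ω → E} {Y : Ω → ι}
    (hY : HasLaw Y (uniformOn Set.univ) P) (hX : AEMeasurable X P) (hXY : IndepFun X Y P)
    {bad : E → ι → Prop} (hmeas : ∀ i, MeasurableSet {x | bad x i}) {c : ℝ}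
    (hcard : ∀ᵐ ω ∂P, ∀ s : Finset ι, (∀ i ∈ s, bad (X ω) i) →
      (s.card : ℝ) ≤ c * Fintype.card ι) :
    P {ω | bad (X ω) (Y ω)} ≤ ENNReal.ofReal c := by
  classical
  have hG : MeasurableSet {q : E × ι | bad q.1 q.2} := by
    have : {q : E × ι | bad q.1 q.2} = ⋃ i, {x | bad x i} ×ˢ {i} := by
      ext ⟨x, i⟩
      simp
    rw [this]
    exact MeasurableSet.iUnion fun i => (hmeas i).prod (measurableSet_singleton i)
  have : IsProbabilityMeasure (P.map Y) := Measure.isProbabilityMeasure_map hY.aemeasurable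
  -- Independence makes the joint law a product, and Fubini conditions on the value of `X`.
  have h1 : P {ω | bad (X ω) (Y ω)} = ∫⁻ ω, P.map Y {i | bad (X ω) i} ∂P := by
    have h2 := (indepFun_iff_map_prod_eq_prod_map_map hX hY.aemeasurable).1 hXY
    have h3 : P {ω | bad (X ω) (Y ω)} = P.map (fun ω => (X ω, Y ω)) {q | bad q.1 q.2} :=
      (Measure.map_apply_of_aemeasurable (hX.prodMk hY.aemeasurable) hG).symm
    rw [h3, h2, Measure.prod_apply hG,
      lintegral_map' (measurable_measure_prodMk_left hG).aemeasurable hX]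
    rfl
  rw [h1]
  calc _ ≤ ∫⁻ _, ENNReal.ofReal c ∂P := by
        refine lintegral_mono_ae ?_
        filter_upwards [hcard] with ω hω
        have h2 := hω (Finset.univ.filter fun i => bad (X ω) i) fun i hi =>
          (Finset.mem_filter.1 hi).2
        have h3 : {i | bad (X ω) i} =
            ((Finset.univ.filter fun i => bad (X ω) i : Finset ι) : Set ι) := by
          ext i; simp
        rw [hY.map_eq, uniformOn_univ, h3, Measure.count_apply_finset]
        have hpos : (0 : ℝ) < Fintype.card ι := by exact_mod_cast Fintype.card_pos
        refine ENNReal.div_le_of_le_mul ?_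
        rw [← ENNReal.ofReal_natCast, ← ENNReal.ofReal_natCast, ← ENNReal.ofReal_mul' hpos.le]
        exact ENNReal.ofReal_le_ofReal h2
    _ = _ := by simp

namespace Comrade

namespace Erm

variable {n d : ℕ} {D : Erm n d}

theorem measurable_curv (j : Fin n) : Measurable fun w => D.curv w j :=
  (measurable_deriv _).comp (by fun_prop)

theorem measurable_gradOn {s : ℕ} (σ : Fin s → Fin n) : Measurable (D.gradOn σ) := by
  have h : ∀ j, Measurable fun w => deriv (D.ell j) (inner ℝ (D.x j) w) := fun j =>
    (measurable_deriv _).comp (by fun_prop)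
  unfold gradOn
  exact ((Finset.measurable_fun_sum _ fun r _ => (h _).smul_const _).const_smul (1 / (s : ℝ))).add
    (measurable_id.const_smul D.lam)

theorem measurable_maxGradNorm : Measurable D.maxGradNorm := by
  have h : ∀ j, Measurable fun w => deriv (D.ell j) (inner ℝ (D.x j) w) := fun j =>
    (measurable_deriv _).comp (by fun_prop)
  unfold maxGradNorm
  exact Measurable.iSup fun j => ((h j).smul_const _).norm

/-- A strict inequality between functions continuous in `u` that holds somewhere holds on a dense
sequence, so the existential over `u` is a countable union. -/
theorem measurableSet_isAtypical (h c : ℝ) {s : ℕ} (σ : Fin s → Fin n) :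
    MeasurableSet {w | D.IsAtypical h c σ w} := by
  refine MeasurableSet.union ?_ (measurableSet_lt (measurable_maxGradNorm.const_mul c)
    ((measurable_gradOn σ).sub (measurable_gradOn id)).norm)
  set F : EuclideanSpace ℝ (Fin d) → EuclideanSpace ℝ (Fin d) → ℝ := fun u w =>
    h * ((1 / (n : ℝ)) * ∑ j, D.curv w j * ⟪D.x j, u⟫_ℝ ^ 2) with hF
  set G : EuclideanSpace ℝ (Fin d) → EuclideanSpace ℝ (Fin d) → ℝ := fun u w =>
    |(1 / (s : ℝ)) * ∑ r, D.curv w (σ r) * ⟪D.x (σ r), u⟫_ℝ ^ 2 -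
      (1 / (n : ℝ)) * ∑ j, D.curv w j * ⟪D.x j, u⟫_ℝ ^ 2| with hG
  have e : {w | ∃ u, F u w < G u w} =
      ⋃ k, {w | F (TopologicalSpace.denseSeq _ k) w < G (TopologicalSpace.denseSeq _ k) w} := by
    ext w
    simp only [Set.mem_ofPred_eq, Set.mem_iUnion]
    refine ⟨fun ⟨u, hu⟩ => ?_, fun ⟨k, hk⟩ => ⟨_, hk⟩⟩
    have hcF : Continuous fun u => F u w := by simp only [hF]; fun_prop
    have hcG : Continuous fun u => G u w := by simp only [hG]; fun_prop
    exact (TopologicalSpace.denseRange_denseSeq _).exists_mem_open (isOpen_lt hcF hcG) ⟨u, hu⟩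
  change MeasurableSet {w | ∃ u, F u w < G u w}
  rw [e]
  refine MeasurableSet.iUnion fun k => measurableSet_lt ?_ ?_
  · exact ((Finset.measurable_fun_sum _ fun j _ =>
      (measurable_curv j).mul_const _).const_mul _).const_mul _
  · exact (((Finset.measurable_fun_sum _ fun r _ =>
      (measurable_curv (σ r)).mul_const _).const_mul _).sub ((Finset.measurable_fun_sum _ fun j _ =>
      (measurable_curv j).mul_const _).const_mul _)).abs

theorem card_exists_isAtypical_le (hn : 0 < n) (hd : 0 < d) {s : ℕ} (hs : 0 < s)
    {w : EuclideanSpace ℝ (Fin d)} (hc : ∀ j, 0 ≤ D.curv w j) {η δ : ℝ} {m : ℕ}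
    (hη : η ∈ Set.Ioo (0 : ℝ) 1) (hm : 3 ≤ m) (hδ : δ ∈ Set.Ioo (0 : ℝ) 1)
    (hsample : 3 * coherence (D.rowMat w) * d / η ^ 2 * Real.log (m * d / δ) ≤ s)
    (B : Finset (Fin m)) (bad : Finset (Fin m → Fin s → Fin n))
    (hbad : ∀ σ ∈ bad, ∃ i ∉ B, D.IsAtypical (slack m * (η * (1 + η / 3)))
      (2 * √3 * ((1 + √(2 * Real.log (m / δ))) * √(1 / (s : ℝ)))) (σ i) w) :
    (bad.card : ℝ) ≤ 0.95 * δ * Fintype.card (Fin m → Fin s → Fin n) := by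
  classical
  set A : Finset (Fin s → Fin n) := Finset.univ.filter fun σ =>
    D.IsAtypical (slack m * (η * (1 + η / 3)))
      (2 * √3 * ((1 + √(2 * Real.log (m / δ))) * √(1 / (s : ℝ)))) σ w with hA
  have hAcard : (A.card : ℝ) ≤ n ^ s * (0.95 * (δ / m)) :=
    card_isAtypical_le hn hd hs hc hη hm hδ hsample A fun σ hσ => (Finset.mem_filter.1 hσ).2
  have hsub : bad ⊆ Finset.univ.biUnion fun i : Fin m =>
      Finset.univ.filter fun σ : Fin m → Fin s → Fin n => σ i ∈ A := fun σ hσ => by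
    obtain ⟨i, -, hi⟩ := hbad σ hσ
    simp only [Finset.mem_biUnion, Finset.mem_univ, true_and, Finset.mem_filter, hA]
    exact ⟨i, hi⟩
  have h1 : bad.card ≤ m * (A.card * (n ^ s) ^ (m - 1)) := by
    refine (Finset.card_le_card hsub).trans (Finset.card_biUnion_le.trans ?_)
    simp only [Fintype.card_apply_mem]
    simp
  have hm0 : (m : ℝ) ≠ 0 := by exact_mod_cast (by omega : m ≠ 0)
  calc (bad.card : ℝ) ≤ m * (A.card * (n ^ s) ^ (m - 1)) := by exact_mod_cast h1
    _ ≤ m * (n ^ s * (0.95 * (δ / m)) * (n ^ s) ^ (m - 1)) := by gcongr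
    _ = 0.95 * δ * ((n ^ s) ^ (m - 1) * n ^ s) := by field_simp
    _ = _ := by
      rw [← pow_succ, Nat.sub_add_cancel (by omega)]
      simp

theorem nu_lt_one_of_zetaByz_lt_one {m : ℕ} {α β η : ℝ} (hα : 0 ≤ α) (hαβ : α < β) (hβ : β < 1)
    (hη : η ∈ Set.Ioo (0 : ℝ) 1) {w : EuclideanSpace ℝ (Fin d)} (hκ : 0 ≤ D.kappa w)
    (hζ : D.zetaByz m α β η w < 1) : D.nu w < 1 := by
  have h1 := two_mul_sq_add_le_zetaByz_sq (m := m) (η := η) (a := 1) (r := 0) hκ zero_le_one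
    ((one_le_div (by linarith)).2 (by linarith) : 1 ≤ (1 - α) / (1 - β)) le_rfl
    (div_nonneg hα (by linarith))
  have h2 : D.zetaByz m α β η w ^ 2 < 1 := pow_lt_one₀ (Real.sqrt_nonneg _) hζ two_ne_zero
  have h3 : D.nu w / (1 - η) < 1 := by nlinarith
  rw [div_lt_one (by linarith [hη.2])] at h3
  linarith [hη.1]

end Erm

end Comrade

/-- The failure probability is bounded as an outer measure, because the Byzantine messages are
arbitrary, possibly non-measurable, functions of the outcome `ω`. -/
theorem theorem2 {n d m s : ℕ} (hn : 0 < n) (hd : 0 < d) (hm : 0 < m) (hs : 0 < s)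
    (D : Comrade.Erm n d)
    (hconv : ∀ j, ConvexOn ℝ Set.univ (D.ell j))
    (hdiff : ∀ j, Differentiable ℝ (D.ell j))
    (hdiff2 : ∀ j, Differentiable ℝ (deriv (D.ell j)))
    (hlam : 0 ≤ D.lam)
    (hstrong : ∃ c : ℝ, 0 < c ∧ StrongConvexOn Set.univ c D.loss)
    (wstar : EuclideanSpace ℝ (Fin d)) (hwstar : IsMinOn D.loss Set.univ wstar)
    (L : ℝ)
    (hL : ∀ w w', Comrade.specNorm (D.hess w - D.hess w') ≤ L * ‖w - w'‖)
    (α β η δ : ℝ) (hα : 0 ≤ α) (hαβ : α < β) (hβ : β < 1 / 2)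
    (hη : η ∈ Set.Ioo (0 : ℝ) 1) (hδ : δ ∈ Set.Ioo (0 : ℝ) 1)
    (B : Finset (Fin m)) (hB : (B.card : ℝ) = α * m)
    {Ω : Type*} [MeasurableSpace Ω] (P : MeasureTheory.Measure Ω)
    [MeasureTheory.IsProbabilityMeasure P]
    (S : ℕ → Ω → Fin m → Fin s → Fin n)
    (p : ℕ → Ω → Fin m → EuclideanSpace ℝ (Fin d))
    (U : ℕ → Ω → Finset (Fin m))
    (w : ℕ → Ω → EuclideanSpace ℝ (Fin d))
    (hrun : ∀ ω, Comrade.IsRun D B β 1 (fun t => S t ω) (fun t => p t ω) (fun t => U t ω)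
      (fun t => w t ω))
    (t : ℕ)
    (hS : ProbabilityTheory.HasLaw (S t) (ProbabilityTheory.uniformOn Set.univ) P)
    (hw : AEMeasurable (w t) P)
    (hindep : ProbabilityTheory.IndepFun (w t) (S t) P)
    (hsample : ∀ᵐ ω ∂P, 3 * Comrade.coherence (D.rowMat (w t ω)) * d / η ^ 2
      * Real.log (m * d / δ) ≤ s)
    (hzeta : ∀ᵐ ω ∂P, D.zetaByz m α β η (w t ω) < 1) :
    P {ω | ¬ (‖w (t + 1) ω - wstar‖ ≤
        max (√(D.kappa (w t ω) * (D.zetaByz m α β η (w t ω) ^ 2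
              / (1 - D.zetaByz m α β η (w t ω) ^ 2))) * ‖w t ω - wstar‖)
            (L / Comrade.sigmaMin (D.hess (w t ω)) * ‖w t ω - wstar‖ ^ 2)
          + 2 * D.epsByz m s α β η δ (w t ω) / √(Comrade.sigmaMin (D.hess (w t ω))))}
      < ENNReal.ofReal δ := by
  obtain ⟨c, hc0, hstrong⟩ := hstrong
  have hcurv := fun v => Comrade.Erm.curv_nonneg (D := D) hconv hdiff v
  have hcoer := fun v => Comrade.Erm.coercive_hess (D := D) hdiff hdiff2 hstrong v
  have hκ : ∀ v, 1 ≤ D.kappa v := fun v => Comrade.Erm.one_le_kappa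
    (hc0.trans_le (Comrade.le_sigmaMin_of_coercive hd (hcoer v)))
  -- Positivity of `λ` and the bounds on `m` do not depend on the outcome, so a single one with `ζ <
  -- 1` yields them.
  obtain ⟨ω₀, hω₀⟩ := hzeta.exists
  have hlam0 : 0 < D.lam := Comrade.Erm.lam_pos_of_nu_lt_one hn hlam (hcurv _) hd hc0 (hcoer _)
    (Comrade.Erm.nu_lt_one_of_zetaByz_lt_one hα hαβ (by linarith) hη
      (zero_le_one.trans (hκ _)) hω₀)
  obtain ⟨hm3, hslack⟩ := Comrade.Erm.three_le_and_slack_le hm hα hαβ hβ hB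
    ((hrun ω₀).trimmed t).card_eq (hκ _) hω₀
  have : Nonempty (Fin n) := ⟨⟨0, hn⟩⟩
  have hbad := hS.measure_bad_le hw hindep
    (bad := fun v σ => ∃ i ∉ B, D.IsAtypical (Comrade.Erm.slack m * (η * (1 + η / 3)))
      (2 * √3 * ((1 + √(2 * Real.log (m / δ))) * √(1 / (s : ℝ)))) (σ i) v)
    (fun σ => by
      simp only [Set.ofPred_exists]
      refine MeasurableSet.iUnion fun i => ?_
      by_cases hi : i ∈ B
      · simp [hi]
      · simpa [hi] using Comrade.Erm.measurableSet_isAtypical _ _ (σ i))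
    (c := 0.95 * δ)
    (by
      filter_upwards [hsample] with ω hω s' hs'
      exact Comrade.Erm.card_exists_isAtypical_le hn hd hs (hcurv _) hη hm3 hδ hω B s' hs')
  -- The constant `0.95` makes the bound strict. Monotonicity of the outer measure suffices: almost
  -- surely, failure implies an atypical honest sample.
  refine lt_of_le_of_lt ((measure_mono_ae ?_).trans hbad)
    ((ENNReal.ofReal_lt_ofReal_iff hδ.1).2 (by linarith [hδ.1]))
  filter_upwards [hzeta] with ω hω hfail
  by_contra hgood
  refine hfail ?_
  rw [(hrun ω).step t, one_smul]
  exact Comrade.Erm.norm_sub_trimmed_newton_le hn hd hconv hdiff hdiff2 hlam0 hwstar hL hm hαβ hβ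
    hη hB (Comrade.Erm.slack_mem m).1 hslack hω ((hrun ω).trimmed t) ((hrun ω).honest t)
    fun i hi hat => hgood ⟨i, hi, hat⟩
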